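/- **Setting.** Let $\mathcal O,\mathcal A$ be finite sets ($\mathcal A\neq\emptyset$), $H\ge 1$, and consider an episodic process: given the history $\tau_{h-1}=(o_1,a_1,\dots,o_{h-1},a_{h-1})$ the next observation is drawn from $\mathbb P(\cdot\mid\tau_{h-1})\in\Delta_{\mathcal O}$, and the action is drawn from a history-dependent policy $\pi(\cdot\mid\tau_{h-1},o_h)\in\Delta_{\mathcal A}$; after step $H$ only a dummy observation occurs. Put $\pi(\tau_H)=\prod_h\pi(a_h\mid\tau_{h-1},o_h)$, and let $\mathbb P^\pi(\tau_H)$ be the law of the trajectory. The known rewards are functions $r_h(\tau_h)\in[0,1]$, $V^\pi=\mathbb E_\pi[\sum_{h=1}^H r_h]$, $V^*=\sup_\pi V^\pi$. A test is a sequence $t=(o_h,a_h,\dots,a_{h+W-2},o_{h+W-1})$, $W\ge1$ (observations may be dummy); $\mathbb P(t\mid\tau_{h-1})$ is the probability of observing $o_{h:h+W-1}$ after $\tau_{h-1}$ when the actions $a_{h:h+W-2}$ are executed, and is $0$ if $\tau_{h-1}$ has probability $0$ under every policy. For $0\le h\le H-1$ let $D_h=[\mathbb P(t\mid\tau_h)]_{t,\tau_h}$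 (all tests, all histories of length $h$) and $d_{\mathrm{PSR}}=\max_h\operatorname{rank}D_h$. Finite sets of tests $\mathcal U_1,\dots,\mathcal U_H$ are core test sets if for every $h$ the rows of $D_h$ in $\mathcal U_{h+1}$ have rank $\operatorname{rank}D_h$. Put $q_{\tau_h}=[\mathbb P(u\mid\tau_h)]_{u\in\mathcal U_{h+1}}$. A core matrix $K_h$ is a matrix of rank $\operatorname{rank}D_h$ whose columns are $q_{\tau}$ for $\operatorname{rank}D_h$ histories $\tau$ of length $h$. The process is $\alpha$-regular ($\alpha>0$) if for every $0\le h\le H-1$ some core matrix satisfies $\|K_h^\dagger\|_{1\to1}\le1/\alpha$. Let $\mathcal U_{A,h}$ be the set of action sequences of the tests in $\mathcal U_h$, $|\mathcal U|=\max_{h\in[H]}|\mathcal U_h|$, $|\mathcal U_A|=\max_{h\in[H]}|\mathcal U_{A,h}|$. Let $\mathcal F$ be a class of tabular parameters $f=\{M_{o,a,h},q_0\}_{o\in\mathcal O,a\in\mathcal A,h\in[H-1]}$, $M_{o,a,h}\in\mathbb R^{\mathcal U_{h+1}\times\mathcal U_h}$, $q_0\in\mathbb R^{\mathcal U_1}$,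 with all entries bounded by $1$ in absolute value, and let $$\mathbb P_f^\pi(\tau_H)=e_{o_H}^\top M_{o_{H-1},a_{H-1},H-1}\cdots M_{o_1,a_1,1}\,q_0\cdot\pi(\tau_H),$$ where $e_o$ is the one-hot vector indexing the test $o$ in $\mathcal U_H$; $V_f^\pi$ is the corresponding value. The $\epsilon$-bracket number $\mathcal N_{\mathcal F}(\epsilon)$ is the least $N$ for which there are pairs $(g_1^i,g_2^i)_{i\le N}$ of real functions of $(\pi,\tau_H)$ with $\|g_1^i(\pi,\cdot)-g_2^i(\pi,\cdot)\|_1\le\epsilon$ for all $\pi$, such that for each $f\in\mathcal F$ some $i$ has $g_1^i\le\mathbb P_f\le g_2^i$ for all $(\pi,\tau_H)$. **Assumptions.** (1) $\mathcal U_1,\dots,\mathcal U_H$ are core test sets of the true process, which is $\alpha$-regular. (2) Every one-step test $o\in\mathcal O$ is in $\mathcal U_H$. (3) Some $f^*\in\mathcal F$ induces the true trajectory laws; and for every $f\in\mathcal F$, $\mathbb P_f$ is the trajectory law of an $\alpha$-regular process with core test sets $\mathcal U_1,\dots,\mathcal U_H$. **CRANE** with parameter $\beta$: for $k=1,\dots,K$,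 let $\mathcal B^k$ be the set of $f\in\mathcal F$ whose log-likelihood $\sum\log\mathbb P_f^{\pi}(\tau_H)$ on all pairs $(\pi,\tau_H)$ collected so far is at least its supremum over $\mathcal F$ minus $\beta$; choose $(f^k,\pi^k)\in\arg\max_{f\in\mathcal B^k,\pi}V_f^\pi$; then for each $0\le h\le H-1$ and each $s\in\mathcal U_{A,h+1}$ collect one trajectory with the policy that follows $\pi^k$ at steps $1,\dots,h-1$, acts uniformly at step $h$, then takes the actions $s$, then acts uniformly. The output is $\widehat\pi=\mathrm{Unif}\{\pi^1,\dots,\pi^K\}$. **Claim.** There are absolute constants $c,C>0$ and a polynomial $P$ in nine variables such that in every such setting the following holds. (i) For every $\epsilon\in(0,1]$, $\mathcal N_{\mathcal F}(\epsilon)$ is finite and $$\log\mathcal N_{\mathcal F}(\epsilon)\le C\,|\mathcal U|^2|\mathcal O||\mathcal A|H^2\log\frac{H|\mathcal O||\mathcal A||\mathcal U_A||\mathcal U|}{\alpha\,\epsilon}.$$ (ii) For every $\delta\in(0,1]$, $\epsilon>0$ and integer $K\ge1$ with $$K\ge\frac1{\epsilon^2}\,P\big(d_{\mathrm{PSR}},|\mathcal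 U_A|,1/\alpha,|\mathcal U|,|\mathcal O|,|\mathcal A|,H,\log(1/\delta),\log(1/\epsilon)\big),$$ if CRANE is run for $K$ iterations with $\beta=c\log(N KH|\mathcal U_A|/\delta)$, where $\epsilon_{\mathrm b}=1/(KH|\mathcal U_A|)$ and $N$ is $\mathcal N_{\mathcal F}(\epsilon_{\mathrm b})$ or any real number between it and the upper bound given by (i) for it, then with probability at least $1-\delta$ $$V^{\widehat\pi}\ge V^*-\epsilon.$$ -/

import Mathlib

namespace PSR

open scoped Matrix

/-! ### Histories, policies and system dynamics

`O` and `A` are the finite observation and action spaces.  A history is a list of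
observation-action pairs `[(o₁, a₁), …, (oₕ, aₕ)]`, earliest first; a history of prescribed length `h`
is a function `Fin h → O × A`, turned into a list by `List.ofFn`. -/

/-- The prefix `(o₁, a₁, …, oₗ, aₗ)` of a history `τ` of length `h`. -/
def pre {O A : Type*} {h : ℕ} (τ : Fin h → O × A) (l : ℕ) : List (O × A) :=
  (List.ofFn τ).take l

/-- A (history dependent, randomized) policy: `π.prob τ o a` is the probability of choosing `a` after
the history `τ` and the current observation `o`; the step is `τ.length + 1`. -/
structure Policy (O A : Type*) [Fintype A] where
  prob : List (O × A) → O → A → ℝ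
  nonneg : ∀ τ o a, 0 ≤ prob τ o a
  sum_one : ∀ τ o, ∑ a, prob τ o a = 1

/-- `π(τ) = ∏ₗ π(aₗ | τₗ₋₁, oₗ)`. -/
noncomputable def Policy.weight {O A : Type*} [Fintype A] (π : Policy O A) {h : ℕ}
    (τ : Fin h → O × A) : ℝ :=
  ∏ l : Fin h, π.prob (pre τ l) (τ l).1 (τ l).2

/-- System dynamics: `D.kernel τ o` is the probability that the next observation is `o` given the
history `τ`.  `D.kernel []` is the law of the first observation.  In an episode of length `H` only the
histories of length less than `H` matter. -/
structure Dynamics (O A : Type*) [Fintype O] where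
  kernel : List (O × A) → O → ℝ
  nonneg : ∀ τ o, 0 ≤ kernel τ o
  sum_one : ∀ τ, ∑ o, kernel τ o = 1

/-- A test: a nonempty sequence of observations with actions between them,
`(o₁, [(a₁, o₂), (a₂, o₃), …])`.  The observation `none` is the dummy observation, which is generated
after the end of the episode. -/
abbrev Test (O A : Type*) := Option O × List (A × Option O)

/-- The action sequence of a test. -/
def Test.actions {O A : Type*} (t : Test O A) : List A := t.2.map Prod.fst

section

variable {O A : Type*} [Fintype O] [Fintype A]

/-- The probability `ℙ^π(τ)` of the trajectory `τ` under the policy `π`. -/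
noncomputable def Dynamics.prob (D : Dynamics O A) (π : Policy O A) {h : ℕ}
    (τ : Fin h → O × A) : ℝ :=
  (∏ l : Fin h, D.kernel (pre τ l) (τ l).1) * π.weight τ

/-- A history is reachable if some policy reaches it with nonzero probability. -/
def Dynamics.Reachable (D : Dynamics O A) {h : ℕ} (τ : Fin h → O × A) : Prop :=
  ∃ π : Policy O A, D.prob π τ ≠ 0

/-- Probability of the next observation when the episode has length `H`: up to step `H` it is given by
the kernel, afterwards only the dummy observation occurs. -/
noncomputable def Dynamics.obsProb (D : Dynamics O A) (H : ℕ) (τ : List (O × A)) : Option O → ℝ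
  | some o => if τ.length < H then D.kernel τ o else 0
  | none => if τ.length < H then 0 else 1

/-- `ℙ(o₁, o₂, … | τ ; do(a₁, a₂, …))` for the test `(o₁, [(a₁, o₂), …])`.  In the third case the
summand vanishes unless the episode is over, and then the history needs no further update. -/
noncomputable def Dynamics.doProb (D : Dynamics O A) (H : ℕ) :
    List (O × A) → Option O → List (A × Option O) → ℝ
  | τ, o, [] => D.obsProb H τ o
  | τ, some o, (a, o') :: l =>
      D.obsProb H τ (some o) * Dynamics.doProb D H (τ ++ [(o, a)]) o' l
  | τ, none, (_, o') :: l => D.obsProb H τ none * Dynamics.doProb D H τ o' l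

open Classical in
/-- The one-step system dynamics matrix `D_h`: rows are indexed by all tests, columns by all histories
of length `h`, and the entries are `ℙ(t | τ)`, which is `0` for unreachable `τ`. -/
noncomputable def Dynamics.dynMatrix (D : Dynamics O A) (H h : ℕ) :
    Matrix (Test O A) (Fin h → O × A) ℝ :=
  fun t τ => if D.Reachable τ then D.doProb H (List.ofFn τ) t.1 t.2 else 0

/-- The rows of `D_h` that belong to a finite set `V` of tests; the columns are the predictive states
`[ℙ(u | τ)]_{u ∈ V}`. -/
noncomputable def Dynamics.stateMatrix (D : Dynamics O A) (H h : ℕ) (V : Finset (Test O A)) :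
    Matrix V (Fin h → O × A) ℝ :=
  fun u τ => D.dynMatrix H h u.1 τ

/-- The PSR rank `max_h rank(D_h)`. -/
noncomputable def Dynamics.psrRank (D : Dynamics O A) (H : ℕ) : ℕ :=
  (Finset.range H).sup fun h => (D.dynMatrix H h).rank

/-- `U 1, …, U H` are core test sets: the rows of `D_h` in `U (h + 1)` have the rank of `D_h`. -/
def Dynamics.IsCore (D : Dynamics O A) (H : ℕ) (U : ℕ → Finset (Test O A)) : Prop :=
  ∀ h < H, (D.stateMatrix H h (U (h + 1))).rank = (D.dynMatrix H h).rank

/-- `X` is the Moore-Penrose pseudoinverse of the real matrix `K`. -/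
def IsPseudoInverse {m n : Type*} [Fintype m] [Fintype n] (K : Matrix m n ℝ) (X : Matrix n m ℝ) :
    Prop :=
  K * X * K = K ∧ X * K * X = X ∧ (K * X)ᵀ = K * X ∧ (X * K)ᵀ = X * K

/-- `‖X‖_{1 ↦ 1} ≤ C`, for `C ≥ 0`. -/
def L1OpNormLE {m n : Type*} [Fintype m] [Fintype n] (X : Matrix m n ℝ) (C : ℝ) : Prop :=
  ∀ x : n → ℝ, ∑ i, |(X *ᵥ x) i| ≤ C * ∑ j, |x j|

/-- `α`-regularity: for every `h ∈ {0, …, H - 1}` there are `d = rank(D_h)` histories of length `h`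
whose predictive states form a matrix `K` of rank `d` (a core matrix) with `‖K†‖_{1 ↦ 1} ≤ 1 / α`.
As there are finitely many core matrices, this says that the one with the smallest
`‖K†‖_{1 ↦ 1}` satisfies the bound. -/
def Dynamics.Regular (D : Dynamics O A) (H : ℕ) (U : ℕ → Finset (Test O A)) (α : ℝ) : Prop :=
  ∀ h < H, ∃ κ : Fin (D.dynMatrix H h).rank → (Fin h → O × A),
    let K := (D.stateMatrix H h (U (h + 1))).submatrix id κ
    K.rank = (D.dynMatrix H h).rank ∧
      ∃ X, IsPseudoInverse K X ∧ L1OpNormLE X (1 / α)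

/-! ### Value -/

/-- The cumulative reward of a trajectory; `r τ` is the reward received at the last step of the
history `τ`. -/
def cumReward (r : List (O × A) → ℝ) {H : ℕ} (τ : Fin H → O × A) : ℝ :=
  ∑ l : Fin H, r (pre τ (l + 1))

/-- The expected cumulative reward when `p` is the law of the trajectory. -/
noncomputable def value (r : List (O × A) → ℝ) {H : ℕ} (p : (Fin H → O × A) → ℝ) : ℝ :=
  ∑ τ, p τ * cumReward r τ

/-- The optimal value `V* = sup_π V^π`. -/
noncomputable def Dynamics.optValue (D : Dynamics O A) (r : List (O × A) → ℝ) (H : ℕ) : ℝ :=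
  ⨆ π : Policy O A, value r (H := H) (D.prob π)

/-- The law of the trajectory under the uniform mixture of `K` policies (one of them is drawn uniformly
at the beginning of the episode and executed). -/
noncomputable def Dynamics.mixProb (D : Dynamics O A) {K : ℕ} (π : Fin K → Policy O A) {H : ℕ}
    (τ : Fin H → O × A) : ℝ :=
  (1 / (K : ℝ)) * ∑ k, D.prob (π k) τ

/-! ### Tabular models -/

/-- Parameters `{M_{o,a,h}, q₀}` of a tabular PSR with test sets `U 1, …, U H`: `M h o a` is the matrix
`M_{o,a,h}`, whose rows are the vectors `m_{(o,a,u),h}`, `u ∈ U (h + 1)`.  Only `1 ≤ h ≤ H - 1` is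
used. -/
structure Params (U : ℕ → Finset (Test O A)) where
  M : (h : ℕ) → O → A → Matrix (U (h + 1)) (U h) ℝ
  q₀ : U 1 → ℝ

variable {U : ℕ → Finset (Test O A)}

/-- `b_τ = M_{oₕ,aₕ,h} ⋯ M_{o₁,a₁,1} q₀`. -/
noncomputable def Params.b (f : Params U) : (h : ℕ) → (Fin h → O × A) → U (h + 1) → ℝ
  | 0, _ => f.q₀
  | h + 1, τ => f.M (h + 1) (τ (Fin.last h)).1 (τ (Fin.last h)).2 *ᵥ
      f.b h (fun i => τ i.castSucc)

/-- `e_{o_H}ᵀ M_{o_{H-1},a_{H-1},H-1} ⋯ M_{o₁,a₁,1} q₀`, where `e_o` is the one-hot vector that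
indexes the one-observation test `o` in `U H`. -/
noncomputable def Params.obsWeight [DecidableEq O] [DecidableEq A] (f : Params U) :
    (H : ℕ) → (Fin H → O × A) → ℝ
  | 0, _ => 1
  | h + 1, τ => ∑ u : U (h + 1),
      (if u.1 = (some (τ (Fin.last h)).1, []) then 1 else 0) *
        f.b h (fun i => τ i.castSucc) u

/-- The trajectory probability `ℙ_f^π(τ_H)` of the model with parameters `f`. -/
noncomputable def Params.prob [DecidableEq O] [DecidableEq A] (f : Params U) (π : Policy O A)
    {H : ℕ} (τ : Fin H → O × A) : ℝ :=
  f.obsWeight H τ * π.weight τ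

/-- The parameters `f` induce the system dynamics `D` on episodes of length `H`. -/
def Params.Induces [DecidableEq O] [DecidableEq A] (f : Params U) (H : ℕ) (D : Dynamics O A) :
    Prop :=
  ∀ (π : Policy O A) (τ : Fin H → O × A), f.prob π τ = D.prob π τ

/-- All entries of the parameters are bounded by `1` in absolute value. -/
def Params.Bounded (f : Params U) (H : ℕ) : Prop :=
  (∀ u, |f.q₀ u| ≤ 1) ∧ ∀ h, 1 ≤ h → h < H → ∀ o a u v, |f.M h o a u v| ≤ 1

/-- Conditions on the function class `F`: realizability; and every `f ∈ F` induces valid dynamics, which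
form a PSR with core test sets `U` and are `α`-regular. -/
def WellSpecified [DecidableEq O] [DecidableEq A] (F : Set (Params U)) (H : ℕ)
    (D : Dynamics O A) (α : ℝ) : Prop :=
  (∃ f ∈ F, f.Induces H D) ∧
    ∀ f ∈ F, ∃ D' : Dynamics O A, f.Induces H D' ∧ D'.IsCore H U ∧ D'.Regular H U α

/-- There is an `ε`-bracket of size `N` for `F`. -/
def HasBracket [DecidableEq O] [DecidableEq A] (F : Set (Params U)) (H : ℕ) (ε : ℝ) (N : ℕ) :
    Prop :=
  ∃ g₁ g₂ : Fin N → Policy O A → (Fin H → O × A) → ℝ,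
    (∀ i π, ∑ τ, |g₁ i π τ - g₂ i π τ| ≤ ε) ∧
      ∀ f ∈ F, ∃ i, ∀ π τ, g₁ i π τ ≤ f.prob π τ ∧ f.prob π τ ≤ g₂ i π τ

/-- The `ε`-bracket number `𝒩_F(ε)`, which is `⊤` if there is no finite `ε`-bracket. -/
noncomputable def bracketNumber [DecidableEq O] [DecidableEq A] (F : Set (Params U)) (H : ℕ)
    (ε : ℝ) : ℕ∞ :=
  ⨅ N ∈ {N : ℕ | HasBracket F H ε N}, (N : ℕ∞)

/-- `𝒰_{A,h}`: the set of action sequences of the tests in `U h`. -/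
def actionSeqs [DecidableEq A] (U : ℕ → Finset (Test O A)) (h : ℕ) : Finset (List A) :=
  (U h).image Test.actions

/-- `|𝒰| = max_{h ∈ [H]} |𝒰_h|`. -/
def maxTests (U : ℕ → Finset (Test O A)) (H : ℕ) : ℕ :=
  (Finset.Icc 1 H).sup fun h => (U h).card

/-- `|𝒰_A| = max_{h ∈ [H]} |𝒰_{A,h}|`. -/
def maxActionSeqs [DecidableEq A] (U : ℕ → Finset (Test O A)) (H : ℕ) : ℕ :=
  (Finset.Icc 1 H).sup fun h => (actionSeqs U h).card

/-- `|𝒰|² |𝒪| |𝒜| H² log(H |𝒪| |𝒜| |𝒰_A| |𝒰| / (α ε))`. -/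
noncomputable def tabularRate [DecidableEq A] (U : ℕ → Finset (Test O A)) (H : ℕ) (α ε : ℝ) : ℝ :=
  (maxTests U H : ℝ) ^ 2 * Fintype.card O * Fintype.card A * (H : ℝ) ^ 2 *
    Real.log (H * Fintype.card O * Fintype.card A * maxActionSeqs U H * maxTests U H / (α * ε))

end

/-! ### The algorithm CRANE -/

section

variable {O A : Type*} [Fintype A] [DecidableEq A] [Nonempty A]

/-- The policy `π_{1:h-1} ∘ Unif(𝒜) ∘ s`: follow `π` at the steps before `h`, choose a uniform action at
step `h`, then take the actions of the sequence `s`, then uniform actions.  For `h = 0` it starts with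
the sequence `s`. -/
noncomputable def Policy.explore (π : Policy O A) (h : ℕ) (s : List A) : Policy O A where
  prob τ o a :=
    if τ.length + 1 < h then π.prob τ o a
    else if τ.length + 1 = h then 1 / (Fintype.card A : ℝ)
    else match s[τ.length - h]? with
      | some a' => if a = a' then 1 else 0
      | none => 1 / (Fintype.card A : ℝ)
  nonneg τ o a := by
    split_ifs
    · exact π.nonneg τ o a
    · positivity
    · split
      · split_ifs <;> norm_num
      · positivity
  sum_one τ o := by
    split_ifs
    · exact π.sum_one τ o
    · simp
    · split <;> simp

variable [Fintype O] [DecidableEq O]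

/-- The index set of the episodes of one iteration: pairs `(h, s)` with `h ∈ {0, …, H - 1}` and
`s ∈ 𝒰_{A,h+1}`. -/
abbrev EpisodeIdx (U : ℕ → Finset (Test O A)) (H : ℕ) := Σ h : Fin H, actionSeqs U (h + 1)

/-- The data of one iteration: one trajectory for every index `(h, s)`. -/
abbrev RoundData (U : ℕ → Finset (Test O A)) (H : ℕ) := EpisodeIdx U H → Fin H → O × A

/-- A learning algorithm: from the data of iterations `1, …, k - 1` it computes `(f^k, π^k)`. -/
abbrev Learner (U : ℕ → Finset (Test O A)) (H : ℕ) :=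
  List (RoundData U H) → Params U × Policy O A

variable {U : ℕ → Finset (Test O A)} {H : ℕ}

/-- The policy executed in the episode `i = (h, s)` of the iteration that follows the data `L`. -/
noncomputable def Learner.execPolicy (alg : Learner U H) (L : List (RoundData U H))
    (i : EpisodeIdx U H) : Policy O A :=
  (alg L).2.explore i.1 i.2.1

/-- The log-likelihood `∑ log ℙ_f^π(τ)` over all pairs `(π, τ)` collected so far, with `log 0 = -∞`. -/
noncomputable def Learner.logLik (alg : Learner U H) (L : List (RoundData U H)) (f : Params U) :
    EReal :=
  ∑ j : Fin L.length, ∑ i : EpisodeIdx U H,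
    ENNReal.log (ENNReal.ofReal (f.prob (alg.execPolicy (L.take j) i) (L.get j i)))

/-- The confidence set: the models of `F` whose log-likelihood is within `β` of the largest one.
For empty data and `β ≥ 0` it is `F`. -/
noncomputable def Learner.confSet (alg : Learner U H) (F : Set (Params U)) (β : ℝ)
    (L : List (RoundData U H)) : Set (Params U) :=
  {f | f ∈ F ∧ (⨆ f' ∈ F, alg.logLik L f') - (β : EReal) ≤ alg.logLik L f}

/-- `alg` is an execution of CRANE for `K` iterations: at each iteration, whatever the data,
`(f^k, π^k)` maximizes `V_f^π` over all `f` in the confidence set and all policies `π`. -/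
def Learner.IsCRANE (alg : Learner U H) (r : List (O × A) → ℝ) (F : Set (Params U)) (β : ℝ)
    (K : ℕ) : Prop :=
  ∀ L : List (RoundData U H), L.length < K →
    (alg L).1 ∈ alg.confSet F β L ∧
      ∀ f ∈ alg.confSet F β L, ∀ π : Policy O A,
        value r (H := H) (f.prob π) ≤ value r (H := H) ((alg L).1.prob (alg L).2)

/-- The policy `π^k` chosen at iteration `k` when `ω` is the data of all iterations. -/
def Learner.chosen (alg : Learner U H) {K : ℕ} (ω : Fin K → RoundData U H) (k : Fin K) :
    Policy O A :=
  (alg ((List.ofFn ω).take k)).2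

/-- The probability that `K` iterations produce the data `ω` when the true dynamics are `D`. -/
noncomputable def Learner.runProb (alg : Learner U H) (D : Dynamics O A) {K : ℕ}
    (ω : Fin K → RoundData U H) : ℝ :=
  ∏ k : Fin K, ∏ i : EpisodeIdx U H, D.prob (alg.execPolicy ((List.ofFn ω).take k) i) (ω k i)

/-- The value `V^π̂` of the output policy `π̂ = Unif{π¹, …, π^K}`. -/
noncomputable def Learner.outputValue (alg : Learner U H) (D : Dynamics O A)
    (r : List (O × A) → ℝ) {K : ℕ} (ω : Fin K → RoundData U H) : ℝ :=
  value r (H := H) (D.mixProb (alg.chosen ω))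

end

end PSR

/-!
CRANE is optimistic maximum likelihood, and the theorem is the combination of three estimates.

*Statistics.*  Fix a bracket with endpoints `g₁ ≤ g₂` around a model.  Along the adaptive run, the
likelihood ratio of `g₂` to the truth, and the ratio of `√(g₂ / ℙ)` compensated for its mean
(`affinityDensity`), are nonnegative supermartingales up to a factor `3`; Markov's inequality
(`lsum_markov`) and a union bound over brackets and iterations show that with probability `1 - δ` both
stay below `T = 4 N K / δ` (`Learner.one_sub_le_sum_of_typical`).  On this event the true parameters
stay in the confidence set (`Learner.mem_confSet`), and every model in it is within squared Hellinger
distance `O(β)` of the truth, summed over all exploratory episodes so far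
(`Learner.sum_exploreHell_le`).

*Predictive states.*  For a regular process the probability of any future is a linear functional of the
predictive state with respect to core tests, and by `α`-regularity these functionals lose at most
`1 / α` in the `ℓ¹`-norm (`exists_coreRep`, `CoreRep.sum_abs_pred_le`).  Telescoping over the steps, the
distance between the trajectory laws of a model and of the truth is bounded by the one-step update errors
of the model along the true process (`sum_abs_prob_sub_le`).  Given the history, the update error is
linear in the coordinates of the true state in at most `d` core histories, and its mean square is
controlled by the Hellinger distances of exploratory episodes (`CoreRep.hist_mul_sq_le`), because these
episodes execute the actions of every core test after every history, observation and action.  The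
elliptical potential lemma (`sum_abs_le_of_sq_sum_le`) then turns small squared errors under the past
policies into `O(√(β K log K))` total error under the current policies (`sum_abs_prob_sub_le_sqrt`).

*Optimism.*  As the truth lies in the confidence set, `V* ≤ V_{f^k}^{π^k}`, so the regret of `π^k` is at
most `H` times the distance of the two trajectory laws (`Learner.IsCRANE.optValue_sub_le`).

The bracket number is bounded by rounding the at most `|𝒰|² |𝒪| |𝒜| H` entries of the parameters to a
grid (`hasBracket_grid`); products of `H` matrices with entries in `[-1, 1]` change by at most
`H |𝒰|^H` times the mesh, and a sum over trajectories weighted by a policy has mass `|𝒪|^H`.  Since the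
bracket size used by CRANE is polynomial in `1 / K`, `β` grows with `K` only like `log K`, and a
polynomial condition on `K ε²` suffices (`mul_one_add_log_sq_le`).
-/

namespace PSR

open scoped Matrix

set_option linter.unusedSectionVars false

/-! ### Sums over lists of fixed length and products along lists -/

section Lists

variable {X : Type*}

/-- The sum of `g` over all lists of length `n`. -/
def lsum [Fintype X] (n : ℕ) (g : List X → ℝ) : ℝ := ∑ τ : Fin n → X, g (List.ofFn τ)

/-- The product of the factors `g σ x` over all steps of the path that starts with `τ` and is
continued by the list `r`; `σ` is the path before the step and `x` is the step. -/
def pathProd (g : List X → X → ℝ) : List X → List X → ℝ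
  | _, [] => 1
  | τ, x :: r => g τ x * pathProd g (τ ++ [x]) r

theorem pathProd_append (g : List X → X → ℝ) (τ r r' : List X) :
    pathProd g τ (r ++ r') = pathProd g τ r * pathProd g (τ ++ r) r' := by
  induction r generalizing τ with
  | nil => simp [pathProd]
  | cons x r ih => simp [pathProd, ih, mul_assoc]

theorem pathProd_nonneg {g : List X → X → ℝ} (hg : ∀ τ x, 0 ≤ g τ x) (τ r : List X) :
    0 ≤ pathProd g τ r := by
  induction r generalizing τ with
  | nil => simp [pathProd]
  | cons x r ih => exact mul_nonneg (hg _ _) (ih _)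

theorem pathProd_pos {g : List X → X → ℝ} (hg : ∀ τ x, 0 < g τ x) (τ r : List X) :
    0 < pathProd g τ r := by
  induction r generalizing τ with
  | nil => simp [pathProd]
  | cons x r ih => exact mul_pos (hg _ _) (ih _)

theorem pathProd_le {g g' : List X → X → ℝ} (hg : ∀ τ x, 0 ≤ g τ x) (h : ∀ τ x, g τ x ≤ g' τ x)
    (τ r : List X) : pathProd g τ r ≤ pathProd g' τ r := by
  induction r generalizing τ with
  | nil => simp [pathProd]
  | cons x r ih =>
    exact mul_le_mul (h _ _) (ih _) (pathProd_nonneg hg _ _) ((hg _ _).trans (h _ _))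

theorem pathProd_mul (g g' : List X → X → ℝ) (τ r : List X) :
    pathProd (fun σ x => g σ x * g' σ x) τ r = pathProd g τ r * pathProd g' τ r := by
  induction r generalizing τ with
  | nil => simp [pathProd]
  | cons x r ih => simp only [pathProd, ih]; ring

theorem pathProd_sqrt {g : List X → X → ℝ} (hg : ∀ τ x, 0 ≤ g τ x) (τ r : List X) :
    pathProd (fun σ x => √(g σ x)) τ r = √(pathProd g τ r) := by
  induction r generalizing τ with
  | nil => simp [pathProd]
  | cons x r ih => simp only [pathProd, ih]; rw [Real.sqrt_mul (hg _ _)]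

theorem prod_get_eq_pathProd (g : List X → X → ℝ) (τ L : List X) :
    ∏ j : Fin L.length, g (τ ++ L.take j) (L.get j) = pathProd g τ L := by
  induction L generalizing τ with
  | nil => simp [pathProd]
  | cons x L ih =>
    simp only [pathProd, ← ih]
    refine (Fin.prod_univ_succ (n := L.length) _).trans ?_
    simp

theorem prod_ofFn_eq_pathProd (g : List X → X → ℝ) (σ : List X) {n : ℕ} (τ : Fin n → X) :
    ∏ l : Fin n, g (σ ++ (List.ofFn τ).take l) (τ l) = pathProd g σ (List.ofFn τ) := by
  induction n generalizing σ with
  | zero => simp [pathProd]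
  | succ n ih =>
    rw [Fin.prod_univ_succ, List.ofFn_succ]
    simp only [pathProd, ← ih]
    simp

variable [Fintype X]

theorem lsum_zero (g : List X → ℝ) : lsum 0 g = g [] := by
  simp [lsum]

theorem lsum_succ (n : ℕ) (g : List X → ℝ) :
    lsum (n + 1) g = ∑ x, lsum n (fun r => g (x :: r)) := by
  unfold lsum
  rw [← (Fin.consEquiv fun _ => X).sum_comp, Fintype.sum_prod_type]
  simp [Fin.consEquiv]

theorem lsum_add (m n : ℕ) (g : List X → ℝ) :
    lsum (m + n) g = lsum m (fun σ => lsum n (fun r => g (σ ++ r))) := by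
  induction m generalizing g with
  | zero => simp [lsum_zero]
  | succ m ih => rw [show m + 1 + n = (m + n) + 1 by ring, lsum_succ, lsum_succ]; simp [ih]

theorem lsum_one (g : List X → ℝ) : lsum 1 g = ∑ x, g [x] := by
  rw [lsum_succ]; simp [lsum_zero]

theorem lsum_succ_right (n : ℕ) (g : List X → ℝ) :
    lsum (n + 1) g = lsum n (fun σ => ∑ x, g (σ ++ [x])) := by
  rw [lsum_add]; simp [lsum_one]

theorem lsum_congr {n : ℕ} {g g' : List X → ℝ} (h : ∀ l, l.length = n → g l = g' l) :
    lsum n g = lsum n g' :=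
  Finset.sum_congr rfl fun _ _ => h _ (List.length_ofFn)

theorem lsum_le_lsum {n : ℕ} {g g' : List X → ℝ} (h : ∀ l, l.length = n → g l ≤ g' l) :
    lsum n g ≤ lsum n g' :=
  Finset.sum_le_sum fun _ _ => h _ (List.length_ofFn)

theorem lsum_nonneg {n : ℕ} {g : List X → ℝ} (h : ∀ l, l.length = n → 0 ≤ g l) :
    0 ≤ lsum n g :=
  Finset.sum_nonneg fun _ _ => h _ (List.length_ofFn)

theorem lsum_mul_left (n : ℕ) (c : ℝ) (g : List X → ℝ) :
    lsum n (fun r => c * g r) = c * lsum n g := by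
  simp [lsum, Finset.mul_sum]

theorem lsum_add_fun (n : ℕ) (g g' : List X → ℝ) :
    lsum n (fun r => g r + g' r) = lsum n g + lsum n g' := by
  simp [lsum, Finset.sum_add_distrib]

theorem lsum_sum {ι : Type*} (s : Finset ι) (n : ℕ) (g : ι → List X → ℝ) :
    lsum n (fun r => ∑ i ∈ s, g i r) = ∑ i ∈ s, lsum n (g i) := by
  simp only [lsum]; exact Finset.sum_comm

/-- If the factors at every step sum to at most `B`, then the products along all paths of length `n`
sum to at most `B ^ n`. -/
theorem lsum_pathProd_le {g : List X → X → ℝ} {B : ℝ} (hg : ∀ τ x, 0 ≤ g τ x)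
    (hB : ∀ τ, ∑ x, g τ x ≤ B) (n : ℕ) (τ : List X) :
    lsum n (pathProd g τ) ≤ B ^ n := by
  induction n generalizing τ with
  | zero => simp [lsum_zero, pathProd]
  | succ n ih =>
    rw [lsum_succ]
    have hB0 : 0 ≤ B := (Finset.sum_nonneg fun x _ => hg [] x).trans (hB [])
    calc ∑ x, lsum n (fun r => pathProd g τ (x :: r))
        = ∑ x, g τ x * lsum n (pathProd g (τ ++ [x])) := by
          simp only [pathProd, lsum_mul_left]
      _ ≤ ∑ x, g τ x * B ^ n := Finset.sum_le_sum fun x _ =>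
          mul_le_mul_of_nonneg_left (ih _) (hg _ _)
      _ = (∑ x, g τ x) * B ^ n := by rw [Finset.sum_mul]
      _ ≤ B * B ^ n := mul_le_mul_of_nonneg_right (hB τ) (pow_nonneg hB0 n)
      _ = B ^ (n + 1) := by ring

/-- An adapted process whose step probabilities sum to `1` has total mass `1`. -/
theorem lsum_pathProd_eq_one {g : List X → X → ℝ} (hB : ∀ τ, ∑ x, g τ x = 1) (n : ℕ)
    (τ : List X) : lsum n (pathProd g τ) = 1 := by
  induction n generalizing τ with
  | zero => simp [lsum_zero, pathProd]
  | succ n ih => rw [lsum_succ]; simp [pathProd, lsum_mul_left, ih, hB]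

open Classical in
/-- Markov's inequality for the likelihood ratio `∏ φ / ∏ p` of the first `k` of `K` steps of an adapted
process with transition probabilities `p`. -/
theorem lsum_markov {p φ : List X → X → ℝ} {B T : ℝ}
    (hp1 : ∀ τ, ∑ x, p τ x = 1) (hφ : ∀ τ x, 0 ≤ φ τ x) (hB : ∀ τ, ∑ x, φ τ x ≤ B) (hT : 0 < T)
    {k K : ℕ} (hk : k ≤ K) :
    lsum K (fun ω => if T * pathProd p [] (ω.take k) < pathProd φ [] (ω.take k)
      then pathProd p [] ω else 0) ≤ B ^ k / T := by
  obtain ⟨m, rfl⟩ := Nat.exists_eq_add_of_le hk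
  rw [lsum_add]
  calc lsum k (fun σ => lsum m fun r =>
        if T * pathProd p [] ((σ ++ r).take k) < pathProd φ [] ((σ ++ r).take k)
          then pathProd p [] (σ ++ r) else 0)
      ≤ lsum k (fun σ => T⁻¹ * pathProd φ [] σ) := by
        refine lsum_le_lsum fun σ hσ => ?_
        have h1 : ∀ r : List X, (σ ++ r).take k = σ := fun r => by
          rw [← hσ]; simp
        simp only [h1]
        -- the event depends only on the first `k` steps, so the remaining steps sum out to `1`
        split_ifs with h
        · simp only [pathProd_append, lsum_mul_left, List.nil_append]
          rw [lsum_pathProd_eq_one hp1, mul_one, ← div_eq_inv_mul, le_div_iff₀ hT]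
          linarith
        · rw [show lsum m (fun _ : List X => (0 : ℝ)) = 0 by simp [lsum]]
          exact mul_nonneg (inv_nonneg.2 hT.le) (pathProd_nonneg hφ _ _)
    _ = T⁻¹ * lsum k (pathProd φ []) := lsum_mul_left _ _ _
    _ ≤ T⁻¹ * B ^ k :=
        mul_le_mul_of_nonneg_left (lsum_pathProd_le hφ hB k []) (inv_nonneg.2 hT.le)
    _ = B ^ k / T := by ring

end Lists

/-! ### Probabilities of histories, futures and tests -/

section Dyn

variable {O A : Type*} [Fintype O] [Fintype A]

/-- The probability of the observations of `r` after the history `κ`, when the actions of `r` are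
executed. -/
noncomputable def Dynamics.hist (D : Dynamics O A) (κ r : List (O × A)) : ℝ :=
  pathProd (fun τ x => D.kernel τ x.1) κ r

/-- The probability that the policy `π` chooses the actions of `r` after the history `τ`, when the
observations of `r` occur. -/
noncomputable def Policy.wt (π : Policy O A) (τ r : List (O × A)) : ℝ :=
  pathProd (fun τ x => π.prob τ x.1 x.2) τ r

/-- The probability of the trajectory `τ`, given as a list. -/
noncomputable def Dynamics.listProb (D : Dynamics O A) (π : Policy O A) (τ : List (O × A)) : ℝ :=
  D.hist [] τ * π.wt [] τ

theorem Policy.weight_eq_wt (π : Policy O A) {h : ℕ} (τ : Fin h → O × A) :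
    π.weight τ = π.wt [] (List.ofFn τ) := by
  rw [Policy.wt, ← prod_ofFn_eq_pathProd]; rfl

theorem Dynamics.prob_eq_listProb (D : Dynamics O A) (π : Policy O A) {h : ℕ}
    (τ : Fin h → O × A) : D.prob π τ = D.listProb π (List.ofFn τ) := by
  rw [listProb, Dynamics.prob, Policy.weight_eq_wt, hist, ← prod_ofFn_eq_pathProd]; rfl

theorem Dynamics.hist_nonneg (D : Dynamics O A) (κ r : List (O × A)) : 0 ≤ D.hist κ r :=
  pathProd_nonneg (fun _ _ => D.nonneg _ _) _ _

theorem Policy.wt_nonneg (π : Policy O A) (κ r : List (O × A)) : 0 ≤ π.wt κ r :=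
  pathProd_nonneg (fun _ _ => π.nonneg _ _ _) _ _

theorem Dynamics.listProb_nonneg (D : Dynamics O A) (π : Policy O A) (τ : List (O × A)) :
    0 ≤ D.listProb π τ := mul_nonneg (D.hist_nonneg _ _) (π.wt_nonneg _ _)

theorem Dynamics.hist_append (D : Dynamics O A) (κ r r' : List (O × A)) :
    D.hist κ (r ++ r') = D.hist κ r * D.hist (κ ++ r) r' := pathProd_append _ _ _ _

theorem Policy.wt_append (π : Policy O A) (κ r r' : List (O × A)) :
    π.wt κ (r ++ r') = π.wt κ r * π.wt (κ ++ r) r' := pathProd_append _ _ _ _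

@[simp] theorem Dynamics.hist_nil (D : Dynamics O A) (κ : List (O × A)) : D.hist κ [] = 1 := rfl

@[simp] theorem Policy.wt_nil (π : Policy O A) (κ : List (O × A)) : π.wt κ [] = 1 := rfl

theorem Dynamics.hist_cons (D : Dynamics O A) (κ r : List (O × A)) (x : O × A) :
    D.hist κ (x :: r) = D.kernel κ x.1 * D.hist (κ ++ [x]) r := rfl

theorem Policy.wt_cons (π : Policy O A) (κ r : List (O × A)) (x : O × A) :
    π.wt κ (x :: r) = π.prob κ x.1 x.2 * π.wt (κ ++ [x]) r := rfl

theorem Policy.prob_le_one (π : Policy O A) (τ : List (O × A)) (o : O) (a : A) :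
    π.prob τ o a ≤ 1 := by
  rw [← π.sum_one τ o]
  exact Finset.single_le_sum (f := fun a => π.prob τ o a) (fun b _ => π.nonneg τ o b)
    (Finset.mem_univ a)

theorem Policy.wt_append_singleton_le (π : Policy O A) (κ r : List (O × A)) (x : O × A) :
    π.wt κ (r ++ [x]) ≤ π.wt κ r := by
  rw [π.wt_append, π.wt_cons, π.wt_nil, mul_one]
  exact mul_le_of_le_one_right (π.wt_nonneg _ _) (π.prob_le_one _ _ _)

/-- The dynamics and the policy may be conditioned on different histories: the products of their
probabilities still sum to one. -/
theorem lsum_hist_mul_wt (D : Dynamics O A) (π : Policy O A) (n : ℕ) (κ τ : List (O × A)) :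
    lsum n (fun r => D.hist κ r * π.wt τ r) = 1 := by
  induction n generalizing κ τ with
  | zero => simp [lsum_zero]
  | succ n ih =>
    rw [lsum_succ]
    calc ∑ x, lsum n (fun r => D.hist κ (x :: r) * π.wt τ (x :: r))
        = ∑ x : O × A, (D.kernel κ x.1 * π.prob τ x.1 x.2) * 1 := by
          refine Finset.sum_congr rfl fun x _ => ?_
          rw [← ih (κ ++ [x]) (τ ++ [x]), ← lsum_mul_left]
          refine lsum_congr fun r _ => ?_
          rw [D.hist_cons, π.wt_cons]; ring
      _ = 1 := by
          rw [Fintype.sum_prod_type]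
          simp only [mul_one, ← Finset.mul_sum, π.sum_one, D.sum_one]

theorem Dynamics.sum_prob (D : Dynamics O A) (π : Policy O A) (h : ℕ) :
    ∑ τ : Fin h → O × A, D.prob π τ = 1 := by
  simp only [D.prob_eq_listProb]
  exact lsum_hist_mul_wt D π h [] []

theorem Dynamics.prob_nonneg (D : Dynamics O A) (π : Policy O A) {h : ℕ} (τ : Fin h → O × A) :
    0 ≤ D.prob π τ := by
  rw [D.prob_eq_listProb]; exact D.listProb_nonneg _ _

/-- The policy that always chooses a uniformly distributed action. -/
noncomputable def Policy.unif (O A : Type*) [Fintype A] [Nonempty A] : Policy O A where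
  prob _ _ _ := 1 / (Fintype.card A : ℝ)
  nonneg _ _ _ := by positivity
  sum_one _ _ := by simp

instance [Nonempty A] : Nonempty (Policy O A) := ⟨Policy.unif O A⟩

theorem Dynamics.reachable_iff [Nonempty A] (D : Dynamics O A) {h : ℕ} (τ : Fin h → O × A) :
    D.Reachable τ ↔ D.hist [] (List.ofFn τ) ≠ 0 := by
  constructor
  · rintro ⟨π, hπ⟩ h0
    rw [D.prob_eq_listProb, listProb, h0, zero_mul] at hπ
    exact hπ rfl
  · intro h0
    refine ⟨Policy.unif O A, ?_⟩
    rw [D.prob_eq_listProb, listProb]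
    refine mul_ne_zero h0 (ne_of_gt (pathProd_pos (fun _ _ => ?_) _ _))
    simp only [Policy.unif]
    positivity

open Classical in
/-- `ℙ(t | τ)` for a list `τ`, which is `0` if `τ` is unreachable. -/
noncomputable def Dynamics.cond (D : Dynamics O A) (H : ℕ) (τ : List (O × A)) (t : Test O A) : ℝ :=
  if D.hist [] τ = 0 then 0 else D.doProb H τ t.1 t.2

/-- The probability of the history `τ` followed by the test `t`. -/
noncomputable def Dynamics.joint (D : Dynamics O A) (H : ℕ) (τ : List (O × A)) (t : Test O A) : ℝ :=
  D.hist [] τ * D.doProb H τ t.1 t.2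

theorem Dynamics.joint_eq (D : Dynamics O A) (H : ℕ) (τ : List (O × A)) (t : Test O A) :
    D.joint H τ t = D.hist [] τ * D.cond H τ t := by
  unfold joint cond; split_ifs with h <;> simp [h]

theorem Dynamics.dynMatrix_eq [Nonempty A] (D : Dynamics O A) (H h : ℕ) (t : Test O A)
    (τ : Fin h → O × A) : D.dynMatrix H h t τ = D.cond H (List.ofFn τ) t := by
  unfold dynMatrix cond
  simp only [D.reachable_iff]
  split_ifs <;> simp_all

theorem Dynamics.obsProb_nonneg (D : Dynamics O A) (H : ℕ) (τ : List (O × A)) (o : Option O) :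
    0 ≤ D.obsProb H τ o := by
  cases o <;> simp only [obsProb] <;> split_ifs <;> first | exact D.nonneg _ _ | norm_num

theorem Dynamics.doProb_nonneg (D : Dynamics O A) (H : ℕ) (τ : List (O × A)) (o : Option O)
    (l : List (A × Option O)) : 0 ≤ D.doProb H τ o l := by
  induction l generalizing τ o with
  | nil => cases o <;> exact D.obsProb_nonneg _ _ _
  | cons x l ih =>
    obtain ⟨a, o'⟩ := x
    cases o <;> exact mul_nonneg (D.obsProb_nonneg _ _ _) (ih _ _)

theorem Dynamics.cond_nonneg (D : Dynamics O A) (H : ℕ) (τ : List (O × A)) (t : Test O A) :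
    0 ≤ D.cond H τ t := by
  unfold cond; split_ifs
  · exact le_rfl
  · exact D.doProb_nonneg _ _ _ _

theorem Dynamics.joint_nonneg (D : Dynamics O A) (H : ℕ) (τ : List (O × A)) (t : Test O A) :
    0 ≤ D.joint H τ t := mul_nonneg (D.hist_nonneg _ _) (D.doProb_nonneg _ _ _ _)

theorem Dynamics.cond_le_doProb (D : Dynamics O A) (H : ℕ) (τ : List (O × A)) (t : Test O A) :
    D.cond H τ t ≤ D.doProb H τ t.1 t.2 := by
  unfold cond; split_ifs
  · exact D.doProb_nonneg _ _ _ _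
  · exact le_rfl

theorem Dynamics.hist_append_singleton (D : Dynamics O A) (κ τ : List (O × A)) (x : O × A) :
    D.hist κ (τ ++ [x]) = D.hist κ τ * D.kernel (κ ++ τ) x.1 := by
  rw [D.hist_append, D.hist_cons, D.hist_nil, mul_one]

theorem Dynamics.joint_cons (D : Dynamics O A) {H : ℕ} {τ : List (O × A)} (hτ : τ.length < H)
    (o : O) (a : A) (t : Test O A) :
    D.joint H τ (some o, (a, t.1) :: t.2) = D.joint H (τ ++ [(o, a)]) t := by
  simp only [joint, doProb, obsProb, hτ, if_true, D.hist_append_singleton, List.nil_append]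
  ring

/-- Chain rule for the conditional probability of a test that starts with `o, a`. -/
theorem Dynamics.cond_cons (D : Dynamics O A) {H : ℕ} {τ : List (O × A)} (hτ : τ.length < H)
    (o : O) (a : A) (t : Test O A) :
    D.cond H τ (some o, (a, t.1) :: t.2) =
      D.cond H τ (some o, []) * D.cond H (τ ++ [(o, a)]) t := by
  simp only [cond, doProb, obsProb, hτ, if_true, D.hist_append_singleton, List.nil_append,
    mul_eq_zero]
  split_ifs <;> simp_all

theorem Dynamics.cond_obs_le (D : Dynamics O A) {H : ℕ} {τ : List (O × A)} (hτ : τ.length < H)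
    (o : O) : D.cond H τ (some o, []) ≤ D.kernel τ o := by
  refine (D.cond_le_doProb _ _ _).trans ?_
  simp [doProb, obsProb, hτ]

/-! ### Tests as events -/

/-- `Matches o l r`: the remaining part `r` of an episode shows the observations of the test `(o, l)`,
the dummy observation occurring after the end of the episode. -/
def Matches : Option O → List (A × Option O) → List (O × A) → Prop
  | none, [], [] => True
  | none, (_, o') :: l, [] => Matches o' l []
  | some _, _, [] => False
  | none, _, _ :: _ => False
  | some o, [], x :: _ => x.1 = o
  | some o, (_, o') :: l, x :: r => x.1 = o ∧ Matches o' l r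

/-- Two tests with the same actions that match the same trajectory are equal. -/
theorem Matches.unique {o o' : Option O} {l l' : List (A × Option O)} {r : List (O × A)}
    (h : Matches o l r) (h' : Matches o' l' r) (hl : l.map Prod.fst = l'.map Prod.fst) :
    o = o' ∧ l = l' := by
  induction l generalizing o o' l' r with
  | nil =>
    obtain rfl : l' = [] := by simpa using hl.symm
    cases o <;> cases o' <;> cases r <;> simp_all [Matches]
  | cons x l ih =>
    obtain ⟨a, p⟩ := x
    cases l' with
    | nil => simp at hl
    | cons x' l' =>
      obtain ⟨a', p'⟩ := x'
      simp only [List.map_cons, List.cons.injEq] at hl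
      obtain ⟨rfl, hl⟩ := hl
      cases r with
      | nil =>
        cases o <;> cases o' <;> simp only [Matches] at h h'
        obtain ⟨rfl, rfl⟩ := ih h h' hl
        simp
      | cons y r =>
        cases o <;> cases o' <;> simp only [Matches] at h h'
        obtain ⟨h1, h⟩ := h
        obtain ⟨h2, h'⟩ := h'
        obtain ⟨rfl, rfl⟩ := ih h h' hl
        simp [← h1, h2]

/-- `π` takes the actions `s` from the history `τ` on, until the end of the episode or of `s`. -/
def Policy.Follows (π : Policy O A) (H h : ℕ) (s : List A) : Prop :=
  ∀ (σ : List (O × A)) (o : O) (a : A), h ≤ σ.length → σ.length < H → s[σ.length - h]? = some a →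
    π.prob σ o a = 1

theorem Policy.prob_eq_zero_of_ne (π : Policy O A) {σ : List (O × A)} {o : O} {a b : A}
    (h : π.prob σ o a = 1) (hb : b ≠ a) : π.prob σ o b = 0 := by
  classical
  have h1 := π.sum_one σ o
  rw [← Finset.add_sum_erase _ _ (Finset.mem_univ a), h] at h1
  have h2 : ∑ x ∈ Finset.univ.erase a, π.prob σ o x = 0 := by linarith
  exact (Finset.sum_eq_zero_iff_of_nonneg fun x _ => π.nonneg σ o x).1 h2 b (by simp [hb])

open Classical in
/-- If the policy follows the actions of a test, then the probability of the test is the probability of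
the event that the rest of the episode matches it. -/
theorem Dynamics.doProb_eq_lsum (D : Dynamics O A) {π : Policy O A} {H : ℕ}
    (l : List (A × Option O)) (o : Option O) (n : ℕ) (τ : List (O × A)) (hτ : τ.length + n = H)
    (hπ : π.Follows H τ.length (l.map Prod.fst)) :
    D.doProb H τ o l =
      lsum n (fun r => if Matches o l r then D.hist τ r * π.wt τ r else 0) := by
  induction l generalizing o n τ with
  | nil =>
    cases n with
    | zero =>
      have h1 : ¬ τ.length < H := by omega
      rw [lsum_zero]
      cases o <;> simp [doProb, obsProb, Matches, h1]
    | succ n =>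
      have h1 : τ.length < H := by omega
      rw [lsum_succ]
      cases o with
      | none => simp [doProb, obsProb, Matches, h1, lsum]
      | some o =>
        simp only [doProb, obsProb, h1, if_true, Matches, D.hist_cons, π.wt_cons]
        rw [Fintype.sum_prod_type, Finset.sum_eq_single o]
        · simp only [if_true]
          calc D.kernel τ o = ∑ a, D.kernel τ o * π.prob τ o a * 1 := by
                simp [← Finset.mul_sum, π.sum_one]
            _ = _ := by
                refine Finset.sum_congr rfl fun a _ => ?_
                rw [← lsum_hist_mul_wt D π n (τ ++ [(o, a)]) (τ ++ [(o, a)]), ← lsum_mul_left]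
                refine lsum_congr fun r _ => ?_
                ring
        · intro b _ hb
          simp [hb, lsum]
        · simp
  | cons x l ih =>
    obtain ⟨a, o'⟩ := x
    cases n with
    | zero =>
      have h1 : ¬ τ.length < H := by omega
      cases o with
      | none =>
        rw [lsum_zero]
        simp only [doProb, obsProb, h1, if_false, Matches, one_mul]
        refine (ih o' 0 τ hτ ?_).trans (lsum_zero _)
        intro σ _ _ hσ hσ'
        omega
      | some o => simp [doProb, obsProb, Matches, h1, lsum_zero]
    | succ n =>
      have h1 : τ.length < H := by omega
      rw [lsum_succ]
      cases o with
      | none => simp [doProb, obsProb, Matches, h1, lsum]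
      | some o =>
        simp only [doProb, obsProb, h1, if_true, Matches, D.hist_cons, π.wt_cons]
        have h2 : π.prob τ o a = 1 := hπ τ o a le_rfl h1 (by simp)
        rw [Fintype.sum_prod_type, Finset.sum_eq_single o, Finset.sum_eq_single a]
        · -- the only action of positive probability is the one of the test
          rw [ih o' n (τ ++ [(o, a)]) (by simp; omega), ← lsum_mul_left]
          · refine lsum_congr fun r _ => ?_
            simp [h2, mul_assoc]
          · intro σ p b hσ hσ' hb
            simp only [List.length_append, List.length_singleton] at hσ hb
            refine hπ σ p b (by omega) hσ' ?_
            rw [show σ.length - τ.length = (σ.length - (τ.length + 1)) + 1 by omega]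
            simpa using hb
        · intro b _ hb
          simp [π.prob_eq_zero_of_ne h2 hb, lsum]
        · simp
        · intro b _ hb
          simp [hb, lsum]
        · simp

variable [DecidableEq A] [Nonempty A]

theorem Policy.explore_follows (π : Policy O A) (H h : ℕ) (s : List A) :
    (π.explore h s).Follows H h s := by
  intro σ o a hσ _ ha
  simp only [Policy.explore]
  rw [if_neg (by omega), if_neg (by omega), ha]
  simp

open Classical in
/-- A sum over the tests with the actions `s` of nonnegative weights of the matching futures is at most
the sum over all futures. -/
theorem sum_lsum_matches_le (V : Finset (Test O A)) (s : List A) (n : ℕ) {g : List (O × A) → ℝ}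
    (hg : ∀ r, 0 ≤ g r) :
    ∑ u ∈ V with u.actions = s, lsum n (fun r => if Matches u.1 u.2 r then g r else 0) ≤
      lsum n g := by
  rw [← lsum_sum]
  refine lsum_le_lsum fun r _ => ?_
  rw [← Finset.sum_filter, Finset.sum_const, nsmul_eq_mul]
  refine mul_le_of_le_one_left (hg r) ?_
  have : Finset.card {u ∈ {u ∈ V | u.actions = s} | Matches u.1 u.2 r} ≤ 1 := by
    rw [Finset.card_le_one]
    intro u hu v hv
    simp only [Finset.mem_filter] at hu hv
    obtain ⟨h1, h2⟩ := hu.2.unique hv.2 (hu.1.2.trans hv.1.2.symm)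
    exact Prod.ext h1 h2
  exact_mod_cast this

/-- Tests with the same actions are disjoint events under a policy that takes these actions. -/
theorem Dynamics.sum_doProb_le_one (D : Dynamics O A) {H : ℕ} {τ : List (O × A)}
    (hτ : τ.length ≤ H) (V : Finset (Test O A)) (s : List A) :
    ∑ u ∈ V with u.actions = s, D.doProb H τ u.1 u.2 ≤ 1 := by
  classical
  set π := (Policy.unif O A).explore τ.length s
  have h1 : ∀ u ∈ V.filter (fun u => u.actions = s), D.doProb H τ u.1 u.2 =
      lsum (H - τ.length) (fun r => if Matches u.1 u.2 r then D.hist τ r * π.wt τ r else 0) := by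
    intro u hu
    refine D.doProb_eq_lsum u.2 u.1 _ τ (by omega) ?_
    rw [show u.2.map Prod.fst = s from (Finset.mem_filter.1 hu).2]
    exact Policy.explore_follows _ _ _ _
  rw [Finset.sum_congr rfl h1, ← lsum_hist_mul_wt D π (H - τ.length) τ τ]
  exact sum_lsum_matches_le V s _ fun r => mul_nonneg (D.hist_nonneg _ _) (π.wt_nonneg _ _)

theorem sum_eq_sum_actions {M : Type*} [AddCommMonoid M] (V : Finset (Test O A))
    (g : Test O A → M) :
    ∑ u ∈ V, g u = ∑ s ∈ V.image Test.actions, ∑ u ∈ V with u.actions = s, g u := by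
  rw [Finset.sum_fiberwise_of_maps_to]
  exact fun u hu => Finset.mem_image_of_mem _ hu

/-- The predictive states have total mass at most the number of action sequences. -/
theorem Dynamics.sum_cond_le (D : Dynamics O A) {H : ℕ} {τ : List (O × A)} (hτ : τ.length ≤ H)
    (V : Finset (Test O A)) :
    ∑ u ∈ V, D.cond H τ u ≤ (V.image Test.actions).card := by
  calc ∑ u ∈ V, D.cond H τ u ≤ ∑ u ∈ V, D.doProb H τ u.1 u.2 :=
        Finset.sum_le_sum fun u _ => D.cond_le_doProb H τ u
    _ = ∑ s ∈ V.image Test.actions, ∑ u ∈ V with u.actions = s, D.doProb H τ u.1 u.2 :=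
        sum_eq_sum_actions V _
    _ ≤ ∑ s ∈ V.image Test.actions, (1 : ℝ) :=
        Finset.sum_le_sum fun s _ => D.sum_doProb_le_one hτ V s
    _ = _ := by simp

/-! ### Hellinger distances of exploratory episodes -/

/-- Twice the squared Hellinger distance `∑ (√p - √q)²`. -/
noncomputable def hell {Ω : Type*} [Fintype Ω] (p q : Ω → ℝ) : ℝ := ∑ ω, (√(p ω) - √(q ω)) ^ 2

theorem hell_nonneg {Ω : Type*} [Fintype Ω] (p q : Ω → ℝ) : 0 ≤ hell p q :=
  Finset.sum_nonneg fun _ _ => sq_nonneg _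

/-- Data processing: merging atoms decreases the Hellinger distance. -/
theorem sq_sqrt_sum_sub_le {ι : Type*} (S : Finset ι) {a b : ι → ℝ} (ha : ∀ i, 0 ≤ a i)
    (hb : ∀ i, 0 ≤ b i) :
    (√(∑ i ∈ S, a i) - √(∑ i ∈ S, b i)) ^ 2 ≤ ∑ i ∈ S, (√(a i) - √(b i)) ^ 2 := by
  have h1 : ∑ i ∈ S, √(a i) * √(b i) ≤ √(∑ i ∈ S, a i) * √(∑ i ∈ S, b i) := by
    refine (Real.sum_mul_le_sqrt_mul_sqrt S _ _).trans (le_of_eq ?_)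
    simp only [Real.sq_sqrt (ha _), Real.sq_sqrt (hb _)]
  have h2 : ∑ i ∈ S, (√(a i) - √(b i)) ^ 2 =
      ∑ i ∈ S, a i + ∑ i ∈ S, b i - 2 * ∑ i ∈ S, √(a i) * √(b i) := by
    rw [Finset.mul_sum, ← Finset.sum_add_distrib, ← Finset.sum_sub_distrib]
    refine Finset.sum_congr rfl fun i _ => ?_
    rw [sub_sq, Real.sq_sqrt (ha i), Real.sq_sqrt (hb i)]; ring
  rw [h2, sub_sq, Real.sq_sqrt (Finset.sum_nonneg fun i _ => ha i),
    Real.sq_sqrt (Finset.sum_nonneg fun i _ => hb i)]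
  linarith

/-- `∑ (√ℙ(τ, u) - √ℙ'(τ, u))²` over the tests `u ∈ V`. -/
noncomputable def testHell (D D' : Dynamics O A) (H : ℕ) (V : Finset (Test O A))
    (τ : List (O × A)) : ℝ :=
  ∑ u ∈ V, (√(D.joint H τ u) - √(D'.joint H τ u)) ^ 2

/-- The squared Hellinger distance of the joint laws of a history and the tests with actions `s` is
bounded by that of the futures, when the policy executes `s`. -/
theorem wt_mul_testHell_le (D D' : Dynamics O A) {π : Policy O A} {H : ℕ}
    {τ : List (O × A)} (hτ : τ.length ≤ H) (V : Finset (Test O A)) (s : List A)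
    (hπ : π.Follows H τ.length s) :
    π.wt [] τ * testHell D D' H (V.filter fun u => u.actions = s) τ ≤
      lsum (H - τ.length) (fun r =>
        (√(D.listProb π (τ ++ r)) - √(D'.listProb π (τ ++ r))) ^ 2) := by
  classical
  have key : ∀ (E : Dynamics O A), ∀ u ∈ V.filter (fun u => u.actions = s),
      π.wt [] τ * E.joint H τ u = lsum (H - τ.length) (fun r =>
        if Matches u.1 u.2 r then E.listProb π (τ ++ r) else 0) := by
    intro E u hu
    rw [Dynamics.joint, E.doProb_eq_lsum (π := π) u.2 u.1 (H - τ.length) τ (by omega),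
      ← mul_assoc, ← lsum_mul_left]
    · refine lsum_congr fun r _ => ?_
      rw [mul_ite, mul_zero, Dynamics.listProb, E.hist_append, π.wt_append, List.nil_append]
      congr 1
      ring
    · rwa [show u.2.map Prod.fst = s from (Finset.mem_filter.1 hu).2]
  unfold testHell
  rw [Finset.mul_sum]
  refine le_trans (Finset.sum_le_sum fun u hu => ?_)
    (sum_lsum_matches_le V s (H - τ.length) fun r => sq_nonneg _)
  have h0 := π.wt_nonneg [] τ
  calc π.wt [] τ * (√(D.joint H τ u) - √(D'.joint H τ u)) ^ 2
      = (√(π.wt [] τ * D.joint H τ u) - √(π.wt [] τ * D'.joint H τ u)) ^ 2 := by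
        rw [Real.sqrt_mul h0, Real.sqrt_mul h0, ← mul_sub, mul_pow, Real.sq_sqrt h0]
    _ ≤ _ := by
        rw [key D u hu, key D' u hu]
        simp only [lsum]
        refine (sq_sqrt_sum_sub_le _ (fun i => ?_) (fun i => ?_)).trans (le_of_eq ?_)
        · split_ifs
          exacts [Dynamics.listProb_nonneg _ _ _, le_rfl]
        · split_ifs
          exacts [Dynamics.listProb_nonneg _ _ _, le_rfl]
        · refine Finset.sum_congr rfl fun i _ => ?_
          split_ifs <;> simp

theorem hell_prob_eq_lsum (D D' : Dynamics O A) (π : Policy O A) (H : ℕ) :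
    hell (D.prob (h := H) π) (D'.prob π) =
      lsum H (fun τ => (√(D.listProb π τ) - √(D'.listProb π τ)) ^ 2) := by
  simp only [hell, lsum, Dynamics.prob_eq_listProb]

/-- The Hellinger distance of whole episodes dominates that of the joint laws of the history of length `h`
and the tests with the actions that are executed afterwards. -/
theorem lsum_testHell_le (D D' : Dynamics O A) {π : Policy O A} {H h : ℕ} (hh : h ≤ H)
    (V : Finset (Test O A)) (s : List A) (hπ : π.Follows H h s) :
    lsum h (fun τ => π.wt [] τ * testHell D D' H (V.filter fun u => u.actions = s) τ) ≤
      hell (D.prob (h := H) π) (D'.prob π) := by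
  obtain ⟨m, rfl⟩ := Nat.exists_eq_add_of_le hh
  rw [hell_prob_eq_lsum, lsum_add]
  refine lsum_le_lsum fun τ hτ => ?_
  subst hτ
  have := wt_mul_testHell_le D D' hh V s hπ
  simpa using this

theorem Policy.explore_wt_of_lt (π : Policy O A) (h : ℕ) (s : List A) (κ r : List (O × A))
    (hr : κ.length + r.length < h) : (π.explore h s).wt κ r = π.wt κ r := by
  induction r generalizing κ with
  | nil => simp
  | cons x r ih =>
    simp only [List.length_cons] at hr
    rw [Policy.wt_cons, Policy.wt_cons, ih _ (by simp; omega)]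
    simp only [Policy.explore]
    rw [if_pos (by omega)]

theorem Policy.explore_wt_succ (π : Policy O A) (s : List A) (τ : List (O × A)) (x : O × A) :
    (π.explore (τ.length + 1) s).wt [] (τ ++ [x]) = π.wt [] τ / Fintype.card A := by
  rw [Policy.wt_append, π.explore_wt_of_lt _ _ _ _ (by simp), Policy.wt_cons]
  simp [Policy.explore, div_eq_mul_inv]

/-- The exploratory episodes with `h = l + 1` control the joint laws of the first `l` steps, any
observation and action at step `l + 1`, and the tests in `V`. -/
theorem lsum_testHell_succ_le (D D' : Dynamics O A) (π : Policy O A) {H l : ℕ} (hl : l + 1 ≤ H)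
    (V : Finset (Test O A)) :
    lsum l (fun τ => π.wt [] τ * ∑ x, testHell D D' H V (τ ++ [x])) ≤
      Fintype.card A * ∑ s ∈ V.image Test.actions,
        hell (D.prob (h := H) (π.explore (l + 1) s)) (D'.prob (π.explore (l + 1) s)) := by
  have h1 : ∀ τ, τ.length = l → π.wt [] τ * ∑ x, testHell D D' H V (τ ++ [x]) =
      Fintype.card A * ∑ s ∈ V.image Test.actions, ∑ x,
        (π.explore (l + 1) s).wt [] (τ ++ [x]) *
          testHell D D' H (V.filter fun u => u.actions = s) (τ ++ [x]) := by
    intro τ hτ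
    subst hτ
    simp only [Policy.explore_wt_succ]
    rw [Finset.sum_comm, Finset.mul_sum, Finset.mul_sum]
    refine Finset.sum_congr rfl fun x _ => ?_
    rw [← Finset.mul_sum, testHell, sum_eq_sum_actions V]
    simp only [testHell]
    have : (Fintype.card A : ℝ) ≠ 0 := by positivity
    field_simp
  rw [lsum_congr h1, lsum_mul_left, lsum_sum]
  refine mul_le_mul_of_nonneg_left (Finset.sum_le_sum fun s _ => ?_) (by positivity)
  rw [← lsum_succ_right (g := fun τ => (π.explore (l + 1) s).wt [] τ *
          testHell D D' H (V.filter fun u => u.actions = s) τ)]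
  exact lsum_testHell_le D D' hl V s (Policy.explore_follows _ _ _ _)

/-- The exploratory episodes of index `h` control the joint laws of the histories of length `h` and the
tests in `V`. -/
theorem lsum_testHell_le_explore (D D' : Dynamics O A) (π : Policy O A) {H h : ℕ} (hh : h ≤ H)
    (V : Finset (Test O A)) :
    lsum h (fun τ => π.wt [] τ * testHell D D' H V τ) ≤
      Fintype.card A * ∑ s ∈ V.image Test.actions,
        hell (D.prob (h := H) (π.explore h s)) (D'.prob (π.explore h s)) := by
  cases h with
  | zero =>
    rw [lsum_zero, Policy.wt_nil, one_mul]
    have hA : (1 : ℝ) ≤ Fintype.card A := by exact_mod_cast Fintype.card_pos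
    have h2 : testHell D D' H V [] ≤ ∑ s ∈ V.image Test.actions,
        hell (D.prob (h := H) (π.explore 0 s)) (D'.prob (π.explore 0 s)) := by
      rw [testHell, sum_eq_sum_actions V]
      refine Finset.sum_le_sum fun s _ => ?_
      have := lsum_testHell_le D D' hh V s (Policy.explore_follows π H 0 s)
      simpa [lsum_zero, testHell] using this
    refine h2.trans (le_mul_of_one_le_left ?_ hA)
    exact Finset.sum_nonneg fun s _ => hell_nonneg _ _
  | succ l =>
    refine le_trans ?_ (lsum_testHell_succ_le D D' π hh V)
    rw [lsum_succ_right]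
    refine lsum_le_lsum fun τ _ => ?_
    rw [Finset.mul_sum]
    refine Finset.sum_le_sum fun x _ => ?_
    exact mul_le_mul_of_nonneg_right (π.wt_append_singleton_le _ _ _)
      (Finset.sum_nonneg fun _ _ => sq_nonneg _)

end Dyn

/-! ### Representation of a regular process by core histories -/

section Core

/-- If the rows `S` of `M` have the rank of `M`, and some columns `K` of `S` have this rank too, then the
columns of `M` are the combinations of its core columns with the coefficients given by any generalized
inverse `Y` of `K`. -/
theorem core_columns {m m' n r : Type*} [Fintype m'] [Fintype n] [Fintype r] [DecidableEq n]
    (M : Matrix m n ℝ) (e : m' → m) (κ : r → n) (Y : Matrix r m' ℝ)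
    (hS : (M.submatrix e id).rank = M.rank) (hK : (M.submatrix e κ).rank = M.rank)
    (hY : M.submatrix e κ * Y * M.submatrix e κ = M.submatrix e κ) (i : m) (j : n) :
    M i j = ∑ k, M i (κ k) * (Y *ᵥ fun u => M (e u) j) k := by
  classical
  set S := M.submatrix e id with hSdef
  set K := M.submatrix e κ with hKdef
  -- the columns of `K` span the range of `S`
  have hKS : ∀ y : r → ℝ, K *ᵥ y = S *ᵥ (∑ k, y k • Pi.single (κ k) 1) := by
    intro y
    rw [Matrix.mulVec_sum]
    simp only [Matrix.mulVec_smul, Matrix.mulVec_single_one]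
    ext u
    simp [Matrix.mulVec, dotProduct, hSdef, hKdef, Matrix.col, mul_comm]
  have hle : LinearMap.range K.mulVecLin ≤ LinearMap.range S.mulVecLin := by
    rintro _ ⟨y, rfl⟩
    exact ⟨_, (hKS y).symm⟩
  have hrange : LinearMap.range K.mulVecLin = LinearMap.range S.mulVecLin :=
    Submodule.eq_of_le_of_finrank_eq hle (hK.trans hS.symm)
  -- the kernels of `S` and `M` agree
  have hker_le : LinearMap.ker M.mulVecLin ≤ LinearMap.ker S.mulVecLin := by
    intro v hv
    have hv' : M *ᵥ v = 0 := hv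
    have : S *ᵥ v = 0 := by
      ext u
      exact congrFun hv' (e u)
    exact this
  have hker : LinearMap.ker M.mulVecLin = LinearMap.ker S.mulVecLin := by
    refine Submodule.eq_of_le_of_finrank_eq hker_le ?_
    have h1 := LinearMap.finrank_range_add_finrank_ker M.mulVecLin
    have h2 := LinearMap.finrank_range_add_finrank_ker S.mulVecLin
    have h3 : Module.finrank ℝ (LinearMap.range S.mulVecLin) =
      Module.finrank ℝ (LinearMap.range M.mulVecLin) := hS
    omega
  -- the `j`-th column of `S` is in the range of `K`
  obtain ⟨y, hy⟩ : S *ᵥ Pi.single j 1 ∈ LinearMap.range K.mulVecLin := by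
    rw [hrange]; exact ⟨_, rfl⟩
  have hcol : S *ᵥ Pi.single j 1 = fun u => M (e u) j := by
    rw [Matrix.mulVec_single_one]; rfl
  have hy' : K *ᵥ y = fun u => M (e u) j := hy.trans hcol
  set c := Y *ᵥ fun u => M (e u) j with hc
  have hKc : K *ᵥ c = S *ᵥ Pi.single j 1 := by
    rw [hc, ← hy', Matrix.mulVec_mulVec, Matrix.mulVec_mulVec, hY, hy',
      hcol]
  have hmem : (Pi.single j 1 - ∑ k, c k • Pi.single (κ k) 1 : n → ℝ) ∈
      LinearMap.ker M.mulVecLin := by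
    rw [hker, LinearMap.mem_ker, Matrix.mulVecLin_apply, Matrix.mulVec_sub, ← hKS, hKc, sub_self]
  have h0 : M *ᵥ (Pi.single j 1 - ∑ k, c k • Pi.single (κ k) 1) = 0 := hmem
  rw [Matrix.mulVec_sub, Matrix.mulVec_sum] at h0
  simp only [Matrix.mulVec_smul, Matrix.mulVec_single_one] at h0
  have h1 := congrFun h0 i
  simp only [Pi.sub_apply, Finset.sum_apply, Pi.smul_apply, Matrix.col_apply, smul_eq_mul,
    Pi.zero_apply] at h1
  rw [sub_eq_zero.1 h1]
  exact Finset.sum_congr rfl fun k _ => mul_comm _ _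

variable {O A : Type*} [Fintype O] [Fintype A]

/-- Core histories `κ` of length `l` and a matrix `X` (the pseudoinverse of the core matrix) that maps
the predictive state of any history to coefficients with respect to the core histories. -/
structure CoreRep (D : Dynamics O A) (H l : ℕ) (V : Finset (Test O A)) (α : ℝ) where
  r : ℕ
  κ : Fin r → List (O × A)
  X : Matrix (Fin r) V ℝ
  length_κ : ∀ i, (κ i).length = l
  norm_X : L1OpNormLE X (1 / α)
  rep : ∀ (τ : List (O × A)) (t : Test O A), τ.length = l →
    D.cond H τ t = ∑ i, D.cond H (κ i) t * (X *ᵥ fun u : V => D.cond H τ u) i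

/-- A regular process has a representation by core histories, of size at most the PSR rank. -/
theorem exists_coreRep [Nonempty A] {D : Dynamics O A} {H : ℕ} {U : ℕ → Finset (Test O A)} {α : ℝ}
    (hc : D.IsCore H U) (hr : D.Regular H U α) {l : ℕ} (hl : l < H) :
    ∃ R : CoreRep D H l (U (l + 1)) α, R.r ≤ D.psrRank H := by
  classical
  obtain ⟨κ, hK, X, hX, hn⟩ := hr l hl
  refine ⟨⟨_, fun i => List.ofFn (κ i), X, fun i => List.length_ofFn, hn, ?_⟩, ?_⟩
  · intro τ t hτ
    subst hτ
    have := core_columns (D.dynMatrix H τ.length) (fun u : U (τ.length + 1) => u.1) κ X (hc _ hl) hK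
      hX.1 t τ.get
    simpa only [D.dynMatrix_eq, List.ofFn_get] using this
  · exact Finset.le_sup (f := fun h => (D.dynMatrix H h).rank) (Finset.mem_range.2 hl)

variable {D : Dynamics O A} {H l : ℕ} {V : Finset (Test O A)} {α : ℝ}

/-- The linear functional on predictive states that predicts the probability of the test `t`. -/
noncomputable def CoreRep.pred (R : CoreRep D H l V α) (t : Test O A) (x : V → ℝ) : ℝ :=
  ∑ i, D.cond H (R.κ i) t * (R.X *ᵥ x) i

theorem CoreRep.pred_cond (R : CoreRep D H l V α) {τ : List (O × A)} (hτ : τ.length = l)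
    (t : Test O A) : R.pred t (fun u => D.cond H τ u) = D.cond H τ t := (R.rep τ t hτ).symm

theorem CoreRep.pred_smul (R : CoreRep D H l V α) (t : Test O A) (c : ℝ) (x : V → ℝ) :
    R.pred t (fun u => c * x u) = c * R.pred t x := by
  have : (fun u => c * x u) = c • x := rfl
  simp only [pred, this, Matrix.mulVec_smul, Pi.smul_apply, smul_eq_mul, Finset.mul_sum]
  exact Finset.sum_congr rfl fun _ _ => by ring

theorem CoreRep.pred_sub (R : CoreRep D H l V α) (t : Test O A) (x y : V → ℝ) :
    R.pred t (fun u => x u - y u) = R.pred t x - R.pred t y := by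
  have : (fun u => x u - y u) = x - y := rfl
  simp only [pred, this, Matrix.mulVec_sub, Pi.sub_apply, mul_sub, Finset.sum_sub_distrib]

theorem CoreRep.pred_sum (R : CoreRep D H l V α) (t : Test O A) {ι : Type*} (s : Finset ι)
    (c : ι → ℝ) (x : ι → V → ℝ) :
    R.pred t (fun u => ∑ i ∈ s, x i u * c i) = ∑ i ∈ s, R.pred t (x i) * c i := by
  have : (fun u => ∑ i ∈ s, x i u * c i) = ∑ i ∈ s, c i • x i := by
    ext u; simp [mul_comm]
  simp only [pred, this, Matrix.mulVec_sum, Matrix.mulVec_smul, Finset.sum_apply, Pi.smul_apply,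
    smul_eq_mul, Finset.mul_sum, Finset.sum_mul]
  rw [Finset.sum_comm]
  exact Finset.sum_congr rfl fun _ _ => Finset.sum_congr rfl fun _ _ => by ring

theorem CoreRep.pred_joint (R : CoreRep D H l V α) {τ : List (O × A)} (hτ : τ.length = l)
    (t : Test O A) : R.pred t (fun u => D.joint H τ u) = D.joint H τ t := by
  simp only [D.joint_eq, R.pred_smul, R.pred_cond hτ]

/-- Predictions of a family of futures are controlled by the `ℓ¹`-norm of the state, if the
probabilities of the futures after each core history have sum at most `B`. -/
theorem sum_abs_combination_le {n m ι : Type*} [Fintype n] [Fintype m] {X : Matrix n m ℝ} {c : ℝ}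
    (hX : L1OpNormLE X c) (s : Finset ι) (p : ι → n → ℝ) (hp : ∀ t i, 0 ≤ p t i) {B : ℝ}
    (hB0 : 0 ≤ B) (hB : ∀ i, ∑ t ∈ s, p t i ≤ B) (x : m → ℝ) :
    ∑ t ∈ s, |∑ i, p t i * (X *ᵥ x) i| ≤ B * c * ∑ u, |x u| := by
  calc ∑ t ∈ s, |∑ i, p t i * (X *ᵥ x) i|
      ≤ ∑ t ∈ s, ∑ i, p t i * |(X *ᵥ x) i| := by
        refine Finset.sum_le_sum fun t _ => (Finset.abs_sum_le_sum_abs _ _).trans (le_of_eq ?_)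
        simp only [abs_mul, abs_of_nonneg (hp t _)]
    _ = ∑ i, (∑ t ∈ s, p t i) * |(X *ᵥ x) i| := by
        rw [Finset.sum_comm]; simp only [Finset.sum_mul]
    _ ≤ ∑ i, B * |(X *ᵥ x) i| :=
        Finset.sum_le_sum fun i _ => mul_le_mul_of_nonneg_right (hB i) (abs_nonneg _)
    _ ≤ B * c * ∑ u, |x u| := by
        rw [← Finset.mul_sum, mul_assoc]
        exact mul_le_mul_of_nonneg_left (hX x) hB0

theorem CoreRep.sum_abs_pred_le (R : CoreRep D H l V α) (T : Finset (Test O A)) {B : ℝ}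
    (hB0 : 0 ≤ B) (hB : ∀ i, ∑ t ∈ T, D.cond H (R.κ i) t ≤ B) (x : V → ℝ) :
    ∑ t ∈ T, |R.pred t x| ≤ B * (1 / α) * ∑ u, |x u| :=
  sum_abs_combination_le R.norm_X T (fun t i => D.cond H (R.κ i) t)
    (fun _ _ => D.cond_nonneg _ _ _) hB0 hB x

theorem Dynamics.exists_hist_pos (D : Dynamics O A) [Nonempty A] (l : ℕ) :
    ∃ τ : List (O × A), τ.length = l ∧ D.hist [] τ ≠ 0 := by
  by_contra! h
  have h1 := lsum_hist_mul_wt D (Policy.unif O A) l [] []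
  rw [lsum_congr (g' := fun _ => 0) fun τ hτ => by rw [h τ hτ, zero_mul]] at h1
  simp [lsum] at h1

/-- Regularity bounds `α` by the number of action sequences of the core tests. -/
theorem CoreRep.alpha_le [DecidableEq A] [Nonempty A] (R : CoreRep D H l V α) (hα : 0 < α)
    (hl : l < H) : α ≤ ((V.image Test.actions).card : ℝ) := by
  obtain ⟨τ, hτ, hpos⟩ := D.exists_hist_pos l
  -- the one-step tests are predicted correctly, so the predictive state of `τ` is not zero
  have hsum : ∑ o, D.cond H τ (some o, []) = 1 := by
    have h1 : τ.length < H := by omega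
    simp [Dynamics.cond, hpos, Dynamics.doProb, Dynamics.obsProb, h1, D.sum_one]
  set q : V → ℝ := fun u => D.cond H τ u
  have hq : 0 < ∑ u, |q u| := by
    refine lt_of_le_of_ne (Finset.sum_nonneg fun _ _ => abs_nonneg _) fun h0 => ?_
    have h2 : ∀ u, q u = 0 := fun u => by
      have := (Finset.sum_eq_zero_iff_of_nonneg fun u _ => abs_nonneg (q u)).1 h0.symm u
        (Finset.mem_univ u)
      exact abs_eq_zero.1 this
    have h3 : q = 0 := funext h2
    have h4 : ∀ o : O, D.cond H τ (some o, []) = 0 := fun o => by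
      rw [R.rep τ _ hτ]
      change ∑ i, D.cond H (R.κ i) _ * (R.X *ᵥ q) i = 0
      simp [h3]
    simp [h4] at hsum
  -- predicting the core tests themselves reproduces the state, so `1 ≤ |𝒰_A| / α`
  have h5 := R.sum_abs_pred_le V (B := (V.image Test.actions).card) (by positivity)
    (fun i => D.sum_cond_le (by rw [R.length_κ]; omega) V) q
  have h6 : ∑ t ∈ V, |R.pred t q| = ∑ u, |q u| := by
    rw [← Finset.sum_coe_sort V]
    exact Finset.sum_congr rfl fun u _ => by rw [R.pred_cond hτ]
  rw [h6] at h5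
  have h7 : 1 ≤ ((V.image Test.actions).card : ℝ) * (1 / α) := by
    by_contra! h
    nlinarith
  rw [mul_one_div, le_div_iff₀ hα] at h7
  linarith

end Core

/-! ### The elliptical potential argument -/

section Potential

variable {n : Type*} [Fintype n] [DecidableEq n]

theorem one_add_sum_le_prod {ι : Type*} (s : Finset ι) {f : ι → ℝ} (hf : ∀ i, 0 ≤ f i) :
    1 + ∑ i ∈ s, f i ≤ ∏ i ∈ s, (1 + f i) := by
  classical
  induction s using Finset.induction_on with
  | empty => simp
  | insert a s ha ih =>
    rw [Finset.sum_insert ha, Finset.prod_insert ha]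
    have h1 : 0 ≤ ∑ i ∈ s, f i := Finset.sum_nonneg fun i _ => hf i
    nlinarith [hf a, mul_nonneg (hf a) h1, mul_le_mul_of_nonneg_left ih (hf a)]

theorem one_add_trace_le_det {S : Matrix n n ℝ} (hS : S.PosSemidef) :
    1 + S.trace ≤ (1 + S).det := by
  have h1 : (1 + S).det = ∏ i, (1 + hS.1.eigenvalues i) := by
    have h2 := Matrix.eval_charpoly S (-1)
    rw [hS.1.charpoly_eq, Polynomial.eval_prod] at h2
    have h3 : Matrix.scalar n (-1 : ℝ) - S = -(1 + S) := by
      simp only [map_neg, map_one]; abel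
    rw [h3, Matrix.det_neg] at h2
    have h4 : ∏ i, Polynomial.eval (-1 : ℝ) (Polynomial.X - Polynomial.C (hS.1.eigenvalues i)) =
        (-1) ^ Fintype.card n * ∏ i, (1 + hS.1.eigenvalues i) := by
      rw [← Finset.card_univ, ← Finset.prod_const, ← Finset.prod_mul_distrib]
      refine Finset.prod_congr rfl fun i _ => ?_
      simp; ring
    have h5 := h4.symm.trans h2
    exact (mul_left_cancel₀ (pow_ne_zero _ (by norm_num)) h5).symm
  rw [h1, hS.1.trace_eq_sum_eigenvalues]
  exact one_add_sum_le_prod _ fun i => hS.eigenvalues_nonneg i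

theorem det_le_trace_pow {S : Matrix n n ℝ} (hS : S.PosSemidef) :
    S.det ≤ S.trace ^ Fintype.card n := by
  rw [hS.1.det_eq_prod_eigenvalues, hS.1.trace_eq_sum_eigenvalues, ← Finset.card_univ,
    ← Finset.prod_const]
  refine Finset.prod_le_prod (fun i _ => hS.eigenvalues_nonneg i) fun i _ => ?_
  exact Finset.single_le_sum (f := fun i => hS.1.eigenvalues i)
    (fun j _ => hS.eigenvalues_nonneg j) (Finset.mem_univ i)

open scoped MatrixOrder in
/-- One step of the potential argument: adding `G` to `Λ` multiplies the determinant by at least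
`1 + tr (Λ⁻¹ G)`. -/
theorem det_mul_le_det_add {Λ G : Matrix n n ℝ} (hΛ : Λ.PosDef) (hG : G.PosSemidef) :
    Λ.det * (1 + (Λ⁻¹ * G).trace) ≤ (Λ + G).det := by
  have hdet : IsUnit Λ.det := (Matrix.isUnit_iff_isUnit_det _).1 hΛ.isUnit
  set R := CFC.sqrt Λ⁻¹ with hR
  have hRR : R * R = Λ⁻¹ :=
    CFC.sqrt_mul_sqrt_self _ (Matrix.nonneg_iff_posSemidef.2 hΛ.inv.posSemidef)
  have hRh : Rᴴ = R := (Matrix.nonneg_iff_posSemidef.1 (CFC.sqrt_nonneg Λ⁻¹)).1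
  have hS : (R * G * R).PosSemidef := by
    have := hG.conjTranspose_mul_mul_same R
    rwa [hRh] at this
  have h1 := one_add_trace_le_det hS
  have h2 : (R * G * R).trace = (Λ⁻¹ * G).trace := by
    rw [Matrix.trace_mul_comm, ← Matrix.mul_assoc, hRR]
  have h3 : (1 + R * G * R).det = (1 + Λ⁻¹ * G).det := by
    rw [Matrix.det_one_add_mul_comm, ← Matrix.mul_assoc, hRR]
  have h4 : Λ + G = Λ * (1 + Λ⁻¹ * G) := by
    rw [mul_add, mul_one, ← Matrix.mul_assoc, Matrix.mul_nonsing_inv _ hdet, one_mul]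
  rw [h4, Matrix.det_mul, ← h3, ← h2]
  exact mul_le_mul_of_nonneg_left h1 hΛ.det_pos.le

/-- Cauchy-Schwarz for the dual norms given by `Λ` and `Λ⁻¹`. -/
theorem sq_dotProduct_le {Λ : Matrix n n ℝ} (hΛ : Λ.PosDef) (w x : n → ℝ) :
    (w ⬝ᵥ x) ^ 2 ≤ (w ⬝ᵥ Λ *ᵥ w) * (x ⬝ᵥ Λ⁻¹ *ᵥ x) := by
  have hdet : IsUnit Λ.det := (Matrix.isUnit_iff_isUnit_det _).1 hΛ.isUnit
  set z := Λ⁻¹ *ᵥ x with hz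
  have hx : x = Λ *ᵥ z := by
    rw [hz, Matrix.mulVec_mulVec, Matrix.mul_nonsing_inv _ hdet, Matrix.one_mulVec]
  have hsymm : Λᵀ = Λ := by
    have := hΛ.1; rwa [Matrix.IsHermitian, Matrix.conjTranspose_eq_transpose_of_trivial] at this
  have hxz : x ⬝ᵥ z = z ⬝ᵥ Λ *ᵥ z := by rw [dotProduct_comm, ← hx]
  have hzw : z ⬝ᵥ Λ *ᵥ w = w ⬝ᵥ x := by
    rw [Matrix.dotProduct_mulVec, ← Matrix.mulVec_transpose, hsymm, ← hx, dotProduct_comm]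
  have key : ∀ t : ℝ, 0 ≤ (z ⬝ᵥ Λ *ᵥ z) * (t * t) + (-2 * (w ⬝ᵥ x)) * t + w ⬝ᵥ Λ *ᵥ w := by
    intro t
    have := hΛ.posSemidef.dotProduct_mulVec_nonneg (w - t • z)
    simp only [star_trivial, Matrix.mulVec_sub, Matrix.mulVec_smul, sub_dotProduct,
      dotProduct_sub, smul_dotProduct, dotProduct_smul, smul_eq_mul, ← hx] at this
    rw [← hxz]
    rw [show z ⬝ᵥ x = x ⬝ᵥ z from dotProduct_comm _ _, hzw] at this
    linarith
  have h := discrim_le_zero key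
  unfold discrim at h
  rw [hxz]
  nlinarith

variable {Ω : Type*} [Fintype Ω]

/-- The regularized design matrix `λ I + ∑_{j < k} ∑_ω p_j(ω) x_ω x_ωᵀ`. -/
def design (lam : ℝ) (p : ℕ → Ω → ℝ) (x : Ω → n → ℝ) (k : ℕ) : Matrix n n ℝ :=
  lam • 1 + ∑ j ∈ Finset.range k, ∑ ω, p j ω • Matrix.vecMulVec (x ω) (x ω)

theorem posSemidef_sum_vecMulVec {p : Ω → ℝ} (hp : ∀ ω, 0 ≤ p ω) (x : Ω → n → ℝ) :
    (∑ ω, p ω • Matrix.vecMulVec (x ω) (x ω)).PosSemidef := by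
  refine Matrix.posSemidef_sum _ fun ω _ => ?_
  exact (Matrix.posSemidef_vecMulVec_self_star (x ω)).smul (hp ω)

theorem design_posDef {lam : ℝ} (hlam : 0 < lam) {p : ℕ → Ω → ℝ} (hp : ∀ j ω, 0 ≤ p j ω)
    (x : Ω → n → ℝ) (k : ℕ) : (design lam p x k).PosDef := by
  refine Matrix.PosDef.add_posSemidef (Matrix.PosDef.one.smul hlam) ?_
  exact Matrix.posSemidef_sum _ fun j _ => posSemidef_sum_vecMulVec (hp j) x

theorem dotProduct_design (lam : ℝ) (p : ℕ → Ω → ℝ) (x : Ω → n → ℝ) (k : ℕ) (w : n → ℝ) :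
    w ⬝ᵥ design lam p x k *ᵥ w =
      lam * ∑ i, w i ^ 2 + ∑ j ∈ Finset.range k, ∑ ω, p j ω * (w ⬝ᵥ x ω) ^ 2 := by
  simp only [design, Matrix.add_mulVec, Matrix.sum_mulVec, Matrix.smul_mulVec, dotProduct_add,
    dotProduct_sum, dotProduct_smul, Matrix.one_mulVec, Matrix.vecMulVec_mulVec, smul_eq_mul]
  congr 1
  · simp [dotProduct, sq]
  · refine Finset.sum_congr rfl fun j _ => Finset.sum_congr rfl fun ω _ => ?_
    simp only [op_smul_eq_smul, smul_eq_mul]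
    rw [dotProduct_comm (x ω) w]; ring

/-- `∑_ω p_k(ω) ‖x_ω‖²` in the norm given by the inverse of the design matrix. -/
noncomputable def potential (lam : ℝ) (p : ℕ → Ω → ℝ) (x : Ω → n → ℝ) (k : ℕ) : ℝ :=
  ∑ ω, p k ω * (x ω ⬝ᵥ (design lam p x k)⁻¹ *ᵥ x ω)

/-- The potentials telescope along the log-determinants of the design matrices, as
`x ≤ 2 log (1 + x)` for `0 ≤ x ≤ 1`. -/
theorem sum_potential_le {lam : ℝ} (hlam : 0 < lam) {p : ℕ → Ω → ℝ} (hp : ∀ j ω, 0 ≤ p j ω)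
    (hp1 : ∀ j, ∑ ω, p j ω ≤ 1) {x : Ω → n → ℝ} (hx : ∀ ω, ∑ i, x ω i ^ 2 ≤ lam) (K : ℕ) :
    ∑ k ∈ Finset.range K, potential lam p x k ≤
      2 * (Fintype.card n * Real.log (Fintype.card n + K)) := by
  set Λ := design lam p x with hΛdef
  have hΛ : ∀ k, (Λ k).PosDef := design_posDef hlam hp x
  have hinv : ∀ k ω, 0 ≤ x ω ⬝ᵥ (Λ k)⁻¹ *ᵥ x ω ∧ x ω ⬝ᵥ (Λ k)⁻¹ *ᵥ x ω ≤ 1 := by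
    intro k ω
    set z := (Λ k)⁻¹ *ᵥ x ω with hz
    have h0 : 0 ≤ x ω ⬝ᵥ z := (hΛ k).inv.posSemidef.dotProduct_mulVec_nonneg (x ω)
    refine ⟨h0, ?_⟩
    have hdet : IsUnit (Λ k).det := (Matrix.isUnit_iff_isUnit_det _).1 (hΛ k).isUnit
    have hxz : Λ k *ᵥ z = x ω := by
      rw [hz, Matrix.mulVec_mulVec, Matrix.mul_nonsing_inv _ hdet, Matrix.one_mulVec]
    -- the design matrix dominates `lam • 1`
    have h1 : lam * ∑ i, z i ^ 2 ≤ x ω ⬝ᵥ z := by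
      rw [dotProduct_comm, ← hxz, dotProduct_design]
      refine le_add_of_nonneg_right (Finset.sum_nonneg fun j _ => Finset.sum_nonneg fun ω _ => ?_)
      exact mul_nonneg (hp _ _) (sq_nonneg _)
    have h2 : (x ω ⬝ᵥ z) ^ 2 ≤ (∑ i, x ω i ^ 2) * ∑ i, z i ^ 2 := by
      simpa [dotProduct] using Finset.sum_mul_sq_le_sq_mul_sq Finset.univ (x ω) z
    have h3 : (x ω ⬝ᵥ z) ^ 2 ≤ x ω ⬝ᵥ z := by
      refine h2.trans (le_trans ?_ h1)
      exact mul_le_mul_of_nonneg_right (hx ω) (Finset.sum_nonneg fun i _ => sq_nonneg _)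
    by_contra! h
    nlinarith
  have hpot0 : ∀ k, 0 ≤ potential lam p x k := fun k =>
    Finset.sum_nonneg fun ω _ => mul_nonneg (hp _ _) (hinv k ω).1
  have hpot1 : ∀ k, potential lam p x k ≤ 1 := fun k =>
    (Finset.sum_le_sum fun ω _ => mul_le_of_le_one_right (hp k ω) (hinv k ω).2).trans (hp1 k)
  have hstep : ∀ k, potential lam p x k ≤
      2 * (Real.log (Λ (k + 1)).det - Real.log (Λ k).det) := by
    intro k
    set G := ∑ ω, p k ω • Matrix.vecMulVec (x ω) (x ω) with hG
    have h1 : Λ (k + 1) = Λ k + G := by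
      rw [hΛdef, design, Finset.sum_range_succ, ← add_assoc]; rfl
    have h2 : ((Λ k)⁻¹ * G).trace = potential lam p x k := by
      rw [hG, Matrix.mul_sum, Matrix.trace_sum]
      refine Finset.sum_congr rfl fun ω _ => ?_
      rw [Matrix.mul_smul, Matrix.trace_smul, Matrix.mul_vecMulVec, Matrix.trace_vecMulVec,
        smul_eq_mul, dotProduct_comm]
    have h3 := det_mul_le_det_add (hΛ k) (posSemidef_sum_vecMulVec (hp k) x)
    rw [← hG, h2, ← h1] at h3
    have h4 : 0 < 1 + potential lam p x k := by linarith [hpot0 k]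
    have h5 := Real.log_le_log (mul_pos (hΛ k).det_pos h4) h3
    rw [Real.log_mul (hΛ k).det_pos.ne' h4.ne'] at h5
    have h6 := Real.one_sub_inv_le_log_of_pos h4
    have h7 : potential lam p x k / 2 ≤ 1 - (1 + potential lam p x k)⁻¹ := by
      rw [show 1 - (1 + potential lam p x k)⁻¹ = potential lam p x k / (1 + potential lam p x k) by
        field_simp; ring]
      exact div_le_div_of_nonneg_left (hpot0 k) h4 (by linarith [hpot1 k])
    linarith
  have htrace : (Λ K).trace ≤ lam * (Fintype.card n + K) := by
    have h1 : (Λ K).trace = lam * Fintype.card n +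
        ∑ j ∈ Finset.range K, ∑ ω, p j ω * ∑ i, x ω i ^ 2 := by
      simp [hΛdef, design, Matrix.trace_add, Matrix.trace_sum, Matrix.trace_smul,
        Matrix.trace_vecMulVec, dotProduct, sq]
    have h2 : ∑ j ∈ Finset.range K, ∑ ω, p j ω * ∑ i, x ω i ^ 2 ≤
        ∑ j ∈ Finset.range K, lam := by
      refine Finset.sum_le_sum fun j _ => ?_
      calc ∑ ω, p j ω * ∑ i, x ω i ^ 2 ≤ ∑ ω, p j ω * lam :=
            Finset.sum_le_sum fun ω _ => mul_le_mul_of_nonneg_left (hx ω) (hp j ω)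
        _ = (∑ ω, p j ω) * lam := by rw [Finset.sum_mul]
        _ ≤ lam := mul_le_of_le_one_left hlam.le (hp1 j)
    rw [Finset.sum_const, Finset.card_range, nsmul_eq_mul] at h2
    rw [h1]; linarith
  calc ∑ k ∈ Finset.range K, potential lam p x k
      ≤ ∑ k ∈ Finset.range K, 2 * (Real.log (Λ (k + 1)).det - Real.log (Λ k).det) :=
        Finset.sum_le_sum fun k _ => hstep k
    _ = 2 * (Real.log (Λ K).det - Real.log (Λ 0).det) := by
        rw [← Finset.mul_sum, Finset.sum_range_sub (fun k => Real.log (Λ k).det)]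
    _ ≤ 2 * (Fintype.card n * Real.log (Fintype.card n + K)) := by
        have h0 : (Λ 0).det = lam ^ Fintype.card n := by
          simp [hΛdef, design]
        rcases isEmpty_or_nonempty n with hn | hn
        · simp
        · have hc : (0 : ℝ) < Fintype.card n := by exact_mod_cast Fintype.card_pos
          have h1 : (Λ K).det ≤ (lam * (Fintype.card n + K)) ^ Fintype.card n :=
            (det_le_trace_pow (hΛ K).posSemidef).trans
              (pow_le_pow_left₀ (hΛ K).posSemidef.trace_nonneg htrace _)
          have h2 := Real.log_le_log (hΛ K).det_pos h1
          rw [Real.log_pow, Real.log_mul hlam.ne' (by positivity)] at h2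
          rw [h0, Real.log_pow]
          linarith

/-- The elliptical potential lemma: if the `k`-th family of linear functionals is small in mean square
under the measures `p_j`, `j < k`, then the functionals are small on average under `p_k`. -/
theorem sum_abs_le_of_sq_sum_le {T : Type*} [Fintype T] {lam : ℝ} (hlam : 0 < lam)
    {p : ℕ → Ω → ℝ} (hp : ∀ j ω, 0 ≤ p j ω) (hp1 : ∀ j, ∑ ω, p j ω ≤ 1) {x : Ω → n → ℝ}
    (hx : ∀ ω, ∑ i, x ω i ^ 2 ≤ lam) {K : ℕ} {w : ℕ → T → n → ℝ} {B Γ : ℝ}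
    (hw : ∀ k < K, ∑ t, ∑ i, w k t i ^ 2 ≤ B)
    (hΓ : ∀ k < K, ∑ j ∈ Finset.range k, ∑ ω, p j ω * ∑ t, (w k t ⬝ᵥ x ω) ^ 2 ≤ Γ) :
    ∑ k ∈ Finset.range K, ∑ ω, p k ω * ∑ t, |w k t ⬝ᵥ x ω| ≤
      √(Fintype.card T * (lam * B + Γ)) *
        √(K * (2 * (Fintype.card n * Real.log (Fintype.card n + K)))) := by
  set Λ := design lam p x with hΛdef
  have hΛ : ∀ k, (Λ k).PosDef := design_posDef hlam hp x
  set ν : ℕ → Ω → ℝ := fun k ω => x ω ⬝ᵥ (Λ k)⁻¹ *ᵥ x ω with hν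
  have hν0 : ∀ k ω, 0 ≤ ν k ω := fun k ω =>
    (hΛ k).inv.posSemidef.dotProduct_mulVec_nonneg (x ω)
  have hwΛ : ∀ k t, 0 ≤ w k t ⬝ᵥ Λ k *ᵥ w k t := fun k t =>
    (hΛ k).posSemidef.dotProduct_mulVec_nonneg (w k t)
  -- the functionals are bounded in the norm of the design matrix, the points on average in the dual norm
  have hw1 : ∀ k < K, ∑ t, √(w k t ⬝ᵥ Λ k *ᵥ w k t) ≤ √(Fintype.card T * (lam * B + Γ)) := by
    intro k hk
    refine Real.le_sqrt_of_sq_le ?_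
    refine sq_sum_le_card_mul_sum_sq.trans ?_
    rw [Finset.card_univ]
    refine mul_le_mul_of_nonneg_left ?_ (by positivity)
    have h1 : ∀ t, √(w k t ⬝ᵥ Λ k *ᵥ w k t) ^ 2 = lam * ∑ i, w k t i ^ 2 +
        ∑ j ∈ Finset.range k, ∑ ω, p j ω * (w k t ⬝ᵥ x ω) ^ 2 := fun t => by
      rw [Real.sq_sqrt (hwΛ k t), dotProduct_design]
    simp only [h1]
    rw [Finset.sum_add_distrib, ← Finset.mul_sum]
    refine add_le_add (mul_le_mul_of_nonneg_left (hw k hk) hlam.le) (le_trans (le_of_eq ?_) (hΓ k hk))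
    rw [Finset.sum_comm]
    refine Finset.sum_congr rfl fun j _ => ?_
    rw [Finset.sum_comm]
    simp only [Finset.mul_sum]
  have hx1 : ∑ k ∈ Finset.range K, ∑ ω, p k ω * √(ν k ω) ≤
      √(K * (2 * (Fintype.card n * Real.log (Fintype.card n + K)))) := by
    have h2 : ∀ k, ∑ ω, p k ω * √(ν k ω) ≤ √(potential lam p x k) := by
      intro k
      calc ∑ ω, p k ω * √(ν k ω) = ∑ ω, √(p k ω) * √(p k ω * ν k ω) := by
            refine Finset.sum_congr rfl fun ω _ => ?_
            rw [Real.sqrt_mul (hp k ω), ← mul_assoc, Real.mul_self_sqrt (hp k ω)]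
        _ ≤ √(∑ ω, √(p k ω) ^ 2) * √(∑ ω, √(p k ω * ν k ω) ^ 2) :=
            Real.sum_mul_le_sqrt_mul_sqrt _ _ _
        _ ≤ 1 * √(potential lam p x k) := by
            refine mul_le_mul ?_ (le_of_eq ?_) (Real.sqrt_nonneg _) zero_le_one
            · refine Real.sqrt_le_one.2 ?_
              simpa only [Real.sq_sqrt (hp k _)] using hp1 k
            · simp only [Real.sq_sqrt (mul_nonneg (hp k _) (hν0 k _))]; rfl
        _ = _ := one_mul _
    refine (Finset.sum_le_sum fun k _ => h2 k).trans (Real.le_sqrt_of_sq_le ?_)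
    refine sq_sum_le_card_mul_sum_sq.trans ?_
    rw [Finset.card_range]
    refine mul_le_mul_of_nonneg_left ?_ (by positivity)
    refine le_trans (le_of_eq ?_) (sum_potential_le hlam hp hp1 hx K)
    refine Finset.sum_congr rfl fun k _ => Real.sq_sqrt ?_
    exact Finset.sum_nonneg fun ω _ => mul_nonneg (hp _ _) (hν0 k ω)
  calc ∑ k ∈ Finset.range K, ∑ ω, p k ω * ∑ t, |w k t ⬝ᵥ x ω|
      ≤ ∑ k ∈ Finset.range K, ∑ ω, √(Fintype.card T * (lam * B + Γ)) * (p k ω * √(ν k ω)) := by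
        refine Finset.sum_le_sum fun k hk => Finset.sum_le_sum fun ω _ => ?_
        have h3 : ∑ t, |w k t ⬝ᵥ x ω| ≤ √(Fintype.card T * (lam * B + Γ)) * √(ν k ω) := by
          refine le_trans ?_ (mul_le_mul_of_nonneg_right (hw1 k (Finset.mem_range.1 hk))
            (Real.sqrt_nonneg _))
          rw [Finset.sum_mul]
          refine Finset.sum_le_sum fun t _ => ?_
          rw [← Real.sqrt_mul (hwΛ k t)]
          exact Real.abs_le_sqrt (sq_dotProduct_le (hΛ k) _ _)
        calc p k ω * ∑ t, |w k t ⬝ᵥ x ω| ≤ p k ω * _ := mul_le_mul_of_nonneg_left h3 (hp k ω)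
          _ = _ := by ring
    _ = √(Fintype.card T * (lam * B + Γ)) * ∑ k ∈ Finset.range K, ∑ ω, p k ω * √(ν k ω) := by
        simp only [Finset.mul_sum]
    _ ≤ _ := mul_le_mul_of_nonneg_left hx1 (Real.sqrt_nonneg _)

end Potential

/-! ### Decomposition of the distance between two trajectory laws -/

section Telescope

variable {O A : Type*} [Fintype O] [Fintype A]

/-- The observation of `x`, then its action, then the test `t`. -/
def consTest (x : O × A) (t : Test O A) : Test O A := (some x.1, (x.2, t.1) :: t.2)

/-- The test that consists of the observations of a nonempty list and the actions between them; the
last action is dropped. -/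
def futTest : List (O × A) → Test O A
  | [] => (none, [])
  | [x] => (some x.1, [])
  | x :: y :: r => consTest x (futTest (y :: r))

theorem Dynamics.joint_consTest (D : Dynamics O A) {H : ℕ} {τ : List (O × A)} (hτ : τ.length < H)
    (x : O × A) (t : Test O A) : D.joint H τ (consTest x t) = D.joint H (τ ++ [x]) t :=
  D.joint_cons hτ x.1 x.2 t

theorem Dynamics.cond_consTest (D : Dynamics O A) {H : ℕ} {τ : List (O × A)} (hτ : τ.length < H)
    (x : O × A) (t : Test O A) :
    D.cond H τ (consTest x t) = D.cond H τ (some x.1, []) * D.cond H (τ ++ [x]) t :=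
  D.cond_cons hτ x.1 x.2 t

theorem Dynamics.doProb_futTest (D : Dynamics O A) {H : ℕ} (r : List (O × A)) (hr : r ≠ [])
    (τ : List (O × A)) (hτ : τ.length + r.length ≤ H) :
    D.doProb H τ (futTest r).1 (futTest r).2 = D.hist τ r := by
  induction r generalizing τ with
  | nil => exact absurd rfl hr
  | cons x r ih =>
    rw [List.length_cons] at hτ
    have h1 : τ.length < H := by omega
    cases r with
    | nil => simp [futTest, doProb, obsProb, h1, D.hist_cons]
    | cons y r =>
      rw [D.hist_cons, ← ih (by simp) (τ ++ [x]) (by simp at hτ ⊢; omega)]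
      simp [futTest, consTest, doProb, obsProb, h1]

theorem Dynamics.joint_futTest (D : Dynamics O A) {H : ℕ} {r : List (O × A)} (hr : r ≠ [])
    {τ : List (O × A)} (hτ : τ.length + r.length ≤ H) :
    D.joint H τ (futTest r) = D.hist [] (τ ++ r) := by
  rw [joint, D.doProb_futTest r hr τ hτ, D.hist_append, List.nil_append]

variable {D' : Dynamics O A} {H l : ℕ} {V V' : Finset (Test O A)} {α : ℝ}

/-- Weighted by a policy, the predictions of all futures are controlled by the `ℓ¹`-norm of the state. -/
theorem CoreRep.lsum_abs_pred_le (R : CoreRep D' H l V α) {n : ℕ} (hn : l + n ≤ H) (hn0 : n ≠ 0)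
    (π : Policy O A) (τ : List (O × A)) (x : V → ℝ) :
    lsum n (fun r => π.wt τ r * |R.pred (futTest r) x|) ≤ 1 / α * ∑ u, |x u| := by
  have h := sum_abs_combination_le R.norm_X (Finset.univ : Finset (Fin n → O × A))
    (fun r i => π.wt τ (List.ofFn r) * D'.cond H (R.κ i) (futTest (List.ofFn r)))
    (fun r i => mul_nonneg (π.wt_nonneg _ _) (D'.cond_nonneg _ _ _)) zero_le_one (fun i => ?_) x
  · rw [one_mul] at h
    refine le_trans (le_of_eq ?_) h
    unfold lsum
    refine Finset.sum_congr rfl fun r _ => ?_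
    simp only [mul_assoc, ← Finset.mul_sum]
    rw [abs_mul, abs_of_nonneg (π.wt_nonneg _ _)]
    rfl
  · rw [← lsum_hist_mul_wt D' π n (R.κ i) τ]
    refine lsum_le_lsum (g := fun r => π.wt τ r * D'.cond H (R.κ i) (futTest r)) fun r hr => ?_
    rw [mul_comm]
    refine mul_le_mul_of_nonneg_right ?_ (π.wt_nonneg _ _)
    refine (D'.cond_le_doProb _ _ _).trans (le_of_eq ?_)
    refine D'.doProb_futTest r ?_ _ (by rw [R.length_κ]; omega)
    rintro rfl
    simp at hr
    omega

/-- Predictions compose: predicting `x` and then `r` is predicting, at the next level, the state that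
is predicted for the time after `x`. -/
theorem CoreRep.pred_futTest_cons (R : CoreRep D' H l V α) (R' : CoreRep D' H (l + 1) V' α)
    (hl : l < H) (x : O × A) {r : List (O × A)} (hr : r ≠ []) (b : V → ℝ) :
    R.pred (futTest (x :: r)) b = R'.pred (futTest r) (fun u => R.pred (consTest x u) b) := by
  have h1 : ∀ (t : Test O A) (i : Fin R.r), D'.cond H (R.κ i) (consTest x t) =
      D'.cond H (R.κ i) (some x.1, []) * D'.cond H (R.κ i ++ [x]) t := fun t i =>
    D'.cond_consTest (by rw [R.length_κ]; exact hl) x t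
  obtain ⟨y, r, rfl⟩ := List.exists_cons_of_ne_nil hr
  have h2 : (fun u : V' => R.pred (consTest x u) b) = fun u : V' => ∑ i,
      (fun u : V' => D'.cond H (R.κ i ++ [x]) u) u *
        (D'.cond H (R.κ i) (some x.1, []) * (R.X *ᵥ b) i) := by
    ext u
    simp only [CoreRep.pred, h1]
    exact Finset.sum_congr rfl fun i _ => by ring
  rw [h2, R'.pred_sum]
  simp only [futTest]
  rw [CoreRep.pred]
  refine Finset.sum_congr rfl fun i _ => ?_
  rw [h1, R'.pred_cond (by simp [R.length_κ])]
  ring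

variable [DecidableEq O] [DecidableEq A]

/-- The tests that are needed to update the predictive state after a history of length `l`: an
observation, an action and a test of the next core set; for the last step the single observations. -/
def nextTests (U : ℕ → Finset (Test O A)) (H l : ℕ) : Finset (Test O A) :=
  if l + 1 < H then (Finset.univ ×ˢ U (l + 2)).image fun p : (O × A) × Test O A => consTest p.1 p.2
  else Finset.univ.image fun o : O => (some o, [])

theorem consTest_injective :
    Function.Injective fun p : (O × A) × Test O A => consTest p.1 p.2 := by
  rintro ⟨⟨o, a⟩, ⟨p, l⟩⟩ ⟨⟨o', a'⟩, ⟨p', l'⟩⟩ h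
  simp only [consTest, Prod.mk.injEq, Option.some.injEq, List.cons.injEq] at h
  simp [h.1, h.2.1.1, h.2.1.2, h.2.2]

theorem sum_nextTests_of_lt {U : ℕ → Finset (Test O A)} (hl : l + 1 < H) (g : Test O A → ℝ) :
    ∑ t ∈ nextTests U H l, g t = ∑ x, ∑ u ∈ U (l + 2), g (consTest x u) := by
  rw [nextTests, if_pos hl, Finset.sum_image consTest_injective.injOn, Finset.sum_product]

theorem sum_nextTests_of_not_lt {U : ℕ → Finset (Test O A)} (hl : ¬ l + 1 < H)
    (g : Test O A → ℝ) : ∑ t ∈ nextTests U H l, g t = ∑ o, g (some o, []) := by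
  rw [nextTests, if_neg hl, Finset.sum_image]
  intro o _ o' _ h
  simpa using h

/-- The error of the model `D'` in updating the true state after the history `τ`, weighted by the
probability of `τ`. -/
noncomputable def CoreRep.err (R : CoreRep D' H l V α) (D : Dynamics O A) (T : Finset (Test O A))
    (τ : List (O × A)) : ℝ :=
  ∑ t ∈ T, |D.joint H τ t - R.pred t (fun u => D.joint H τ u)|

theorem CoreRep.err_nonneg (R : CoreRep D' H l V α) (D : Dynamics O A) (T : Finset (Test O A))
    (τ : List (O × A)) : 0 ≤ R.err D T τ := Finset.sum_nonneg fun _ _ => abs_nonneg _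

/-- The telescoping estimate for the hybrid that follows the true dynamics for `l` steps and
then predicts with the model. -/
theorem lsum_hybrid_le (D : Dynamics O A) {U : ℕ → Finset (Test O A)} (hα : 0 < α)
    (R : ∀ l, l < H → CoreRep D' H l (U (l + 1)) α) (π : Policy O A) {E : ℕ → ℝ}
    (hE : ∀ l (hl : l < H), lsum l (fun τ => π.wt [] τ * (R l hl).err D (nextTests U H l) τ) ≤ E l)
    (n l : ℕ) (hl : l < H) (hn : l + (n + 1) = H) :
    lsum l (fun τ => lsum (n + 1) fun r => π.wt [] (τ ++ r) *
        |(R l hl).pred (futTest r) (fun u => D.joint H τ u) - D.hist [] (τ ++ r)|) ≤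
      (1 + 1 / α) * ∑ j ∈ Finset.Ico l H, E j := by
  have hα' : 0 < 1 / α := by positivity
  have hE0 : ∀ l, l < H → 0 ≤ E l := fun l hl => le_trans (lsum_nonneg fun τ _ =>
    mul_nonneg (π.wt_nonneg _ _) ((R l hl).err_nonneg _ _ _)) (hE l hl)
  induction n generalizing l with
  | zero =>
    have hlast : ¬ l + 1 < H := by omega
    have h1 : lsum l (fun τ => lsum 1 fun r => π.wt [] (τ ++ r) *
        |(R l hl).pred (futTest r) (fun u => D.joint H τ u) - D.hist [] (τ ++ r)|) ≤ E l := by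
      refine le_trans (lsum_le_lsum fun τ hτ => ?_) (hE l hl)
      rw [lsum_one, CoreRep.err, sum_nextTests_of_not_lt hlast, Fintype.sum_prod_type,
        Finset.mul_sum]
      refine Finset.sum_le_sum fun o _ => ?_
      have h2 : ∀ a : A, π.wt [] (τ ++ [(o, a)]) *
          |(R l hl).pred (futTest [(o, a)]) (fun u => D.joint H τ u) - D.hist [] (τ ++ [(o, a)])| =
          π.wt [] τ * |D.joint H τ (some o, []) -
            (R l hl).pred (some o, []) (fun u => D.joint H τ u)| * π.prob τ o a := by
        intro a
        rw [← D.joint_futTest (H := H) (r := [(o, a)]) (by simp) (by simp; omega), π.wt_append,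
          abs_sub_comm]
        simp only [Policy.wt_cons, Policy.wt_nil, futTest, List.nil_append]
        ring
      simp only [h2]
      rw [← Finset.mul_sum, π.sum_one, mul_one]
    have h3 : ∑ j ∈ Finset.Ico l H, E j = E l := by
      rw [show H = l + 1 by omega, Nat.Ico_succ_singleton, Finset.sum_singleton]
    rw [h3]
    have := hE0 l hl
    nlinarith [mul_nonneg hα'.le this]
  | succ n ih =>
    have hl1 : l + 1 < H := by omega
    have ih' := ih (l + 1) hl1 (by omega)
    rw [lsum_succ_right] at ih'
    set b : List (O × A) → Test O A → ℝ := fun τ u => D.joint H τ u with hb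
    have h1 : ∀ τ : List (O × A), τ.length = l → ∀ x : O × A,
        lsum (n + 1) (fun r => π.wt [] (τ ++ x :: r) *
          |(R l hl).pred (futTest (x :: r)) (fun u => b τ u) - D.hist [] (τ ++ x :: r)|) ≤
        π.wt [] τ * (1 / α * ∑ u ∈ U (l + 2), |b τ (consTest x u) -
            (R l hl).pred (consTest x u) (fun u => b τ u)|) +
          lsum (n + 1) (fun r => π.wt [] (τ ++ [x] ++ r) *
            |(R (l + 1) hl1).pred (futTest r) (fun u => b (τ ++ [x]) u) -
              D.hist [] (τ ++ [x] ++ r)|) := by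
      intro τ hτ x
      -- `y` is the one-step update error; the model propagates it with a loss of `1 / α`
      set y : U (l + 1 + 1) → ℝ := fun u => (R l hl).pred (consTest x u) (fun u => b τ u) -
        b (τ ++ [x]) u with hy
      have h2 := (R (l + 1) hl1).lsum_abs_pred_le (n := n + 1) (by omega) (by omega) π (τ ++ [x]) y
      have h3 : ∑ u, |y u| = ∑ u ∈ U (l + 2), |b τ (consTest x u) -
            (R l hl).pred (consTest x u) (fun u => b τ u)| := by
        rw [← Finset.sum_coe_sort (U (l + 2))]
        refine Finset.sum_congr rfl fun u _ => ?_
        rw [hy, abs_sub_comm]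
        simp only [hb]
        rw [D.joint_consTest (by omega)]
      rw [h3] at h2
      have h4 : ∀ r : List (O × A), r.length = n + 1 → π.wt [] (τ ++ x :: r) *
          |(R l hl).pred (futTest (x :: r)) (fun u => b τ u) - D.hist [] (τ ++ x :: r)| ≤
          π.wt [] τ * (π.wt (τ ++ [x]) r * |(R (l + 1) hl1).pred (futTest r) y|) +
          π.wt [] (τ ++ [x] ++ r) *
            |(R (l + 1) hl1).pred (futTest r) (fun u => b (τ ++ [x]) u) -
              D.hist [] (τ ++ [x] ++ r)| := by
        intro r hr
        have hr0 : r ≠ [] := by rintro rfl; simp at hr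
        rw [(R l hl).pred_futTest_cons (R (l + 1) hl1) hl x hr0, hy, CoreRep.pred_sub,
          show τ ++ x :: r = τ ++ [x] ++ r by simp]
        set p1 := (R (l + 1) hl1).pred (futTest r) (fun u => (R l hl).pred (consTest x u)
          fun u => b τ u)
        set p2 := (R (l + 1) hl1).pred (futTest r) (fun u => b (τ ++ [x]) u)
        have h5 : π.wt [] (τ ++ [x] ++ r) ≤ π.wt [] τ * π.wt (τ ++ [x]) r := by
          rw [π.wt_append]
          exact mul_le_mul_of_nonneg_right (π.wt_append_singleton_le _ _ _) (π.wt_nonneg _ _)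
        have h6 : |p1 - D.hist [] (τ ++ [x] ++ r)| ≤ |p1 - p2| + |p2 - D.hist [] (τ ++ [x] ++ r)| :=
          abs_sub_le _ _ _
        calc π.wt [] (τ ++ [x] ++ r) * |p1 - D.hist [] (τ ++ [x] ++ r)|
            ≤ π.wt [] (τ ++ [x] ++ r) * (|p1 - p2| + |p2 - D.hist [] (τ ++ [x] ++ r)|) :=
              mul_le_mul_of_nonneg_left h6 (π.wt_nonneg _ _)
          _ ≤ _ := by
              rw [mul_add, ← mul_assoc]
              exact add_le_add_left (mul_le_mul_of_nonneg_right h5 (abs_nonneg _)) _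
      refine (lsum_le_lsum h4).trans ?_
      rw [lsum_add_fun, lsum_mul_left]
      exact add_le_add_left (mul_le_mul_of_nonneg_left h2 (π.wt_nonneg _ _)) _
    have h7 : lsum l (fun τ => lsum (n + 1 + 1) fun r => π.wt [] (τ ++ r) *
        |(R l hl).pred (futTest r) (fun u => b τ u) - D.hist [] (τ ++ r)|) ≤
        1 / α * E l + (1 + 1 / α) * ∑ j ∈ Finset.Ico (l + 1) H, E j := by
      calc lsum l (fun τ => lsum (n + 1 + 1) fun r => π.wt [] (τ ++ r) *
            |(R l hl).pred (futTest r) (fun u => b τ u) - D.hist [] (τ ++ r)|)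
          ≤ lsum l (fun τ => 1 / α * (π.wt [] τ * (R l hl).err D (nextTests U H l) τ) +
            ∑ x, lsum (n + 1) (fun r => π.wt [] (τ ++ [x] ++ r) *
            |(R (l + 1) hl1).pred (futTest r) (fun u => b (τ ++ [x]) u) -
              D.hist [] (τ ++ [x] ++ r)|)) := by
            refine lsum_le_lsum fun τ hτ => ?_
            rw [lsum_succ, CoreRep.err, sum_nextTests_of_lt hl1]
            refine (Finset.sum_le_sum fun x _ => h1 τ hτ x).trans (le_of_eq ?_)
            rw [Finset.sum_add_distrib, ← Finset.mul_sum, ← Finset.mul_sum]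
            ring
        _ ≤ _ := by
            rw [lsum_add_fun, lsum_mul_left]
            exact add_le_add (mul_le_mul_of_nonneg_left (hE l hl) hα'.le) ih'
    refine h7.trans ?_
    rw [Finset.sum_eq_sum_Ico_succ_bot hl, mul_add]
    have := hE0 l hl
    linarith

/-- The distance of the trajectory laws under `π` is controlled by the errors of the initial state and
of the state updates along the true process. -/
theorem sum_abs_prob_sub_le (D : Dynamics O A) {U : ℕ → Finset (Test O A)} (hα : 0 < α)
    (hH : 1 ≤ H) (R : ∀ l, l < H → CoreRep D' H l (U (l + 1)) α) (π : Policy O A) {E : ℕ → ℝ}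
    (hE : ∀ l (hl : l < H), lsum l (fun τ => π.wt [] τ * (R l hl).err D (nextTests U H l) τ) ≤ E l) :
    ∑ τ : Fin H → O × A, |D'.prob π τ - D.prob π τ| ≤
      (1 + 1 / α) * (∑ u ∈ U 1, |D'.joint H [] u - D.joint H [] u| + ∑ l ∈ Finset.range H, E l) := by
  obtain ⟨n, rfl⟩ : ∃ n, H = n + 1 := ⟨H - 1, by omega⟩
  have hα' : 0 < 1 / α := by positivity
  have h1 := lsum_hybrid_le D hα R π hE n 0 (by omega) (by omega)
  rw [lsum_zero, ← Finset.range_eq_Ico] at h1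
  simp only [List.nil_append] at h1
  set R0 := R 0 (by omega)
  set y : U (0 + 1) → ℝ := fun u => D'.joint (n + 1) [] u - D.joint (n + 1) [] u with hy
  have h2 := R0.lsum_abs_pred_le (n := n + 1) (by omega) (by omega) π [] y
  have h3 : ∑ u, |y u| = ∑ u ∈ U 1, |D'.joint (n + 1) [] u - D.joint (n + 1) [] u| := by
    rw [← Finset.sum_coe_sort (U 1)]
  rw [h3] at h2
  have h4 : ∑ τ : Fin (n + 1) → O × A, |D'.prob π τ - D.prob π τ| ≤
      lsum (n + 1) (fun r => π.wt [] r * |R0.pred (futTest r) y|) +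
        lsum (n + 1) (fun r => π.wt [] r *
          |R0.pred (futTest r) (fun u => D.joint (n + 1) [] u) - D.hist [] r|) := by
    rw [← lsum_add_fun]
    simp only [Dynamics.prob_eq_listProb]
    refine lsum_le_lsum (g := fun r => |D'.listProb π r - D.listProb π r|) fun r hr => ?_
    have hr0 : r ≠ [] := by rintro rfl; simp at hr
    have h5 : R0.pred (futTest r) y =
        D'.hist [] r - R0.pred (futTest r) (fun u => D.joint (n + 1) [] u) := by
      rw [hy, CoreRep.pred_sub, R0.pred_joint rfl, D'.joint_futTest hr0 (by simp [hr]),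
        List.nil_append]
    rw [h5, Dynamics.listProb, Dynamics.listProb, ← sub_mul, abs_mul,
      abs_of_nonneg (π.wt_nonneg _ _), mul_comm, ← mul_add]
    exact mul_le_mul_of_nonneg_left (abs_sub_le _ _ _) (π.wt_nonneg _ _)
  have h6 : 0 ≤ ∑ u ∈ U 1, |D'.joint (n + 1) [] u - D.joint (n + 1) [] u| :=
    Finset.sum_nonneg fun _ _ => abs_nonneg _
  rw [mul_add]
  linarith

end Telescope

/-! ### Update errors and Hellinger distances -/

section Errors

/-- As `a - b = (√a - √b) (√a + √b)` and `√b ≤ √a + |√a - √b|`. -/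
theorem abs_sub_le_of_sqrt {a b P : ℝ} (ha : 0 ≤ a) (hb : 0 ≤ b) (haP : a ≤ P) :
    |a - b| ≤ 2 * √P * |√a - √b| + (√a - √b) ^ 2 := by
  set x := √a with hx
  set y := √b with hy
  have h1 : a = x ^ 2 := (Real.sq_sqrt ha).symm
  have h2 : b = y ^ 2 := (Real.sq_sqrt hb).symm
  have hx0 : 0 ≤ x := Real.sqrt_nonneg _
  have hy0 : 0 ≤ y := Real.sqrt_nonneg _
  have hxP : x ≤ √P := Real.sqrt_le_sqrt haP
  have h3 : y ≤ x + |x - y| := by linarith [neg_abs_le (x - y)]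
  calc |a - b| = |x - y| * (x + y) := by
        rw [h1, h2, show x ^ 2 - y ^ 2 = (x - y) * (x + y) by ring, abs_mul,
          abs_of_nonneg (by linarith : 0 ≤ x + y)]
    _ ≤ |x - y| * (2 * √P + |x - y|) :=
        mul_le_mul_of_nonneg_left (by linarith) (abs_nonneg _)
    _ = _ := by rw [← sq_abs (x - y)]; ring

variable {O A : Type*} [Fintype O] [Fintype A] [DecidableEq O] [DecidableEq A] [Nonempty A]

theorem Dynamics.cond_le_one (D : Dynamics O A) {H : ℕ} {τ : List (O × A)} (hτ : τ.length ≤ H)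
    (t : Test O A) : D.cond H τ t ≤ 1 := by
  simpa using D.sum_cond_le hτ {t}

theorem Dynamics.joint_le_hist (D : Dynamics O A) {H : ℕ} {τ : List (O × A)} (hτ : τ.length ≤ H)
    (t : Test O A) : D.joint H τ t ≤ D.hist [] τ := by
  rw [D.joint_eq]
  exact mul_le_of_le_one_right (D.hist_nonneg _ _) (D.cond_le_one hτ t)

theorem testHell_nonneg (D D' : Dynamics O A) (H : ℕ) (V : Finset (Test O A)) (τ : List (O × A)) :
    0 ≤ testHell D D' H V τ := Finset.sum_nonneg fun _ _ => sq_nonneg _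

theorem sum_abs_joint_sub_le (D D' : Dynamics O A) {H : ℕ} {τ : List (O × A)} (hτ : τ.length ≤ H)
    (V : Finset (Test O A)) {N Q : ℝ} (hN : (V.card : ℝ) ≤ N) (hQ : testHell D D' H V τ ≤ Q) :
    ∑ t ∈ V, |D.joint H τ t - D'.joint H τ t| ≤ 2 * √(D.hist [] τ) * √(N * Q) + Q := by
  have h1 : ∑ t ∈ V, |√(D.joint H τ t) - √(D'.joint H τ t)| ≤ √(N * Q) := by
    refine Real.le_sqrt_of_sq_le (sq_sum_le_card_mul_sum_sq.trans ?_)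
    simp only [sq_abs]
    have h0 : (0 : ℝ) ≤ N := (Nat.cast_nonneg _).trans hN
    exact mul_le_mul hN hQ (testHell_nonneg D D' H V τ) h0
  calc ∑ t ∈ V, |D.joint H τ t - D'.joint H τ t|
      ≤ ∑ t ∈ V, (2 * √(D.hist [] τ) * |√(D.joint H τ t) - √(D'.joint H τ t)| +
          (√(D.joint H τ t) - √(D'.joint H τ t)) ^ 2) :=
        Finset.sum_le_sum fun t _ => abs_sub_le_of_sqrt (D.joint_nonneg _ _ _)
          (D'.joint_nonneg _ _ _) (D.joint_le_hist hτ t)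
    _ = 2 * √(D.hist [] τ) * ∑ t ∈ V, |√(D.joint H τ t) - √(D'.joint H τ t)| +
          testHell D D' H V τ := by
        rw [Finset.sum_add_distrib, ← Finset.mul_sum, testHell]
    _ ≤ _ := add_le_add (mul_le_mul_of_nonneg_left h1 (by positivity)) hQ

variable {D D' : Dynamics O A} {H l : ℕ} {V T : Finset (Test O A)} {α : ℝ}

/-- The update error on the true state is at most the distance of the joint laws. -/
theorem CoreRep.err_le (R : CoreRep D' H l V α) {BT : ℝ} (hBT : 0 ≤ BT)
    (hT' : ∀ τ : List (O × A), τ.length = l → ∑ t ∈ T, D'.cond H τ t ≤ BT)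
    {τ : List (O × A)} (hτ : τ.length = l) :
    R.err D T τ ≤ ∑ t ∈ T, |D.joint H τ t - D'.joint H τ t| +
      BT * (1 / α) * ∑ u ∈ V, |D.joint H τ u - D'.joint H τ u| := by
  have h1 := R.sum_abs_pred_le T hBT (fun i => hT' _ (R.length_κ i))
    (fun u => D.joint H τ u - D'.joint H τ u)
  rw [Finset.sum_coe_sort V (fun u => |D.joint H τ u - D'.joint H τ u|)] at h1
  refine le_trans ?_ (add_le_add_right h1 _)
  rw [CoreRep.err, ← Finset.sum_add_distrib]
  refine Finset.sum_le_sum fun t _ => ?_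
  rw [R.pred_sub, R.pred_joint hτ, abs_sub_comm (R.pred t _) (D'.joint H τ t)]
  exact abs_sub_le _ _ _

/-- The update errors of conditional states are bounded. -/
theorem CoreRep.sum_abs_cond_sub_pred_le (R : CoreRep D' H l V α) (hα : 0 < α) {BT BV : ℝ}
    (hBT : 0 ≤ BT)
    (hT' : ∀ τ : List (O × A), τ.length = l → ∑ t ∈ T, D'.cond H τ t ≤ BT)
    (hT : ∀ τ : List (O × A), τ.length = l → ∑ t ∈ T, D.cond H τ t ≤ BT)
    (hV : ∀ τ : List (O × A), τ.length = l → ∑ u ∈ V, D.cond H τ u ≤ BV)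
    {τ : List (O × A)} (hτ : τ.length = l) :
    ∑ t ∈ T, |D.cond H τ t - R.pred t (fun u => D.cond H τ u)| ≤ BT + BT * (1 / α) * BV := by
  have h1 := R.sum_abs_pred_le T hBT (fun i => hT' _ (R.length_κ i)) (fun u => D.cond H τ u)
  simp only [abs_of_nonneg (D.cond_nonneg _ _ _)] at h1
  rw [Finset.sum_coe_sort V (fun u => D.cond H τ u)] at h1
  have h2 : BT * (1 / α) * ∑ u ∈ V, D.cond H τ u ≤ BT * (1 / α) * BV :=
    mul_le_mul_of_nonneg_left (hV τ hτ) (by positivity)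
  calc ∑ t ∈ T, |D.cond H τ t - R.pred t (fun u => D.cond H τ u)|
      ≤ ∑ t ∈ T, (D.cond H τ t + |R.pred t (fun u => D.cond H τ u)|) := by
        refine Finset.sum_le_sum fun t _ => (abs_sub _ _).trans ?_
        rw [abs_of_nonneg (D.cond_nonneg _ _ _)]
    _ ≤ _ := by
        rw [Finset.sum_add_distrib]
        exact add_le_add (hT τ hτ) (h1.trans h2)

theorem CoreRep.err_eq (R : CoreRep D' H l V α) (τ : List (O × A)) :
    R.err D T τ = D.hist [] τ * ∑ t ∈ T, |D.cond H τ t - R.pred t (fun u => D.cond H τ u)| := by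
  rw [CoreRep.err, Finset.mul_sum]
  refine Finset.sum_congr rfl fun t _ => ?_
  simp only [D.joint_eq, R.pred_smul]
  rw [← mul_sub, abs_mul, abs_of_nonneg (D.hist_nonneg _ _)]

/-- The mean square of the update error is controlled by the Hellinger distance `Q` of the joint laws of
`τ` and the relevant tests.  If `Q` exceeds the probability of `τ`, this holds as the conditional error
is bounded; otherwise `|a - b| ≤ 2 √a |√a - √b| + (√a - √b) ^ 2` and the Cauchy-Schwarz
inequality apply. -/
theorem CoreRep.hist_mul_sq_le (R : CoreRep D' H l V α) (hα : 0 < α) (hl : l ≤ H) {BT BV N : ℝ}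
    (hBT : 0 ≤ BT)
    (hT' : ∀ τ : List (O × A), τ.length = l → ∑ t ∈ T, D'.cond H τ t ≤ BT)
    (hT : ∀ τ : List (O × A), τ.length = l → ∑ t ∈ T, D.cond H τ t ≤ BT)
    (hV : ∀ τ : List (O × A), τ.length = l → ∑ u ∈ V, D.cond H τ u ≤ BV)
    (hTN : (T.card : ℝ) ≤ N) (hVN : (V.card : ℝ) ≤ N)
    {τ : List (O × A)} (hτ : τ.length = l) :
    D.hist [] τ * (∑ t ∈ T, |D.cond H τ t - R.pred t (fun u => D.cond H τ u)|) ^ 2 ≤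
      ((1 + BT * (1 / α)) ^ 2 * (8 * N + 2) + (BT + BT * (1 / α) * BV) ^ 2) *
        (testHell D D' H T τ + testHell D D' H V τ) := by
  set P := D.hist [] τ with hP
  set Q := testHell D D' H T τ + testHell D D' H V τ with hQ
  set c := BT * (1 / α) with hc
  set x := ∑ t ∈ T, |D.cond H τ t - R.pred t (fun u => D.cond H τ u)| with hx
  have hP0 : 0 ≤ P := D.hist_nonneg _ _
  have hc0 : 0 ≤ c := by positivity
  have hN0 : 0 ≤ N := (Nat.cast_nonneg _).trans hTN
  have hQT := testHell_nonneg D D' H T τ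
  have hQV := testHell_nonneg D D' H V τ
  have hQ0 : 0 ≤ Q := add_nonneg hQT hQV
  have hx0 : 0 ≤ x := Finset.sum_nonneg fun _ _ => abs_nonneg _
  have hxR : x ≤ BT + c * BV := R.sum_abs_cond_sub_pred_le hα hBT hT' hT hV hτ
  rcases le_or_gt Q P with h | h
  · rcases hP0.eq_or_lt with hP1 | hP1
    · rw [← hP1, zero_mul]; positivity
    have h1 : P * x ≤ (1 + c) * (2 * √P * √(N * Q) + Q) := by
      rw [hP, hx, ← R.err_eq]
      refine (R.err_le hBT hT' hτ).trans ?_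
      have h2 := sum_abs_joint_sub_le D D' (by omega : τ.length ≤ H) T hTN (le_add_of_nonneg_right hQV)
      have h3 := sum_abs_joint_sub_le D D' (by omega : τ.length ≤ H) V hVN (le_add_of_nonneg_left hQT)
      rw [add_mul, one_mul]
      exact add_le_add h2 (mul_le_mul_of_nonneg_left h3 hc0)
    have h2 : Q ≤ √P * √Q := by
      calc Q = √Q * √Q := (Real.mul_self_sqrt hQ0).symm
        _ ≤ _ := mul_le_mul_of_nonneg_right (Real.sqrt_le_sqrt h) (Real.sqrt_nonneg _)
    have h3 : P * x ≤ √P * ((1 + c) * √Q * (2 * √N + 1)) := by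
      refine h1.trans ?_
      rw [Real.sqrt_mul hN0]
      calc (1 + c) * (2 * √P * (√N * √Q) + Q) ≤ (1 + c) * (2 * √P * (√N * √Q) + √P * √Q) :=
            mul_le_mul_of_nonneg_left (by linarith) (by positivity)
        _ = _ := by ring
    have h4 : (P * x) ^ 2 ≤ P * ((1 + c) ^ 2 * (8 * N + 2) * Q) := by
      refine (pow_le_pow_left₀ (by positivity) h3 2).trans ?_
      rw [mul_pow, Real.sq_sqrt hP0, mul_pow, mul_pow, Real.sq_sqrt hQ0]
      refine mul_le_mul_of_nonneg_left ?_ hP0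
      have h5 : (2 * √N + 1) ^ 2 ≤ 8 * N + 2 := by
        nlinarith [Real.sq_sqrt hN0, sq_nonneg (2 * √N - 1)]
      calc (1 + c) ^ 2 * Q * (2 * √N + 1) ^ 2 ≤ (1 + c) ^ 2 * Q * (8 * N + 2) :=
            mul_le_mul_of_nonneg_left h5 (by positivity)
        _ = _ := by ring
    have h5 : P * x ^ 2 ≤ (1 + c) ^ 2 * (8 * N + 2) * Q := by
      refine le_of_mul_le_mul_left (a := P) ?_ hP1
      linarith [h4, show P * (P * x ^ 2) = (P * x) ^ 2 by ring]
    have h6 : 0 ≤ (BT + c * BV) ^ 2 * Q := by positivity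
    linarith [add_mul ((1 + c) ^ 2 * (8 * N + 2)) ((BT + c * BV) ^ 2) Q]
  · have h1 : P * x ^ 2 ≤ Q * (BT + c * BV) ^ 2 :=
      mul_le_mul h.le (pow_le_pow_left₀ hx0 hxR 2) (by positivity) hQ0
    have h6 : 0 ≤ (1 + c) ^ 2 * (8 * N + 2) * Q := by positivity
    linarith [add_mul ((1 + c) ^ 2 * (8 * N + 2)) ((BT + c * BV) ^ 2) Q]

/-- A regret bound at one level `l`: if the Hellinger distances between the `k`-th model and the truth,
on the histories of length `l` under the earlier policies, are bounded by `Γ`, then the sum of the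
update errors under the current policies is of order `√K`. -/
theorem sum_lsum_err_le (R : CoreRep D H l V α) (hα : 0 < α) (hl : l ≤ H) {BT BV N Γ : ℝ}
    (hBT : 0 ≤ BT) (hBV : 0 < BV) (D' : ℕ → Dynamics O A) (R' : ∀ k, CoreRep (D' k) H l V α)
    (π : ℕ → Policy O A) (K : ℕ)
    (hT : ∀ E : Dynamics O A, ∀ τ : List (O × A), τ.length = l → ∑ t ∈ T, E.cond H τ t ≤ BT)
    (hV : ∀ τ : List (O × A), τ.length = l → ∑ u ∈ V, D.cond H τ u ≤ BV)
    (hTN : (T.card : ℝ) ≤ N) (hVN : (V.card : ℝ) ≤ N)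
    (hΓ : ∀ k < K, ∑ j ∈ Finset.range k, lsum l (fun τ => (π j).wt [] τ *
      (testHell D (D' k) H T τ + testHell D (D' k) H V τ)) ≤ Γ) :
    ∑ k ∈ Finset.range K, lsum l (fun τ => (π k).wt [] τ * (R' k).err D T τ) ≤
      √(N * ((BV * (1 / α)) ^ 2 * (R.r * (BT + BT * (1 / α) * BV) ^ 2) +
        ((1 + BT * (1 / α)) ^ 2 * (8 * N + 2) + (BT + BT * (1 / α) * BV) ^ 2) * Γ)) *
        √(K * (2 * (R.r * Real.log (R.r + K)))) := by
  set C₁ := (1 + BT * (1 / α)) ^ 2 * (8 * N + 2) + (BT + BT * (1 / α) * BV) ^ 2 with hC₁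
  set q : (Fin l → O × A) → V → ℝ := fun τ u => D.cond H (List.ofFn τ) u with hq
  set x : (Fin l → O × A) → Fin R.r → ℝ := fun τ => R.X *ᵥ q τ with hx
  set p : ℕ → (Fin l → O × A) → ℝ := fun k τ =>
    (π k).wt [] (List.ofFn τ) * D.hist [] (List.ofFn τ) with hp
  set w : ℕ → T → Fin R.r → ℝ := fun k t i =>
    D.cond H (R.κ i) t - (R' k).pred t (fun u => D.cond H (R.κ i) u) with hw
  have hN0 : 0 ≤ N := (Nat.cast_nonneg _).trans hTN
  have hC₁0 : 0 ≤ C₁ := by positivity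
  have hp0 : ∀ k τ, 0 ≤ p k τ := fun k τ => mul_nonneg ((π k).wt_nonneg _ _) (D.hist_nonneg _ _)
  have hp1 : ∀ k, ∑ τ, p k τ ≤ 1 := by
    intro k
    rw [← lsum_hist_mul_wt D (π k) l [] []]
    exact le_of_eq (Finset.sum_congr rfl fun τ _ => mul_comm _ _)
  -- the update error after `τ` is linear in the coordinates `x τ` of its state in the true core histories,
  -- whose number is at most the PSR rank
  have hwx : ∀ k t τ, w k t ⬝ᵥ x τ = D.cond H (List.ofFn τ) t -
      (R' k).pred t (fun u => D.cond H (List.ofFn τ) u) := by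
    intro k t τ
    have h1 : (fun u : V => D.cond H (List.ofFn τ) u) = fun u : V => ∑ i,
        (fun u : V => D.cond H (R.κ i) u) u * x τ i := by
      ext u
      exact R.rep _ _ List.length_ofFn
    rw [h1, (R' k).pred_sum, R.rep (List.ofFn τ) t List.length_ofFn, ← Finset.sum_sub_distrib]
    refine Finset.sum_congr rfl fun i _ => ?_
    rw [hw, hx, hq]; ring
  have hxlam : ∀ τ, ∑ i, x τ i ^ 2 ≤ (BV * (1 / α)) ^ 2 := by
    intro τ
    have h1 : ∑ i, |x τ i| ≤ BV * (1 / α) := by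
      refine (R.norm_X (q τ)).trans ?_
      rw [mul_comm]
      refine mul_le_mul_of_nonneg_right ?_ (by positivity)
      simp only [hq, abs_of_nonneg (D.cond_nonneg _ _ _)]
      rw [Finset.sum_coe_sort V (fun u => D.cond H (List.ofFn τ) u)]
      exact hV _ List.length_ofFn
    refine le_trans ?_ (pow_le_pow_left₀ (Finset.sum_nonneg fun _ _ => abs_nonneg _) h1 2)
    simpa only [sq_abs] using
      Finset.sum_sq_le_sq_sum_of_nonneg (s := Finset.univ) fun i _ => abs_nonneg (x τ i)
  have hwB : ∀ k < K, ∑ t, ∑ i, w k t i ^ 2 ≤ R.r * (BT + BT * (1 / α) * BV) ^ 2 := by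
    intro k _
    rw [Finset.sum_comm]
    have h1 : ∀ i, ∑ t, w k t i ^ 2 ≤ (BT + BT * (1 / α) * BV) ^ 2 := by
      intro i
      have h2 := (R' k).sum_abs_cond_sub_pred_le (D := D) hα hBT (hT _) (hT _) hV (R.length_κ i)
      rw [← Finset.sum_coe_sort T] at h2
      refine le_trans ?_ (pow_le_pow_left₀ (Finset.sum_nonneg fun _ _ => abs_nonneg _) h2 2)
      simpa only [sq_abs] using
        Finset.sum_sq_le_sq_sum_of_nonneg (s := Finset.univ) fun t _ => abs_nonneg (w k t i)
    refine (Finset.sum_le_sum fun i _ => h1 i).trans (le_of_eq ?_)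
    simp
  have hΓ' : ∀ k < K, ∑ j ∈ Finset.range k, ∑ τ, p j τ * ∑ t, (w k t ⬝ᵥ x τ) ^ 2 ≤ C₁ * Γ := by
    intro k hk
    refine le_trans ?_ (mul_le_mul_of_nonneg_left (hΓ k hk) hC₁0)
    rw [Finset.mul_sum]
    refine Finset.sum_le_sum fun j _ => ?_
    rw [← lsum_mul_left]
    refine Finset.sum_le_sum fun τ _ => ?_
    simp only [hwx]
    have h2 := (R' k).hist_mul_sq_le (D := D) hα hl hBT (hT _) (hT _) hV hTN hVN
      (List.length_ofFn (f := τ))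
    have h3 : ∑ t : T, (D.cond H (List.ofFn τ) t -
        (R' k).pred t (fun u => D.cond H (List.ofFn τ) u)) ^ 2 ≤
        (∑ t ∈ T, |D.cond H (List.ofFn τ) t -
          (R' k).pred t (fun u => D.cond H (List.ofFn τ) u)|) ^ 2 := by
      rw [← Finset.sum_coe_sort T]
      simpa only [sq_abs] using
        Finset.sum_sq_le_sq_sum_of_nonneg (s := Finset.univ) fun (t : T) _ =>
          abs_nonneg (D.cond H (List.ofFn τ) t -
            (R' k).pred t (fun u => D.cond H (List.ofFn τ) u))
    have h4 := mul_le_mul_of_nonneg_left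
      ((mul_le_mul_of_nonneg_left h3 (D.hist_nonneg [] (List.ofFn τ))).trans h2)
      ((π j).wt_nonneg [] (List.ofFn τ))
    simp only [hp, mul_assoc]
    refine h4.trans (le_of_eq ?_)
    ring
  have key := sum_abs_le_of_sq_sum_le (lam := (BV * (1 / α)) ^ 2) (by positivity) hp0 hp1 hxlam hwB
    hΓ'
  -- `0 ≤ Γ` follows from the hypothesis for `k = 0`, unless there are no iterations
  have hΓ0 : 0 ≤ (BV * (1 / α)) ^ 2 * (R.r * (BT + BT * (1 / α) * BV) ^ 2) + C₁ * Γ ∨ K = 0 := by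
    rcases Nat.eq_zero_or_pos K with h | h
    · exact Or.inr h
    · left
      have := hΓ 0 h
      simp only [Finset.range_zero, Finset.sum_empty] at this
      positivity
  rcases hΓ0 with hΓ0 | hK
  · rw [Fintype.card_coe, Fintype.card_fin] at key
    refine le_trans (le_of_eq ?_) (key.trans (mul_le_mul_of_nonneg_right (Real.sqrt_le_sqrt
      (mul_le_mul_of_nonneg_right hTN hΓ0)) (Real.sqrt_nonneg _)))
    refine Finset.sum_congr rfl fun k _ => Finset.sum_congr rfl fun τ _ => ?_
    change (π k).wt [] (List.ofFn τ) * (R' k).err D T (List.ofFn τ) = _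
    rw [(R' k).err_eq, ← Finset.sum_coe_sort T]
    simp only [hwx, hp, mul_assoc]
  · subst hK; simp

end Errors

/-! ### From Hellinger distances of exploratory episodes to regret -/

section Regret

variable {O A : Type*} [Fintype O] [Fintype A] [DecidableEq O] [DecidableEq A] [Nonempty A]

/-- A common bound `S` for all the parameters of a problem. -/
structure SizeBound (U : ℕ → Finset (Test O A)) (H : ℕ) (α : ℝ) (d : ℕ) (S : ℝ) : Prop where
  card_O : (Fintype.card O : ℝ) ≤ S
  card_A : (Fintype.card A : ℝ) ≤ S
  card_U : ∀ h, 1 ≤ h → h ≤ H → ((U h).card : ℝ) ≤ S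
  card_acts : ∀ h, 1 ≤ h → h ≤ H → ((actionSeqs U h).card : ℝ) ≤ S
  inv_alpha : 1 / α ≤ S
  horizon : (H : ℝ) ≤ S
  rank : (d : ℝ) ≤ S
  one_le : 1 ≤ S

variable {U : ℕ → Finset (Test O A)} {H d : ℕ} {α S : ℝ}

theorem SizeBound.sum_cond_nextTests_le (hS : SizeBound U H α d S) (E : Dynamics O A) {l : ℕ}
    (hl : l < H) {τ : List (O × A)} (hτ : τ.length = l) :
    ∑ t ∈ nextTests U H l, E.cond H τ t ≤ S ^ 2 := by
  have hS1 := hS.one_le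
  have hlt : τ.length < H := by omega
  have hobs : ∑ o, E.cond H τ (some o, []) ≤ 1 := by
    rw [← E.sum_one τ]
    exact Finset.sum_le_sum fun o _ => E.cond_obs_le hlt o
  by_cases h : l + 1 < H
  · rw [sum_nextTests_of_lt h]
    calc ∑ x : O × A, ∑ u ∈ U (l + 2), E.cond H τ (consTest x u)
        ≤ ∑ x : O × A, E.cond H τ (some x.1, []) * S := by
          refine Finset.sum_le_sum fun x _ => ?_
          simp only [E.cond_consTest hlt, ← Finset.mul_sum]
          refine mul_le_mul_of_nonneg_left ?_ (E.cond_nonneg _ _ _)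
          refine (E.sum_cond_le (by simp; omega) _).trans ?_
          exact hS.card_acts (l + 2) (by omega) (by omega)
      _ = (∑ o, E.cond H τ (some o, [])) * (Fintype.card A * S) := by
          rw [Fintype.sum_prod_type, Finset.sum_mul]
          simp; exact Finset.sum_congr rfl fun _ _ => by ring
      _ ≤ 1 * (S * S) := by
          refine mul_le_mul hobs ?_ (by positivity) zero_le_one
          exact mul_le_mul_of_nonneg_right hS.card_A (by linarith)
      _ = S ^ 2 := by ring
  · rw [sum_nextTests_of_not_lt h]
    exact hobs.trans (one_le_pow₀ hS1)

theorem SizeBound.card_nextTests_le (hS : SizeBound U H α d S) (l : ℕ) :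
    ((nextTests U H l).card : ℝ) ≤ S ^ 3 := by
  have hS1 := hS.one_le
  have hS0 : 0 ≤ S := by linarith
  unfold nextTests
  split_ifs with h
  · refine (Nat.cast_le.2 Finset.card_image_le).trans ?_
    rw [Finset.card_product, Finset.card_univ, Fintype.card_prod]
    push_cast
    calc (Fintype.card O : ℝ) * Fintype.card A * (U (l + 2)).card ≤ S * S * S :=
          mul_le_mul (mul_le_mul hS.card_O hS.card_A (by positivity) hS0)
            (hS.card_U _ (by omega) (by omega)) (by positivity) (by positivity)
      _ = S ^ 3 := by ring
  · refine (Nat.cast_le.2 Finset.card_image_le).trans ?_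
    rw [Finset.card_univ]
    refine hS.card_O.trans ?_
    calc S = S ^ 1 := (pow_one S).symm
      _ ≤ S ^ 3 := pow_le_pow_right₀ hS1 (by norm_num)

/-- The sum of the Hellinger distances over the exploratory episodes that are based on `π`. -/
noncomputable def exploreHell (D D' : Dynamics O A) (U : ℕ → Finset (Test O A)) (H : ℕ)
    (π : Policy O A) : ℝ :=
  ∑ i : EpisodeIdx U H,
    hell (D.prob (h := H) (π.explore i.1 i.2.1)) (D'.prob (π.explore i.1 i.2.1))

theorem exploreHell_nonneg (D D' : Dynamics O A) (U : ℕ → Finset (Test O A)) (H : ℕ)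
    (π : Policy O A) : 0 ≤ exploreHell D D' U H π :=
  Finset.sum_nonneg fun _ _ => hell_nonneg _ _

theorem sum_hell_le_exploreHell (D D' : Dynamics O A) (π : Policy O A) {h : ℕ} (hh : h < H) :
    ∑ s ∈ (U (h + 1)).image Test.actions,
      hell (D.prob (h := H) (π.explore h s)) (D'.prob (π.explore h s)) ≤
      exploreHell D D' U H π := by
  rw [exploreHell, Fintype.sum_sigma, ← Finset.sum_coe_sort]
  exact Finset.single_le_sum (f := fun h : Fin H => ∑ s : actionSeqs U (h + 1),
    hell (D.prob (h := H) (π.explore h s.1)) (D'.prob (π.explore h s.1)))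
    (fun _ _ => Finset.sum_nonneg fun _ _ => hell_nonneg _ _) (Finset.mem_univ ⟨h, hh⟩)

theorem lsum_testHell_core_le (D D' : Dynamics O A) (π : Policy O A) {l : ℕ} (hl : l < H) :
    lsum l (fun τ => π.wt [] τ * testHell D D' H (U (l + 1)) τ) ≤
      Fintype.card A * exploreHell D D' U H π :=
  (lsum_testHell_le_explore D D' π hl.le _).trans
    (mul_le_mul_of_nonneg_left (sum_hell_le_exploreHell D D' π hl) (by positivity))

theorem lsum_testHell_nextTests_le (D D' : Dynamics O A) (π : Policy O A) {l : ℕ} (hl : l < H)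
    (hU : ∀ o : O, ((some o, []) : Test O A) ∈ U H) :
    lsum l (fun τ => π.wt [] τ * testHell D D' H (nextTests U H l) τ) ≤
      Fintype.card A * exploreHell D D' U H π := by
  by_cases h : l + 1 < H
  · refine le_trans ?_ ((lsum_testHell_succ_le D D' π h.le (U (l + 2))).trans
      (mul_le_mul_of_nonneg_left (sum_hell_le_exploreHell D D' π h) (by positivity)))
    refine lsum_le_lsum fun τ hτ => mul_le_mul_of_nonneg_left (le_of_eq ?_) (π.wt_nonneg _ _)
    rw [testHell, sum_nextTests_of_lt h]
    refine Finset.sum_congr rfl fun x _ => Finset.sum_congr rfl fun u _ => ?_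
    rw [D.joint_consTest (by omega), D'.joint_consTest (by omega)]
  · have hH : l + 1 = H := by omega
    refine le_trans ?_ (lsum_testHell_core_le D D' π hl)
    refine lsum_le_lsum fun τ hτ => mul_le_mul_of_nonneg_left ?_ (π.wt_nonneg _ _)
    refine Finset.sum_le_sum_of_subset_of_nonneg ?_ fun _ _ _ => sq_nonneg _
    rw [nextTests, if_neg h, hH]
    intro t ht
    obtain ⟨o, _, rfl⟩ := Finset.mem_image.1 ht
    exact hU o

theorem sqrt_mul_sqrt_le {a b c e : ℝ} (hab : a ≤ b) (hce : c ≤ e) : √a * √c ≤ √b * √e :=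
  mul_le_mul (Real.sqrt_le_sqrt hab) (Real.sqrt_le_sqrt hce) (Real.sqrt_nonneg _)
    (Real.sqrt_nonneg _)

/-- If the Hellinger distances of the `k`-th model to the truth, summed over all earlier exploratory
episodes, are bounded by `β` for every `k`, then the distances under the policies
`π k` themselves sum to `O(√K)`, up to a logarithm. -/
theorem sum_abs_prob_sub_le_sqrt {D : Dynamics O A} (hS : SizeBound U H α (D.psrRank H) S)
    (hH : 1 ≤ H) (hα : 0 < α) (hc : D.IsCore H U) (hr : D.Regular H U α)
    (hU : ∀ o : O, ((some o, []) : Test O A) ∈ U H)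
    (D' : ℕ → Dynamics O A) (hc' : ∀ k, (D' k).IsCore H U) (hr' : ∀ k, (D' k).Regular H U α)
    (π : ℕ → Policy O A) {K : ℕ} (hK : 1 ≤ K) {β : ℝ} (hβ : 1 ≤ β)
    (hell_le : ∀ k < K, ∑ j ∈ Finset.range k, exploreHell D (D' k) U H (π j) ≤ β) :
    ∑ k ∈ Finset.range K, ∑ τ : Fin H → O × A, |(D' k).prob (π k) τ - D.prob (π k) τ| ≤
      4 * S ^ 2 * (√(92 * S ^ 16 * β) * √(K * (2 * (S * Real.log (S + K))))) := by
  have hS1 := hS.one_le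
  have hS0 : 0 ≤ S := by linarith
  have hα' : 0 ≤ 1 / α := by positivity
  have hKr : (1 : ℝ) ≤ K := by exact_mod_cast hK
  set Ψ := √(92 * S ^ 16 * β) * √(K * (2 * (S * Real.log (S + K)))) with hΨ
  have hΨ0 : 0 ≤ Ψ := by positivity
  choose R hRd using fun l (hl : l < H) => exists_coreRep hc hr hl
  choose R' _ using fun k l (hl : l < H) => exists_coreRep (hc' k) (hr' k) hl
  have hlog : ∀ m : ℕ, (m : ℝ) ≤ S →
      K * (2 * (m * Real.log (m + K))) ≤ K * (2 * (S * Real.log (S + K))) := by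
    intro m hm
    have h1 : Real.log (m + K) ≤ Real.log (S + K) :=
      Real.log_le_log (by positivity) (by linarith)
    have h2 : 0 ≤ Real.log (m + K) := Real.log_nonneg (by
      have : (0 : ℝ) ≤ m := by positivity
      linarith)
    exact mul_le_mul_of_nonneg_left (mul_le_mul_of_nonneg_left
      (mul_le_mul hm h1 h2 hS0) (by norm_num)) (by positivity)
  -- update errors
  have hE : ∀ l (hl : l < H), ∑ k ∈ Finset.range K, lsum l (fun τ => (π k).wt [] τ *
      (R' k l hl).err D (nextTests U H l) τ) ≤ Ψ := by
    intro l hl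
    have hUc : ((U (l + 1)).card : ℝ) ≤ S ^ 3 := by
      refine (hS.card_U (l + 1) (by omega) (by omega)).trans ?_
      calc S = S ^ 1 := (pow_one S).symm
        _ ≤ S ^ 3 := pow_le_pow_right₀ hS1 (by norm_num)
    have key := sum_lsum_err_le (R l hl) hα hl.le (BT := S ^ 2) (BV := S) (N := S ^ 3)
      (Γ := 2 * S * β) (by positivity) (by linarith) D' (fun k => R' k l hl) π K
      (fun E τ hτ => hS.sum_cond_nextTests_le E hl hτ)
      (fun τ hτ => (D.sum_cond_le (by omega) _).trans (hS.card_acts (l + 1) (by omega) (by omega)))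
      (hS.card_nextTests_le l) hUc ?_
    · refine key.trans (sqrt_mul_sqrt_le ?_ (hlog _ ?_))
      · have hd : ((R l hl).r : ℝ) ≤ S := (Nat.cast_le.2 (hRd l hl)).trans hS.rank
        have h1 : S ^ 2 * (1 / α) ≤ S ^ 3 :=
          (mul_le_mul_of_nonneg_left hS.inv_alpha (by positivity)).trans (le_of_eq (by ring))
        have h2 : S ^ 2 + S ^ 2 * (1 / α) * S ≤ 2 * S ^ 4 := by
          have h3 := mul_le_mul_of_nonneg_right h1 hS0
          have h4 : S ^ 2 ≤ S ^ 4 := pow_le_pow_right₀ hS1 (by norm_num)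
          linarith [show S ^ 3 * S = S ^ 4 by ring]
        have h5 : 1 + S ^ 2 * (1 / α) ≤ 2 * S ^ 3 := by
          linarith [one_le_pow₀ hS1 (n := 3)]
        have h6 : S * (1 / α) ≤ S ^ 2 :=
          (mul_le_mul_of_nonneg_left hS.inv_alpha hS0).trans (le_of_eq (by ring))
        have h7 : 8 * S ^ 3 + 2 ≤ 10 * S ^ 3 := by linarith [one_le_pow₀ hS1 (n := 3)]
        have h8 : (S ^ 2 + S ^ 2 * (1 / α) * S) ^ 2 ≤ (2 * S ^ 4) ^ 2 :=
          pow_le_pow_left₀ (by positivity) h2 2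
        have h9 : (1 + S ^ 2 * (1 / α)) ^ 2 ≤ (2 * S ^ 3) ^ 2 :=
          pow_le_pow_left₀ (by positivity) h5 2
        have h10 : (S * (1 / α)) ^ 2 ≤ (S ^ 2) ^ 2 := pow_le_pow_left₀ (by positivity) h6 2
        calc S ^ 3 * ((S * (1 / α)) ^ 2 * ((R l hl).r * (S ^ 2 + S ^ 2 * (1 / α) * S) ^ 2) +
              ((1 + S ^ 2 * (1 / α)) ^ 2 * (8 * S ^ 3 + 2) +
                (S ^ 2 + S ^ 2 * (1 / α) * S) ^ 2) * (2 * S * β))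
            ≤ S ^ 3 * ((S ^ 2) ^ 2 * (S * (2 * S ^ 4) ^ 2) +
              ((2 * S ^ 3) ^ 2 * (10 * S ^ 3) + (2 * S ^ 4) ^ 2) * (2 * S * β)) := by
              gcongr
          _ = 4 * S ^ 16 * 1 + 80 * S ^ 13 * β + 8 * S ^ 12 * β := by ring
          _ ≤ 4 * S ^ 16 * β + 80 * S ^ 16 * β + 8 * S ^ 16 * β := by
              gcongr <;> first | exact hS1 | norm_num
          _ = 92 * S ^ 16 * β := by ring
      · exact (Nat.cast_le.2 (hRd l hl)).trans hS.rank
    · intro k hk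
      have h1 : ∀ j, lsum l (fun τ => (π j).wt [] τ * (testHell D (D' k) H (nextTests U H l) τ +
          testHell D (D' k) H (U (l + 1)) τ)) ≤ 2 * S * exploreHell D (D' k) U H (π j) := by
        intro j
        simp only [mul_add]
        rw [lsum_add_fun]
        have h2 := lsum_testHell_nextTests_le D (D' k) (π j) hl hU
        have h3 := lsum_testHell_core_le (U := U) D (D' k) (π j) hl
        have h4 := mul_le_mul_of_nonneg_right hS.card_A (exploreHell_nonneg D (D' k) U H (π j))
        linarith
      refine (Finset.sum_le_sum fun j _ => h1 j).trans ?_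
      rw [← Finset.mul_sum]
      exact mul_le_mul_of_nonneg_left (hell_le k hk) (by positivity)
  -- errors of the initial state: the potential argument in dimension one
  have h0 : ∑ k ∈ Finset.range K, ∑ u ∈ U 1, |(D' k).joint H [] u - D.joint H [] u| ≤ Ψ := by
    have hle1 : ∀ (E : Dynamics O A) u, E.joint H [] u ≤ 1 := fun E u =>
      (E.joint_le_hist (by simp) u).trans (le_of_eq rfl)
    have hU1 := hS.card_U 1 le_rfl hH
    have key := sum_abs_le_of_sq_sum_le (n := Unit) (Ω := Unit) (T := U 1) (lam := 1) one_pos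
      (p := fun _ _ => 1) (fun _ _ => zero_le_one) (fun _ => by simp) (x := fun _ _ => 1)
      (fun _ => by simp) (K := K)
      (w := fun k u _ => (D' k).joint H [] u - D.joint H [] u) (B := S) (Γ := 4 * S * β) ?_ ?_
    · simp only [dotProduct, Finset.univ_unique, Finset.sum_singleton, mul_one, one_mul,
        Fintype.card_coe, Fintype.card_unit, Nat.cast_one] at key
      refine le_trans (le_of_eq ?_) (key.trans (sqrt_mul_sqrt_le ?_ ?_))
      · refine Finset.sum_congr rfl fun k _ => ?_
        rw [Finset.sum_coe_sort (U 1) (fun u => |(D' k).joint H [] u - D.joint H [] u|)]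
      · calc ((U 1).card : ℝ) * (S + 4 * S * β) ≤ S * (S + 4 * S * β) := by gcongr
          _ = S ^ 2 * 1 + 4 * S ^ 2 * β := by ring
          _ ≤ S ^ 16 * β + 4 * S ^ 16 * β := by gcongr <;> first | exact hS1 | norm_num
          _ ≤ 92 * S ^ 16 * β := by
              have : 0 ≤ S ^ 16 * β := by positivity
              linarith
      · simpa using hlog 1 (by simpa using hS1)
    · intro k _
      have h1 : ∀ u : U 1, ((D' k).joint H [] u - D.joint H [] u) ^ 2 ≤ 1 := by
        intro u
        rw [sq_le_one_iff_abs_le_one, abs_le]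
        constructor <;> linarith [hle1 (D' k) u, hle1 D u, (D' k).joint_nonneg H [] u,
          D.joint_nonneg H [] u]
      calc ∑ u : U 1, ∑ _i : Unit, ((D' k).joint H [] u - D.joint H [] u) ^ 2
          ≤ ∑ u : U 1, 1 := Finset.sum_le_sum fun u _ => by simpa using h1 u
        _ ≤ S := by simpa using hU1
    · intro k hk
      have h1 : ∀ u : U 1, ((D' k).joint H [] u - D.joint H [] u) ^ 2 ≤
          4 * (√(D.joint H [] u) - √((D' k).joint H [] u)) ^ 2 := by
        intro u
        have ha := D.joint_nonneg H [] u
        have hb := (D' k).joint_nonneg H [] u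
        have ha1 : √(D.joint H [] u) ≤ 1 := Real.sqrt_le_one.2 (hle1 _ _)
        have hb1 : √((D' k).joint H [] u) ≤ 1 := Real.sqrt_le_one.2 (hle1 _ _)
        have ha2 := Real.sqrt_nonneg (D.joint H [] u)
        have hb2 := Real.sqrt_nonneg ((D' k).joint H [] u)
        calc ((D' k).joint H [] u - D.joint H [] u) ^ 2
            = (√((D' k).joint H [] u) ^ 2 - √(D.joint H [] u) ^ 2) ^ 2 := by
              rw [Real.sq_sqrt ha, Real.sq_sqrt hb]
          _ = (√(D.joint H [] u) + √((D' k).joint H [] u)) ^ 2 *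
                (√(D.joint H [] u) - √((D' k).joint H [] u)) ^ 2 := by ring
          _ ≤ _ := mul_le_mul_of_nonneg_right (by nlinarith) (sq_nonneg _)
      have h2 : ∀ j, ∑ u : U 1, ((D' k).joint H [] u - D.joint H [] u) ^ 2 ≤
          4 * S * exploreHell D (D' k) U H (π j) := by
        intro j
        have h3 := lsum_testHell_core_le (U := U) D (D' k) (π j) (l := 0) hH
        rw [lsum_zero, Policy.wt_nil, one_mul] at h3
        have h4 := mul_le_mul_of_nonneg_right hS.card_A (exploreHell_nonneg D (D' k) U H (π j))
        have h5 : ∑ u : U 1, ((D' k).joint H [] u - D.joint H [] u) ^ 2 ≤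
            4 * testHell D (D' k) H (U 1) [] := by
          rw [testHell, Finset.mul_sum, ← Finset.sum_coe_sort (U 1)]
          exact Finset.sum_le_sum fun u _ => h1 u
        simp only [zero_add] at h3
        linarith
      simp only [dotProduct, Finset.univ_unique, Finset.sum_singleton, mul_one, one_mul]
      refine (Finset.sum_le_sum fun j _ => h2 j).trans ?_
      rw [← Finset.mul_sum]
      exact mul_le_mul_of_nonneg_left (hell_le k hk) (by positivity)
  set E : ℕ → ℕ → ℝ := fun k l => if hl : l < H then lsum l (fun τ => (π k).wt [] τ *
      (R' k l hl).err D (nextTests U H l) τ) else 0 with hEdef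
  have h1 : ∀ k, ∑ τ : Fin H → O × A, |(D' k).prob (π k) τ - D.prob (π k) τ| ≤
      (1 + 1 / α) * (∑ u ∈ U 1, |(D' k).joint H [] u - D.joint H [] u| +
        ∑ l ∈ Finset.range H, E k l) := fun k =>
    sum_abs_prob_sub_le D hα hH (R' k) (π k) fun l hl => by simp [hEdef, hl]
  have h2 : ∑ k ∈ Finset.range K, ∑ l ∈ Finset.range H, E k l ≤ H * Ψ := by
    rw [Finset.sum_comm]
    calc ∑ l ∈ Finset.range H, ∑ k ∈ Finset.range K, E k l ≤ ∑ l ∈ Finset.range H, Ψ := by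
          refine Finset.sum_le_sum fun l hl => ?_
          have hl' := Finset.mem_range.1 hl
          simpa [hEdef, hl'] using hE l hl'
      _ = H * Ψ := by simp
  calc ∑ k ∈ Finset.range K, ∑ τ : Fin H → O × A, |(D' k).prob (π k) τ - D.prob (π k) τ|
      ≤ (1 + 1 / α) * (∑ k ∈ Finset.range K, ∑ u ∈ U 1, |(D' k).joint H [] u - D.joint H [] u| +
        ∑ k ∈ Finset.range K, ∑ l ∈ Finset.range H, E k l) := by
        rw [← Finset.sum_add_distrib, Finset.mul_sum]
        exact Finset.sum_le_sum fun k _ => h1 k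
    _ ≤ (S + S) * (S * Ψ + S * Ψ) := by
        have h3 : (H : ℝ) * Ψ ≤ S * Ψ := mul_le_mul_of_nonneg_right hS.horizon hΨ0
        have h4 : Ψ ≤ S * Ψ := le_mul_of_one_le_left hΨ0 hS1
        have h5 : 0 ≤ S * Ψ := by positivity
        refine mul_le_mul (add_le_add hS1 hS.inv_alpha) (by linarith) ?_ (by linarith)
        refine add_nonneg ?_ ?_
        · exact Finset.sum_nonneg fun _ _ => Finset.sum_nonneg fun _ _ => abs_nonneg _
        · refine Finset.sum_nonneg fun k _ => Finset.sum_nonneg fun l _ => ?_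
          simp only [hEdef]
          split_ifs with hl
          · exact lsum_nonneg fun τ _ =>
              mul_nonneg ((π k).wt_nonneg _ _) ((R' k l hl).err_nonneg _ _ _)
          · exact le_rfl
    _ = 4 * S ^ 2 * Ψ := by ring

end Regret

/-! ### Likelihood ratios -/

section Likelihood

variable {O A : Type*} [Fintype O] [Fintype A] [DecidableEq O] [DecidableEq A] [Nonempty A]
variable {U : ℕ → Finset (Test O A)} {H : ℕ}

/-- The likelihood of the data `x` of the iteration after the data `L`, when `q π τ` is the likelihood
of the trajectory `τ` under the policy `π`. -/
noncomputable def Learner.stepLik (alg : Learner U H) (q : Policy O A → (Fin H → O × A) → ℝ)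
    (L : List (RoundData U H)) (x : RoundData U H) : ℝ :=
  ∏ i, q (alg.execPolicy L i) (x i)

/-- The likelihood of the data `L` of all iterations. -/
noncomputable def Learner.lik (alg : Learner U H) (q : Policy O A → (Fin H → O × A) → ℝ)
    (L : List (RoundData U H)) : ℝ :=
  pathProd (alg.stepLik q) [] L

theorem Learner.stepLik_nonneg (alg : Learner U H) {q : Policy O A → (Fin H → O × A) → ℝ}
    (hq : ∀ π τ, 0 ≤ q π τ) (L : List (RoundData U H)) (x : RoundData U H) :
    0 ≤ alg.stepLik q L x := Finset.prod_nonneg fun _ _ => hq _ _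

theorem Learner.lik_nonneg (alg : Learner U H) {q : Policy O A → (Fin H → O × A) → ℝ}
    (hq : ∀ π τ, 0 ≤ q π τ) (L : List (RoundData U H)) : 0 ≤ alg.lik q L :=
  pathProd_nonneg (alg.stepLik_nonneg hq) _ _

theorem Learner.lik_mono (alg : Learner U H) {q q' : Policy O A → (Fin H → O × A) → ℝ}
    (hq : ∀ π τ, 0 ≤ q π τ) (h : ∀ π τ, q π τ ≤ q' π τ) (L : List (RoundData U H)) :
    alg.lik q L ≤ alg.lik q' L :=
  pathProd_le (alg.stepLik_nonneg hq)
    (fun _ _ => Finset.prod_le_prod (fun _ _ => hq _ _) fun _ _ => h _ _) _ _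

theorem Learner.sum_stepLik_le (alg : Learner U H) {q : Policy O A → (Fin H → O × A) → ℝ}
    (hq : ∀ π τ, 0 ≤ q π τ) {B : ℝ} (hB : ∀ π, ∑ τ, q π τ ≤ B) (L : List (RoundData U H)) :
    ∑ x, alg.stepLik q L x ≤ B ^ Fintype.card (EpisodeIdx U H) := by
  have h1 : ∑ x, alg.stepLik q L x = ∏ i, ∑ τ, q (alg.execPolicy L i) τ :=
    (Fintype.prod_sum fun i τ => q (alg.execPolicy L i) τ).symm
  rw [h1, ← Finset.card_univ, ← Finset.prod_const]
  exact Finset.prod_le_prod (fun i _ => Finset.sum_nonneg fun _ _ => hq _ _) fun i _ => hB _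

theorem Learner.sum_stepLik_eq_one (alg : Learner U H) (D : Dynamics O A)
    (L : List (RoundData U H)) : ∑ x, alg.stepLik (fun π => D.prob π) L x = 1 := by
  have h1 : ∑ x, alg.stepLik (fun π => D.prob π) L x =
      ∏ i, ∑ τ : Fin H → O × A, D.prob (alg.execPolicy L i) τ :=
    (Fintype.prod_sum fun i (τ : Fin H → O × A) => D.prob (alg.execPolicy L i) τ).symm
  rw [h1]
  simp [D.sum_prob]

theorem Learner.runProb_eq_lik (alg : Learner U H) (D : Dynamics O A) {K : ℕ}
    (ω : Fin K → RoundData U H) :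
    alg.runProb D ω = alg.lik (fun π => D.prob π) (List.ofFn ω) := by
  rw [Learner.lik, ← prod_ofFn_eq_pathProd]; rfl

theorem sum_log_ofReal {ι : Type*} (s : Finset ι) {a : ι → ℝ} (ha : ∀ i, 0 ≤ a i) :
    ∑ i ∈ s, ENNReal.log (ENNReal.ofReal (a i)) =
      ENNReal.log (ENNReal.ofReal (∏ i ∈ s, a i)) := by
  classical
  induction s using Finset.induction_on with
  | empty => simp
  | insert i s hi ih =>
    rw [Finset.sum_insert hi, Finset.prod_insert hi, ih, ENNReal.ofReal_mul (ha i),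
      ENNReal.log_mul_add]

theorem Learner.logLik_eq (alg : Learner U H) (L : List (RoundData U H)) {f : Params U}
    (hf : ∀ π (τ : Fin H → O × A), 0 ≤ f.prob π τ) :
    alg.logLik L f = ENNReal.log (ENNReal.ofReal (alg.lik (fun π => f.prob π) L)) := by
  rw [Learner.logLik, Learner.lik, ← prod_get_eq_pathProd,
    ← sum_log_ofReal _ (fun j => alg.stepLik_nonneg hf _ _)]
  refine Finset.sum_congr rfl fun j _ => ?_
  rw [sum_log_ofReal _ (fun i => hf _ _)]
  rfl

/-- The density whose likelihood ratio to `p` is `√(g / p)`, compensated for its mean. -/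
noncomputable def affinityDensity (p g : Policy O A → (Fin H → O × A) → ℝ) (π : Policy O A)
    (τ : Fin H → O × A) : ℝ :=
  √(g π τ * p π τ) * Real.exp (1 - ∑ τ', √(g π τ' * p π τ'))

theorem sum_affinityDensity_le (p g : Policy O A → (Fin H → O × A) → ℝ) (π : Policy O A) :
    ∑ τ, affinityDensity p g π τ ≤ 1 := by
  unfold affinityDensity
  rw [← Finset.sum_mul]
  set Z := ∑ τ', √(g π τ' * p π τ')
  have h1 : Z ≤ Real.exp (Z - 1) := by linarith [Real.add_one_le_exp (Z - 1)]
  calc Z * Real.exp (1 - Z) ≤ Real.exp (Z - 1) * Real.exp (1 - Z) :=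
        mul_le_mul_of_nonneg_right h1 (Real.exp_pos _).le
    _ = 1 := by rw [← Real.exp_add]; simp

theorem Learner.lik_affinityDensity (alg : Learner U H)
    {p g : Policy O A → (Fin H → O × A) → ℝ} (hp : ∀ π τ, 0 ≤ p π τ) (hg : ∀ π τ, 0 ≤ g π τ)
    (L : List (RoundData U H)) :
    alg.lik (affinityDensity p g) L = √(alg.lik g L * alg.lik p L) *
      Real.exp (∑ j ∈ Finset.range L.length, ∑ i,
        (1 - ∑ τ, √(g (alg.execPolicy (L.take j) i) τ * p (alg.execPolicy (L.take j) i) τ))) := by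
  have h1 : alg.stepLik (affinityDensity p g) = fun L x =>
      √(alg.stepLik g L x * alg.stepLik p L x) * Real.exp (∑ i,
        (1 - ∑ τ, √(g (alg.execPolicy L i) τ * p (alg.execPolicy L i) τ))) := by
    funext L x
    simp only [Learner.stepLik, affinityDensity]
    have h2 : √((∏ i, g (alg.execPolicy L i) (x i)) * ∏ i, p (alg.execPolicy L i) (x i)) =
        ∏ i, √(g (alg.execPolicy L i) (x i) * p (alg.execPolicy L i) (x i)) := by
      rw [← Finset.prod_mul_distrib, Real.sqrt_prod _ fun i _ => mul_nonneg (hg _ _) (hp _ _)]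
    rw [h2, Real.exp_sum, ← Finset.prod_mul_distrib]
  have h2 : ∀ (L : List (RoundData U H)) (x : RoundData U H),
      0 ≤ alg.stepLik g L x * alg.stepLik p L x := fun L x =>
    mul_nonneg (alg.stepLik_nonneg hg _ _) (alg.stepLik_nonneg hp _ _)
  rw [Learner.lik, h1, pathProd_mul (fun L x => √(alg.stepLik g L x * alg.stepLik p L x))
    (fun L _ => Real.exp (∑ i,
        (1 - ∑ τ, √(g (alg.execPolicy L i) τ * p (alg.execPolicy L i) τ)))),
    pathProd_sqrt h2, pathProd_mul]
  congr 1
  rw [← prod_get_eq_pathProd, Real.exp_sum, Finset.prod_range]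
  simp

/-- The data `ω` after `k` iterations are typical for the density `g`: its likelihood ratio to the true
law is at most `T`, and the same holds for the compensated square root of the ratio. -/
def Learner.Typical (alg : Learner U H) (D : Dynamics O A) (T : ℝ)
    (g : Policy O A → (Fin H → O × A) → ℝ) (L : List (RoundData U H)) : Prop :=
  alg.lik g L ≤ T * alg.lik (fun π => D.prob π) L ∧
    alg.lik (affinityDensity (fun π => D.prob π) g) L ≤ T * alg.lik (fun π => D.prob π) L

open Classical in
/-- Data that are not typical after `k` iterations have probability at most `4 / T`: the upper bracket
has total mass at most `(1 + εb)^(number of episodes) ≤ e ≤ 3` over all data, and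
`affinityDensity` has mass at most `1`. -/
theorem Learner.lsum_not_typical_le (alg : Learner U H) (D : Dynamics O A) {T εb : ℝ} (hT : 0 < T)
    (hεb : 0 ≤ εb) {g : Policy O A → (Fin H → O × A) → ℝ} (hg : ∀ π τ, 0 ≤ g π τ)
    (hg1 : ∀ π, ∑ τ, g π τ ≤ 1 + εb) {k K : ℕ} (hk : k ≤ K)
    (hK : K * Fintype.card (EpisodeIdx U H) * εb ≤ 1) :
    lsum K (fun ω => if ¬ alg.Typical D T g (ω.take k)
      then alg.lik (fun π => D.prob π) ω else 0) ≤ 4 / T := by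
  have hp0 : ∀ π (τ : Fin H → O × A), 0 ≤ D.prob π τ := fun π τ => D.prob_nonneg π τ
  have hnn := alg.lik_nonneg hp0
  have h1 := lsum_markov (alg.sum_stepLik_eq_one D) (alg.stepLik_nonneg hg)
    (alg.sum_stepLik_le hg hg1) hT hk
  have haff : ∀ π τ, 0 ≤ affinityDensity (fun π => D.prob π) g π τ := fun π τ =>
    mul_nonneg (Real.sqrt_nonneg _) (Real.exp_pos _).le
  have h2 := lsum_markov (alg.sum_stepLik_eq_one D) (alg.stepLik_nonneg haff)
    (alg.sum_stepLik_le haff (sum_affinityDensity_le _ _)) hT hk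
  have h3 : ((1 + εb) ^ Fintype.card (EpisodeIdx U H)) ^ k ≤ 3 := by
    rw [← pow_mul]
    calc (1 + εb) ^ (Fintype.card (EpisodeIdx U H) * k)
        ≤ Real.exp εb ^ (Fintype.card (EpisodeIdx U H) * k) :=
          pow_le_pow_left₀ (by positivity) (by linarith [Real.add_one_le_exp εb]) _
      _ = Real.exp ((Fintype.card (EpisodeIdx U H) * k : ℕ) * εb) := by
          rw [← Real.exp_nat_mul]
      _ ≤ Real.exp 1 := by
          refine Real.exp_le_exp.2 (le_trans ?_ hK)
          rw [mul_comm (K : ℝ)]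
          push_cast
          gcongr
      _ ≤ 3 := Real.exp_one_lt_d9.le.trans (by norm_num)
  have h4 : lsum K (fun ω => if ¬ alg.Typical D T g (ω.take k)
      then alg.lik (fun π => D.prob π) ω else 0) ≤
      lsum K (fun ω => (if T * alg.lik (fun π => D.prob π) (ω.take k) < alg.lik g (ω.take k)
        then alg.lik (fun π => D.prob π) ω else 0) +
        (if T * alg.lik (fun π => D.prob π) (ω.take k) <
            alg.lik (affinityDensity (fun π => D.prob π) g) (ω.take k)
          then alg.lik (fun π => D.prob π) ω else 0)) := by
    refine lsum_le_lsum fun ω _ => ?_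
    have := hnn ω
    simp only [Learner.Typical, not_and_or, not_le]
    split_ifs <;> simp_all
  rw [lsum_add_fun] at h4
  refine h4.trans ((add_le_add h1 h2).trans ?_)
  rw [one_pow, one_pow, ← add_div]
  exact div_le_div_of_nonneg_right (by linarith) hT.le

/-- Hellinger distance to a density `f` that is close to the upper bracket `g`, in terms of the affinity
of `g` and `p`. -/
theorem hell_le_of_bracket {Ω : Type*} [Fintype Ω] {p f g : Ω → ℝ} {εb : ℝ} (hp : ∀ ω, 0 ≤ p ω)
    (hp1 : ∑ ω, p ω = 1) (hf : ∀ ω, 0 ≤ f ω) (hfg : ∀ ω, f ω ≤ g ω)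
    (hfg1 : ∑ ω, (g ω - f ω) ≤ εb) (hf1 : ∑ ω, f ω = 1) :
    hell p f ≤ 4 * (1 - ∑ ω, √(g ω * p ω)) + 4 * εb := by
  have hg : ∀ ω, 0 ≤ g ω := fun ω => (hf ω).trans (hfg ω)
  have h1 : hell p f ≤ ∑ ω, (2 * (p ω + g ω - 2 * √(g ω * p ω)) + 2 * (g ω - f ω)) := by
    refine Finset.sum_le_sum fun ω _ => ?_
    have h2 : (√(p ω) - √(g ω)) ^ 2 = p ω + g ω - 2 * √(g ω * p ω) := by
      rw [sub_sq, Real.sq_sqrt (hp ω), Real.sq_sqrt (hg ω), Real.sqrt_mul (hg ω)]; ring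
    have h3 : (√(g ω) - √(f ω)) ^ 2 ≤ g ω - f ω := by
      have h4 : √(f ω) ≤ √(g ω) := Real.sqrt_le_sqrt (hfg ω)
      have h5 := Real.sqrt_nonneg (f ω)
      nlinarith [Real.sq_sqrt (hg ω), Real.sq_sqrt (hf ω)]
    rw [← h2]
    nlinarith [sq_nonneg ((√(p ω) - √(g ω)) - (√(g ω) - √(f ω)))]
  have h2 : ∑ ω, g ω ≤ 1 + εb := by
    rw [Finset.sum_sub_distrib, hf1] at hfg1; linarith
  refine h1.trans ?_
  rw [Finset.sum_add_distrib, ← Finset.mul_sum, ← Finset.mul_sum, Finset.sum_sub_distrib,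
    Finset.sum_add_distrib, ← Finset.mul_sum, hp1]
  linarith

variable {F : Set (Params U)} {D : Dynamics O A}

/-- On typical data, the parameters of the true process are in the confidence set. -/
theorem Learner.mem_confSet (alg : Learner U H) {fs : Params U} (hfs : fs ∈ F)
    (hind : fs.Induces H D) (hF : ∀ f ∈ F, ∀ π (τ : Fin H → O × A), 0 ≤ f.prob π τ)
    {T β : ℝ} (hT : 0 < T) (hTβ : Real.log T ≤ β) {L : List (RoundData U H)}
    (h : ∀ f ∈ F, alg.lik (fun π => f.prob π) L ≤ T * alg.lik (fun π => D.prob π) L) :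
    fs ∈ alg.confSet F β L := by
  refine ⟨hfs, EReal.sub_le_of_le_add (iSup₂_le fun f hf => ?_)⟩
  have h1 : (fun π => fs.prob (H := H) π) = fun π => D.prob π := funext fun π => funext (hind π)
  rw [alg.logLik_eq L (hF f hf), alg.logLik_eq L (hF fs hfs), h1]
  refine (ENNReal.log_le_log (ENNReal.ofReal_le_ofReal (h f hf))).trans ?_
  rw [ENNReal.ofReal_mul hT.le, ENNReal.log_mul_add, ENNReal.log_ofReal_of_pos hT, add_comm]
  exact add_le_add_right (EReal.coe_le_coe_iff.2 hTβ) _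

/-- A model in the confidence set has a likelihood of at least `e^{-β}` times that of the truth. -/
theorem Learner.lik_le_of_mem_confSet (alg : Learner U H) {fs : Params U} (hfs : fs ∈ F)
    (hind : fs.Induces H D) (hF : ∀ f ∈ F, ∀ π (τ : Fin H → O × A), 0 ≤ f.prob π τ)
    {β : ℝ} {L : List (RoundData U H)} {f : Params U} (hf : f ∈ alg.confSet F β L)
    (hpos : 0 < alg.lik (fun π => D.prob π) L) :
    alg.lik (fun π => D.prob π) L ≤ Real.exp β * alg.lik (fun π => f.prob π) L := by
  obtain ⟨hfF, hle⟩ := hf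
  have h1 : (fun π => fs.prob (H := H) π) = fun π => D.prob π := funext fun π => funext (hind π)
  have h2 : alg.logLik L fs - (β : EReal) ≤ alg.logLik L f :=
    (EReal.sub_le_sub (le_iSup₂ (f := fun f' (_ : f' ∈ F) => alg.logLik L f') fs hfs) le_rfl).trans
      hle
  rw [alg.logLik_eq L (hF f hfF), alg.logLik_eq L (hF fs hfs), h1,
    ENNReal.log_ofReal_of_pos hpos, ENNReal.log_ofReal] at h2
  split_ifs at h2 with h3
  · rw [le_bot_iff, ← EReal.coe_sub] at h2
    exact absurd h2 (EReal.coe_ne_bot _)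
  · rw [← EReal.coe_sub, EReal.coe_le_coe_iff] at h2
    rw [not_le] at h3
    have h4 : Real.log (alg.lik (fun π => D.prob π) L) ≤
        Real.log (Real.exp β * alg.lik (fun π => f.prob π) L) := by
      rw [Real.log_mul (Real.exp_pos _).ne' h3.ne', Real.log_exp]; linarith
    exact (Real.log_le_log_iff hpos (by positivity)).1 h4

/-- On typical data, every model in the confidence set is close in Hellinger distance to the truth on the
episodes collected so far. -/
theorem Learner.sum_exploreHell_le (alg : Learner U H) {D' : Dynamics O A} {T β εb : ℝ}
    (hTβ : Real.log T ≤ β)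
    {f g : Policy O A → (Fin H → O × A) → ℝ} (hfD : ∀ π τ, f π τ = D'.prob π τ)
    (hfg : ∀ π τ, f π τ ≤ g π τ) (hfg1 : ∀ π, ∑ τ, (g π τ - f π τ) ≤ εb)
    {L : List (RoundData U H)} (htyp : alg.Typical D T g L)
    (hpos : 0 < alg.lik (fun π => D.prob π) L)
    (hlik : alg.lik (fun π => D.prob π) L ≤ Real.exp β * alg.lik f L)
    (hK : L.length * Fintype.card (EpisodeIdx U H) * εb ≤ 1) :
    ∑ j ∈ Finset.range L.length, exploreHell D D' U H (alg (L.take j)).2 ≤ 6 * β + 4 := by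
  set p : Policy O A → (Fin H → O × A) → ℝ := fun π => D.prob π with hp
  have hp0 : ∀ π τ, 0 ≤ p π τ := fun π τ => D.prob_nonneg π τ
  have hf0 : ∀ π τ, 0 ≤ f π τ := fun π τ => by rw [hfD]; exact D'.prob_nonneg π τ
  have hg0 : ∀ π τ, 0 ≤ g π τ := fun π τ => (hf0 π τ).trans (hfg π τ)
  have h1 := htyp.2
  rw [alg.lik_affinityDensity hp0 hg0] at h1
  set s := ∑ j ∈ Finset.range L.length, ∑ i,
    (1 - ∑ τ, √(g (alg.execPolicy (L.take j) i) τ * p (alg.execPolicy (L.take j) i) τ)) with hs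
  set a := alg.lik p L with ha
  have hga : a ≤ Real.exp β * alg.lik g L :=
    hlik.trans (mul_le_mul_of_nonneg_left (alg.lik_mono hf0 hfg L) (Real.exp_pos _).le)
  -- the likelihood ratio of `g` is at least `e^{-β}`
  have h2 : Real.exp (-(β / 2)) * a ≤ √(alg.lik g L * a) := by
    refine Real.le_sqrt_of_sq_le ?_
    have h3 : Real.exp (-(β / 2)) ^ 2 * Real.exp β = 1 := by
      rw [← Real.exp_nat_mul, ← Real.exp_add]
      convert Real.exp_zero using 2
      push_cast; ring
    calc (Real.exp (-(β / 2)) * a) ^ 2 = Real.exp (-(β / 2)) ^ 2 * a * a := by ring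
      _ ≤ Real.exp (-(β / 2)) ^ 2 * (Real.exp β * alg.lik g L) * a := by gcongr
      _ = (Real.exp (-(β / 2)) ^ 2 * Real.exp β) * (alg.lik g L * a) := by ring
      _ = alg.lik g L * a := by rw [h3, one_mul]
  have h3 : Real.exp (s - β / 2) ≤ T := by
    have h4 : Real.exp (-(β / 2)) * a * Real.exp s ≤ T * a :=
      (mul_le_mul_of_nonneg_right h2 (Real.exp_pos _).le).trans h1
    have h5 : Real.exp (s - β / 2) * a ≤ T * a := by
      refine le_trans (le_of_eq ?_) h4
      rw [sub_eq_add_neg, Real.exp_add]; ring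
    exact le_of_mul_le_mul_right h5 hpos
  have h4 : s ≤ 3 / 2 * β := by
    have := Real.log_le_log (Real.exp_pos _) h3
    rw [Real.log_exp] at this
    linarith
  have h5 : ∀ j, exploreHell D D' U H (alg (L.take j)).2 ≤ 4 * (∑ i,
      (1 - ∑ τ, √(g (alg.execPolicy (L.take j) i) τ * p (alg.execPolicy (L.take j) i) τ))) +
      Fintype.card (EpisodeIdx U H) * (4 * εb) := by
    intro j
    rw [exploreHell, Finset.mul_sum]
    have h6 : ∀ i : EpisodeIdx U H, hell (D.prob (h := H) (alg.execPolicy (L.take j) i))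
        (D'.prob (alg.execPolicy (L.take j) i)) ≤ 4 * (1 - ∑ τ,
          √(g (alg.execPolicy (L.take j) i) τ * p (alg.execPolicy (L.take j) i) τ)) + 4 * εb :=
      fun i => hell_le_of_bracket (D.prob_nonneg _) (D.sum_prob _ _) (D'.prob_nonneg _)
        (fun τ => by rw [← hfD]; exact hfg _ _)
        (by simpa only [hfD] using hfg1 (alg.execPolicy (L.take j) i)) (D'.sum_prob _ _)
    refine (Finset.sum_le_sum fun i _ => h6 i).trans (le_of_eq ?_)
    rw [Finset.sum_add_distrib, Finset.sum_const, nsmul_eq_mul, Finset.card_univ]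
  refine (Finset.sum_le_sum fun j _ => h5 j).trans ?_
  rw [Finset.sum_add_distrib, ← Finset.mul_sum, Finset.sum_const, Finset.card_range, nsmul_eq_mul]
  linarith

end Likelihood

/-! ### The bracket number of tabular models -/

section Bracket

variable {O A : Type*} [Fintype O] [Fintype A] [DecidableEq O] [DecidableEq A] [Nonempty A]
variable {U : ℕ → Finset (Test O A)} {H : ℕ}

theorem card_le_maxTests {h : ℕ} (h1 : 1 ≤ h) (hH : h ≤ H) : (U h).card ≤ maxTests U H :=
  Finset.le_sup (f := fun h => (U h).card) (Finset.mem_Icc.2 ⟨h1, hH⟩)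

theorem card_le_maxActionSeqs {h : ℕ} (h1 : 1 ≤ h) (hH : h ≤ H) :
    (actionSeqs U h).card ≤ maxActionSeqs U H :=
  Finset.le_sup (f := fun h => (actionSeqs U h).card) (Finset.mem_Icc.2 ⟨h1, hH⟩)

/-- All entries of `f` and `f'` that are used in episodes of length `H` differ by at most `η`. -/
def Params.Close (f f' : Params U) (H : ℕ) (η : ℝ) : Prop :=
  (∀ u, |f.q₀ u - f'.q₀ u| ≤ η) ∧
    ∀ h, 1 ≤ h → h < H → ∀ o a u v, |f.M h o a u v - f'.M h o a u v| ≤ η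

/-- With entries bounded by `1`, each step multiplies the size of the state by at most `|𝒰|`. -/
theorem Params.abs_b_le {f : Params U} (hf : f.Bounded H) {h : ℕ} (hh : h < H)
    (τ : Fin h → O × A) (u : U (h + 1)) : |f.b h τ u| ≤ (maxTests U H : ℝ) ^ h := by
  induction h with
  | zero => simpa [Params.b] using hf.1 u
  | succ h ih =>
    rw [Params.b, Matrix.mulVec, dotProduct]
    calc |∑ v, f.M (h + 1) (τ (Fin.last h)).1 (τ (Fin.last h)).2 u v *
          f.b h (fun i => τ i.castSucc) v|
        ≤ ∑ v : U (h + 1), 1 * (maxTests U H : ℝ) ^ h := by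
          refine (Finset.abs_sum_le_sum_abs _ _).trans (Finset.sum_le_sum fun v _ => ?_)
          rw [abs_mul]
          exact mul_le_mul (hf.2 (h + 1) (by omega) hh _ _ u v) (ih (by omega) _ v) (abs_nonneg _)
            zero_le_one
      _ = ((U (h + 1)).card : ℝ) * (maxTests U H : ℝ) ^ h := by simp
      _ ≤ (maxTests U H : ℝ) * (maxTests U H : ℝ) ^ h := by
          gcongr
          exact card_le_maxTests (by omega) hh.le
      _ = _ := by ring

theorem Params.Close.abs_b_sub_le {f f' : Params U} {η : ℝ} (hη : 0 ≤ η) (hc : f.Close f' H η)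
    (hf : f.Bounded H) (hf' : f'.Bounded H) {h : ℕ} (hh : h < H)
    (τ : Fin h → O × A) (u : U (h + 1)) :
    |f.b h τ u - f'.b h τ u| ≤ (h + 1) * (maxTests U H : ℝ) ^ h * η := by
  induction h with
  | zero => simpa [Params.b] using hc.1 u
  | succ h ih =>
    simp only [Params.b, Matrix.mulVec, dotProduct]
    set M := f.M (h + 1) (τ (Fin.last h)).1 (τ (Fin.last h)).2
    set M' := f'.M (h + 1) (τ (Fin.last h)).1 (τ (Fin.last h)).2
    set b := f.b h (fun i => τ i.castSucc)
    set b' := f'.b h (fun i => τ i.castSucc)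
    rw [← Finset.sum_sub_distrib]
    calc |∑ v, (M u v * b v - M' u v * b' v)|
        ≤ ∑ v : U (h + 1), (η * (maxTests U H : ℝ) ^ h +
            1 * ((h + 1) * (maxTests U H : ℝ) ^ h * η)) := by
          refine (Finset.abs_sum_le_sum_abs _ _).trans (Finset.sum_le_sum fun v _ => ?_)
          rw [show M u v * b v - M' u v * b' v = (M u v - M' u v) * b v + M' u v * (b v - b' v) by
            ring]
          refine (abs_add_le _ _).trans (add_le_add ?_ ?_)
          · rw [abs_mul]
            exact mul_le_mul (hc.2 (h + 1) (by omega) hh _ _ u v)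
              (Params.abs_b_le hf (by omega) _ v) (abs_nonneg _) hη
          · rw [abs_mul]
            exact mul_le_mul (hf'.2 (h + 1) (by omega) hh _ _ u v) (ih (by omega) _ v)
              (abs_nonneg _) zero_le_one
      _ = ((U (h + 1)).card : ℝ) * ((h + 1 + 1) * (maxTests U H : ℝ) ^ h * η) := by
          simp; ring
      _ ≤ (maxTests U H : ℝ) * ((h + 1 + 1) * (maxTests U H : ℝ) ^ h * η) := by
          gcongr
          exact card_le_maxTests (by omega) hh.le
      _ = _ := by push_cast; ring

theorem Params.Close.abs_obsWeight_sub_le {f f' : Params U} {η : ℝ} (hη : 0 ≤ η)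
    (hc : f.Close f' H η) (hf : f.Bounded H) (hf' : f'.Bounded H) (hH : 1 ≤ H)
    (τ : Fin H → O × A) :
    |f.obsWeight H τ - f'.obsWeight H τ| ≤ H * (maxTests U H : ℝ) ^ H * η := by
  obtain ⟨h, rfl⟩ : ∃ h, H = h + 1 := ⟨H - 1, by omega⟩
  simp only [Params.obsWeight]
  rw [← Finset.sum_sub_distrib]
  calc |∑ u : U (h + 1), ((if u.1 = (some (τ (Fin.last h)).1, []) then 1 else 0) *
          f.b h (fun i => τ i.castSucc) u -
        (if u.1 = (some (τ (Fin.last h)).1, []) then 1 else 0) *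
          f'.b h (fun i => τ i.castSucc) u)|
      ≤ ∑ u : U (h + 1), (h + 1) * (maxTests U (h + 1) : ℝ) ^ h * η := by
        refine (Finset.abs_sum_le_sum_abs _ _).trans (Finset.sum_le_sum fun u _ => ?_)
        have := Params.Close.abs_b_sub_le hη hc hf hf' (Nat.lt_succ_self h)
          (fun i => τ i.castSucc) u
        rw [← mul_sub, abs_mul]
        refine le_trans (mul_le_of_le_one_left (abs_nonneg _) ?_) this
        split_ifs <;> simp
    _ = ((U (h + 1)).card : ℝ) * ((h + 1) * (maxTests U (h + 1) : ℝ) ^ h * η) := by simp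
    _ ≤ (maxTests U (h + 1) : ℝ) * ((h + 1) * (maxTests U (h + 1) : ℝ) ^ h * η) := by
        gcongr
        exact card_le_maxTests (by omega) le_rfl
    _ = _ := by push_cast; ring

/-- The indices of the entries of the parameters that are used in episodes of length `H`. -/
abbrev EntryIdx (U : ℕ → Finset (Test O A)) (H : ℕ) :=
  U 1 ⊕ Σ h : Fin (H - 1), (O × A) × (U (h + 2) × U (h + 1))

/-- The points `-1, -1 + 1/m, …, 1`. -/
noncomputable def gridPoint (m : ℕ) (j : Fin (2 * m + 1)) : ℝ := j / m - 1

theorem abs_gridPoint_le {m : ℕ} (hm : 0 < m) (j : Fin (2 * m + 1)) : |gridPoint m j| ≤ 1 := by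
  have h1 : (0 : ℝ) < m := by exact_mod_cast hm
  have h2 : (j : ℝ) ≤ 2 * m := by exact_mod_cast Nat.lt_succ_iff.1 j.2
  have h3 : (j : ℝ) / m ≤ 2 := by rw [div_le_iff₀ h1]; exact h2
  have h4 : (0 : ℝ) ≤ (j : ℝ) / m := by positivity
  rw [gridPoint, abs_le]
  constructor <;> linarith

theorem exists_gridPoint {m : ℕ} (hm : 0 < m) {x : ℝ} (hx : |x| ≤ 1) :
    ∃ j, |x - gridPoint m j| ≤ 1 / m := by
  have h1 : (0 : ℝ) < m := by exact_mod_cast hm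
  obtain ⟨hx1, hx2⟩ := abs_le.1 hx
  have h0 : 0 ≤ (x + 1) * m := mul_nonneg (by linarith) h1.le
  have h2 : ⌊(x + 1) * m⌋₊ < 2 * m + 1 := by
    rw [Nat.lt_succ_iff]
    refine Nat.floor_le_of_le ?_
    push_cast
    nlinarith
  refine ⟨⟨_, h2⟩, ?_⟩
  have h3 := Nat.floor_le h0
  have h4 := Nat.lt_floor_add_one ((x + 1) * m)
  have h5 : x - gridPoint m ⟨_, h2⟩ = ((x + 1) * m - ⌊(x + 1) * m⌋₊) / m := by
    rw [gridPoint]; field_simp; ring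
  rw [h5, abs_div, abs_of_pos h1]
  refine div_le_div_of_nonneg_right ?_ h1.le
  rw [abs_le]
  constructor <;> linarith

/-- The parameters with entries at given grid points. -/
noncomputable def gridParams {m : ℕ} (j : EntryIdx U H → Fin (2 * m + 1)) : Params U where
  q₀ u := gridPoint m (j (Sum.inl u))
  M h := match h with
    | 0 => 0
    | h + 1 => fun o a u v =>
      if hh : h < H - 1 then gridPoint m (j (Sum.inr ⟨⟨h, hh⟩, (o, a), (u, v)⟩)) else 0

theorem gridParams_bounded {m : ℕ} (hm : 0 < m) (j : EntryIdx U H → Fin (2 * m + 1)) :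
    (gridParams j).Bounded H := by
  refine ⟨fun u => abs_gridPoint_le hm _, fun h h1 hH o a u v => ?_⟩
  obtain ⟨h, rfl⟩ : ∃ h', h = h' + 1 := ⟨h - 1, by omega⟩
  have hh : h < H - 1 := by omega
  simp only [gridParams, hh, dif_pos]
  exact abs_gridPoint_le hm _

theorem Params.Bounded.exists_gridParams {f : Params U} (hf : f.Bounded H) {m : ℕ} (hm : 0 < m) :
    ∃ j : EntryIdx U H → Fin (2 * m + 1), f.Close (gridParams j) H (1 / m) := by
  have h1 : ∀ i : EntryIdx U H, ∃ j : Fin (2 * m + 1),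
      |(Sum.elim f.q₀ (fun p => f.M (p.1 + 1) p.2.1.1 p.2.1.2 p.2.2.1 p.2.2.2) i : ℝ) -
        gridPoint m j| ≤ 1 / m := by
    rintro (u | ⟨h, ⟨o, a⟩, ⟨u, v⟩⟩)
    · exact exists_gridPoint hm (hf.1 u)
    · exact exists_gridPoint hm (hf.2 (h + 1) (by omega) (by have := h.2; omega) o a u v)
  choose j hj using h1
  refine ⟨j, fun u => hj (Sum.inl u), fun h h1 hH o a u v => ?_⟩
  obtain ⟨h, rfl⟩ : ∃ h', h = h' + 1 := ⟨h - 1, by omega⟩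
  have hh : h < H - 1 := by omega
  simp only [gridParams, hh, dif_pos]
  exact hj (Sum.inr ⟨⟨h, hh⟩, (o, a), (u, v)⟩)

theorem Policy.sum_weight_le (π : Policy O A) (H : ℕ) :
    ∑ τ : Fin H → O × A, π.weight τ ≤ (Fintype.card O : ℝ) ^ H := by
  simp only [π.weight_eq_wt]
  refine lsum_pathProd_le (fun _ _ => π.nonneg _ _ _) (fun τ => le_of_eq ?_) H []
  rw [Fintype.sum_prod_type]
  simp [π.sum_one]

/-- Rounding the entries to a grid of mesh `1 / m` gives a bracket. -/
theorem hasBracket_grid {F : Set (Params U)} (hF : ∀ f ∈ F, f.Bounded H) (hH : 1 ≤ H) {m : ℕ}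
    (hm : 0 < m) {ε : ℝ}
    (hε : 2 * (H * (maxTests U H : ℝ) ^ H * (1 / m)) * (Fintype.card O : ℝ) ^ H ≤ ε) :
    HasBracket F H ε ((2 * m + 1) ^ Fintype.card (EntryIdx U H)) := by
  classical
  set w : ℝ := H * (maxTests U H : ℝ) ^ H * (1 / m) with hw
  have hw0 : 0 ≤ w := by positivity
  have hcard : Fintype.card (EntryIdx U H → Fin (2 * m + 1)) =
      (2 * m + 1) ^ Fintype.card (EntryIdx U H) := by
    rw [Fintype.card_fun, Fintype.card_fin]
  have e : Fin ((2 * m + 1) ^ Fintype.card (EntryIdx U H)) ≃ (EntryIdx U H → Fin (2 * m + 1)) :=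
    (Fintype.equivFinOfCardEq hcard).symm
  have hwt : ∀ (π : Policy O A) (τ : Fin H → O × A), 0 ≤ π.weight τ := fun π τ => by
    rw [π.weight_eq_wt]; exact π.wt_nonneg _ _
  refine ⟨fun i π τ => ((gridParams (e i)).obsWeight H τ - w) * π.weight τ,
    fun i π τ => ((gridParams (e i)).obsWeight H τ + w) * π.weight τ, fun i π => ?_, fun f hf => ?_⟩
  · have h1 : ∀ τ : Fin H → O × A, |((gridParams (e i)).obsWeight H τ - w) * π.weight τ -
        ((gridParams (e i)).obsWeight H τ + w) * π.weight τ| = 2 * w * π.weight τ := by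
      intro τ
      rw [← sub_mul, abs_mul, abs_of_nonneg (hwt π τ),
        show (gridParams (e i)).obsWeight H τ - w - ((gridParams (e i)).obsWeight H τ + w) =
          -(2 * w) by ring, abs_neg, abs_of_nonneg (by positivity)]
    simp only [h1]
    rw [← Finset.mul_sum]
    exact (mul_le_mul_of_nonneg_left (π.sum_weight_le H) (by positivity)).trans hε
  · obtain ⟨j, hj⟩ := (hF f hf).exists_gridParams hm
    refine ⟨e.symm j, fun π τ => ?_⟩
    have h1 := abs_le.1 (hj.abs_obsWeight_sub_le (by positivity) (hF f hf) (gridParams_bounded hm j)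
      hH τ)
    simp only [Equiv.apply_symm_apply, Params.prob]
    constructor <;> refine mul_le_mul_of_nonneg_right ?_ (hwt π τ) <;> linarith

theorem card_entryIdx_le [Nonempty O] (hH : 1 ≤ H) :
    Fintype.card (EntryIdx U H) ≤ H * Fintype.card O * Fintype.card A * maxTests U H ^ 2 := by
  have h1 : (U 1).card ≤ maxTests U H := card_le_maxTests le_rfl hH
  have hO : 1 ≤ Fintype.card O := Fintype.card_pos
  have hA : 1 ≤ Fintype.card A := Fintype.card_pos
  have h2 : ∀ h : Fin (H - 1), Fintype.card ((O × A) × (U (h + 2) × U (h + 1))) ≤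
      Fintype.card O * Fintype.card A * maxTests U H ^ 2 := by
    intro h
    have := h.2
    rw [Fintype.card_prod, Fintype.card_prod, Fintype.card_prod, Fintype.card_coe,
      Fintype.card_coe, sq]
    exact Nat.mul_le_mul le_rfl (Nat.mul_le_mul (card_le_maxTests (by omega) (by omega))
      (card_le_maxTests (by omega) (by omega)))
  rw [Fintype.card_sum, Fintype.card_sigma, Fintype.card_coe]
  have h3 : ∑ h : Fin (H - 1), Fintype.card ((O × A) × (U (h + 2) × U (h + 1))) ≤
      (H - 1) * (Fintype.card O * Fintype.card A * maxTests U H ^ 2) := by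
    refine (Finset.sum_le_sum fun h _ => h2 h).trans (le_of_eq ?_)
    simp
  have h4 : maxTests U H ≤ Fintype.card O * Fintype.card A * maxTests U H ^ 2 := by
    calc maxTests U H ≤ maxTests U H ^ 2 := Nat.le_self_pow (by norm_num) _
      _ = 1 * maxTests U H ^ 2 := (one_mul _).symm
      _ ≤ _ := Nat.mul_le_mul (Nat.mul_pos hO hA) le_rfl
  obtain ⟨k, rfl⟩ : ∃ k, H = k + 1 := ⟨H - 1, by omega⟩
  simp only [Nat.add_sub_cancel] at h3 ⊢
  calc (U 1).card + _ ≤ maxTests U (k + 1) + k * (Fintype.card O * Fintype.card A *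
        maxTests U (k + 1) ^ 2) := Nat.add_le_add h1 h3
    _ ≤ Fintype.card O * Fintype.card A * maxTests U (k + 1) ^ 2 + k * (Fintype.card O *
        Fintype.card A * maxTests U (k + 1) ^ 2) := Nat.add_le_add_right h4 _
    _ = _ := by ring

/-- If there is a finite bracket, then the bracket number is attained. -/
theorem exists_bracketNumber_eq {F : Set (Params U)} {ε : ℝ} {N : ℕ} (h : HasBracket F H ε N) :
    ∃ n : ℕ, n ≤ N ∧ bracketNumber F H ε = n ∧ HasBracket F H ε n := by
  have hne : {N : ℕ | HasBracket F H ε N}.Nonempty := ⟨N, h⟩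
  refine ⟨sInf {N : ℕ | HasBracket F H ε N}, Nat.sInf_le h, ?_, Nat.sInf_mem hne⟩
  refine le_antisymm (iInf₂_le _ (Nat.sInf_mem hne)) (le_iInf₂ fun n hn => ?_)
  exact_mod_cast Nat.sInf_le hn

theorem HasBracket.pos {F : Set (Params U)} (hF : F.Nonempty) {ε : ℝ} {N : ℕ}
    (h : HasBracket F H ε N) : 0 < N := by
  obtain ⟨f, hf⟩ := hF
  obtain ⟨_, _, _, h2⟩ := h
  obtain ⟨i, _⟩ := h2 f hf
  exact i.pos

/-- Basic size estimates for a regular process with core tests. -/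
theorem size_facts {D : Dynamics O A} {α : ℝ} (hH : 1 ≤ H) (hα : 0 < α) (hc : D.IsCore H U)
    (hr : D.Regular H U α) :
    Nonempty O ∧ 1 ≤ maxTests U H ∧ 1 ≤ maxActionSeqs U H ∧ α ≤ maxActionSeqs U H := by
  obtain ⟨R, -⟩ := exists_coreRep hc hr (l := 0) hH
  have h1 : α ≤ ((actionSeqs U 1).card : ℝ) := R.alpha_le hα hH
  have h2 : (0 : ℝ) < ((actionSeqs U 1).card : ℝ) := hα.trans_le h1
  have h3 : 1 ≤ (actionSeqs U 1).card := by exact_mod_cast h2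
  have h4 : (actionSeqs U 1).card ≤ maxActionSeqs U H := card_le_maxActionSeqs le_rfl hH
  refine ⟨?_, ?_, h3.trans h4, h1.trans (by exact_mod_cast h4)⟩
  · by_contra hO
    rw [not_nonempty_iff] at hO
    have := D.sum_one []
    simp at this
  · exact (h3.trans Finset.card_image_le).trans (card_le_maxTests le_rfl hH)

/-- The argument of the logarithm in `tabularRate` is at least `H |𝒪| |𝒜| |𝒰| / ε`. -/
theorem le_tabular_arg {D : Dynamics O A} {α ε : ℝ} (hH : 1 ≤ H) (hα : 0 < α)
    (hc : D.IsCore H U) (hr : D.Regular H U α) (hε : 0 < ε) :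
    (H * Fintype.card O * Fintype.card A * maxTests U H : ℝ) / ε ≤
      H * Fintype.card O * Fintype.card A * maxActionSeqs U H * maxTests U H / (α * ε) := by
  obtain ⟨_, _, _, h⟩ := size_facts hH hα hc hr
  rw [div_le_div_iff₀ hε (by positivity)]
  have h0 : (0 : ℝ) ≤ H * Fintype.card O * Fintype.card A * maxTests U H * ε := by positivity
  nlinarith [mul_le_mul_of_nonneg_left h h0]

/-- The bound for the bracket number, from the bracket given by rounding the entries to a grid. -/
theorem exists_bracketNumber_le {D : Dynamics O A} {α : ℝ} {F : Set (Params U)} (hH : 1 ≤ H)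
    (hα : 0 < α) (hc : D.IsCore H U) (hr : D.Regular H U α) (hW : WellSpecified F H D α)
    (hF : ∀ f ∈ F, f.Bounded H) {ε : ℝ} (hε : 0 < ε) (hε1 : ε ≤ 1) :
    ∃ n : ℕ, bracketNumber F H ε = n ∧ HasBracket F H ε n ∧ 0 < n ∧
      Real.log n ≤ 6 * tabularRate U H α ε := by
  obtain ⟨hO, hu1, _, hαU⟩ := size_facts hH hα hc hr
  have hFne : F.Nonempty := by obtain ⟨⟨f, hf, _⟩, _⟩ := hW; exact ⟨f, hf⟩
  have hO1 : 1 ≤ Fintype.card O := Fintype.card_pos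
  have hA1 : 1 ≤ Fintype.card A := Fintype.card_pos
  set X : ℝ := H * Fintype.card O * Fintype.card A * maxActionSeqs U H * maxTests U H / (α * ε)
    with hX
  have hXge := le_tabular_arg hH hα hc hr hε
  rw [← hX] at hXge
  set u := maxTests U H with hu
  have hP : ((H * Fintype.card O * Fintype.card A * u : ℕ) : ℝ) ≤
      (H * Fintype.card O * Fintype.card A * u : ℝ) / ε := by
    push_cast
    rw [le_div_iff₀ hε]
    exact mul_le_of_le_one_right (by positivity) hε1
  have hrate : tabularRate U H α ε =
      (u : ℝ) ^ 2 * Fintype.card O * Fintype.card A * (H : ℝ) ^ 2 * Real.log X := rfl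
  rcases Nat.lt_or_ge (H * Fintype.card O * Fintype.card A * u) 2 with hlt | hge
  · -- there is only one trajectory, so the models agree
    have hone : H * Fintype.card O * Fintype.card A * u = 1 := by
      have : 0 < H * Fintype.card O * Fintype.card A * u := by positivity
      omega
    have hA : Fintype.card A = 1 := Nat.eq_one_of_mul_eq_one_left
      (Nat.eq_one_of_mul_eq_one_right hone)
    have hO' : Fintype.card O = 1 := Nat.eq_one_of_mul_eq_one_left
      (Nat.eq_one_of_mul_eq_one_right (Nat.eq_one_of_mul_eq_one_right hone))
    have hX1 : 1 ≤ X := by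
      refine le_trans ?_ (hP.trans hXge)
      rw [hone]; simp
    have hb : HasBracket F H ε 1 := by
      refine ⟨fun _ _ _ => 1, fun _ _ _ => 1, fun _ _ => by simp [hε.le], fun f hf => ⟨0, ?_⟩⟩
      intro π τ
      obtain ⟨D', hD', _⟩ := hW.2 f hf
      have hsub : Subsingleton (O × A) := by
        rw [← Fintype.card_le_one_iff_subsingleton, Fintype.card_prod, hA, hO']
      have h1 : f.prob π τ = 1 := by
        rw [hD', ← D'.sum_prob π H]
        exact (Fintype.sum_subsingleton _ τ).symm
      rw [h1]
      exact ⟨le_rfl, le_rfl⟩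
    obtain ⟨n, hn1, hn, hbn⟩ := exists_bracketNumber_eq hb
    refine ⟨n, hn, hbn, hbn.pos hFne, ?_⟩
    have hn' : n = 1 := le_antisymm hn1 (hbn.pos hFne)
    rw [hn', hrate, Nat.cast_one, Real.log_one]
    have := Real.log_nonneg hX1
    positivity
  · have hX2 : 2 ≤ X := by
      refine le_trans ?_ (hP.trans hXge)
      exact_mod_cast hge
    have hH' : (1 : ℝ) ≤ H := by exact_mod_cast hH
    have hOr : (1 : ℝ) ≤ Fintype.card O := by exact_mod_cast hO1
    have hAr : (1 : ℝ) ≤ Fintype.card A := by exact_mod_cast hA1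
    have hur : (1 : ℝ) ≤ u := by exact_mod_cast hu1
    set Y : ℝ := H * (u * Fintype.card O) ^ H / ε with hY
    have hprod1 : (1 : ℝ) ≤ u * Fintype.card O := one_le_mul_of_one_le_of_one_le hur hOr
    have hY1 : 1 ≤ Y := by
      rw [hY, le_div_iff₀ hε, one_mul]
      exact hε1.trans (one_le_mul_of_one_le_of_one_le hH' (one_le_pow₀ hprod1))
    set m := ⌈2 * Y⌉₊ with hm
    have hm0 : 0 < m := Nat.ceil_pos.2 (by linarith)
    have hmr : (0 : ℝ) < m := by exact_mod_cast hm0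
    have hmge : 2 * Y ≤ m := Nat.le_ceil _
    have hmle : (m : ℝ) ≤ 2 * Y + 1 := (Nat.ceil_lt_add_one (by linarith)).le
    have hb := hasBracket_grid hF hH hm0 (ε := ε) (by
      rw [← hu]
      have h1 : 2 * (H * (u : ℝ) ^ H * (1 / m)) * (Fintype.card O : ℝ) ^ H =
          2 * Y * ε / m := by
        rw [hY, mul_pow]; field_simp
      rw [h1, div_le_iff₀ hmr]
      nlinarith)
    obtain ⟨n, hn1, hn, hbn⟩ := exists_bracketNumber_eq hb
    have hn0 := hbn.pos hFne
    refine ⟨n, hn, hbn, hn0, ?_⟩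
    have hYX : Y ≤ X ^ (H + 1) := by
      have h1 : (H : ℝ) / ε ≤ X := by
        refine le_trans (div_le_div_of_nonneg_right ?_ hε.le) hXge
        calc (H : ℝ) = H * 1 * 1 * 1 := by ring
          _ ≤ _ := by gcongr
      have h2 : (u : ℝ) * Fintype.card O ≤ X := by
        refine le_trans ?_ (hP.trans hXge)
        push_cast
        calc (u : ℝ) * Fintype.card O = 1 * Fintype.card O * 1 * u := by ring
          _ ≤ _ := by gcongr
      calc Y = H / ε * (u * Fintype.card O) ^ H := by rw [hY]; ring
        _ ≤ X * X ^ H := by gcongr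
        _ = X ^ (H + 1) := by ring
    have hmX : ((2 * m + 1 : ℕ) : ℝ) ≤ X ^ (6 * H) := by
      have h9 : (9 : ℝ) ≤ X ^ 4 := by
        calc (9 : ℝ) ≤ 2 ^ 4 := by norm_num
          _ ≤ X ^ 4 := pow_le_pow_left₀ (by norm_num) hX2 4
      push_cast
      calc 2 * (m : ℝ) + 1 ≤ 9 * Y := by linarith
        _ ≤ X ^ 4 * X ^ (H + 1) := by gcongr
        _ = X ^ (4 + (H + 1)) := by rw [← pow_add]
        _ ≤ X ^ (6 * H) := pow_le_pow_right₀ (by linarith) (by omega)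
    have hlogX : 0 ≤ Real.log X := Real.log_nonneg (by linarith)
    have h1 : Real.log n ≤ Fintype.card (EntryIdx U H) * (((6 * H : ℕ) : ℝ) * Real.log X) := by
      calc Real.log n ≤ Real.log (((2 * m + 1) ^ Fintype.card (EntryIdx U H) : ℕ) : ℝ) :=
            Real.log_le_log (by exact_mod_cast hn0) (by exact_mod_cast hn1)
        _ = Fintype.card (EntryIdx U H) * Real.log ((2 * m + 1 : ℕ) : ℝ) := by
            rw [Nat.cast_pow, Real.log_pow]
        _ ≤ _ := by
            refine mul_le_mul_of_nonneg_left ?_ (by positivity)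
            rw [← Real.log_pow]
            exact Real.log_le_log (by positivity) hmX
    refine h1.trans ?_
    have h2 : (Fintype.card (EntryIdx U H) : ℝ) ≤
        H * Fintype.card O * Fintype.card A * (u : ℝ) ^ 2 := by
      exact_mod_cast card_entryIdx_le (U := U) hH
    calc Fintype.card (EntryIdx U H) * (((6 * H : ℕ) : ℝ) * Real.log X)
        ≤ H * Fintype.card O * Fintype.card A * (u : ℝ) ^ 2 *
            (((6 * H : ℕ) : ℝ) * Real.log X) :=
          mul_le_mul_of_nonneg_right h2 (by positivity)
      _ = 6 * tabularRate U H α ε := by rw [hrate]; push_cast; ring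

end Bracket

/-! ### Values -/

section Value

variable {O A : Type*} [Fintype O] [Fintype A] [DecidableEq O] [DecidableEq A] [Nonempty A]
variable {U : ℕ → Finset (Test O A)} {H : ℕ}

theorem cumReward_mem {r : List (O × A) → ℝ} (hr : ∀ τ, 0 ≤ r τ ∧ r τ ≤ 1) (τ : Fin H → O × A) :
    0 ≤ cumReward r τ ∧ cumReward r τ ≤ H := by
  refine ⟨Finset.sum_nonneg fun _ _ => (hr _).1, ?_⟩
  refine (Finset.sum_le_sum fun _ _ => (hr _).2).trans (le_of_eq ?_)
  simp

theorem value_sub_le {r : List (O × A) → ℝ} (hr : ∀ τ, 0 ≤ r τ ∧ r τ ≤ 1)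
    (p q : (Fin H → O × A) → ℝ) : value r p - value r q ≤ H * ∑ τ, |p τ - q τ| := by
  rw [value, value, ← Finset.sum_sub_distrib, Finset.mul_sum]
  refine Finset.sum_le_sum fun τ _ => ?_
  rw [← sub_mul, mul_comm]
  obtain ⟨h0, h1⟩ := cumReward_mem hr τ
  exact (mul_le_mul_of_nonneg_left (le_abs_self _) h0).trans
    (mul_le_mul_of_nonneg_right h1 (abs_nonneg _))

theorem value_prob_mem {r : List (O × A) → ℝ} (hr : ∀ τ, 0 ≤ r τ ∧ r τ ≤ 1) (D : Dynamics O A)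
    (π : Policy O A) : 0 ≤ value r (D.prob (h := H) π) ∧ value r (D.prob (h := H) π) ≤ H := by
  constructor
  · exact Finset.sum_nonneg fun τ _ => mul_nonneg (D.prob_nonneg _ _) (cumReward_mem hr τ).1
  · calc value r (D.prob (h := H) π) ≤ ∑ τ : Fin H → O × A, D.prob π τ * H :=
          Finset.sum_le_sum fun τ _ =>
            mul_le_mul_of_nonneg_left (cumReward_mem hr τ).2 (D.prob_nonneg _ _)
      _ = H := by rw [← Finset.sum_mul, D.sum_prob, one_mul]

theorem Learner.outputValue_eq (alg : Learner U H) (D : Dynamics O A) (r : List (O × A) → ℝ)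
    {K : ℕ} (ω : Fin K → RoundData U H) :
    alg.outputValue D r ω = (1 / (K : ℝ)) * ∑ k ∈ Finset.range K,
      value r (D.prob (h := H) (alg ((List.ofFn ω).take k)).2) := by
  simp only [Learner.outputValue, value, Dynamics.mixProb, Learner.chosen]
  rw [Finset.sum_range, Finset.sum_comm, Finset.mul_sum]
  refine Finset.sum_congr rfl fun τ _ => ?_
  rw [mul_assoc, Finset.sum_mul]

/-! ### Performance of CRANE on typical data -/

theorem card_episodeIdx_le : Fintype.card (EpisodeIdx U H) ≤ H * maxActionSeqs U H := by
  rw [Fintype.card_sigma]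
  calc ∑ h : Fin H, Fintype.card (actionSeqs U (h + 1)) ≤ ∑ h : Fin H, maxActionSeqs U H := by
        refine Finset.sum_le_sum fun h _ => ?_
        rw [Fintype.card_coe]
        exact card_le_maxActionSeqs (by omega) (by omega)
    _ = _ := by simp

variable {D : Dynamics O A} {F : Set (Params U)} {α β T εb S : ℝ} {r : List (O × A) → ℝ} {n K : ℕ}

/-- The regret bound for data `ω` that are typical for all upper brackets of models. -/
theorem Learner.IsCRANE.optValue_sub_le {alg : Learner U H} (halg : alg.IsCRANE r F β K)
    (hr01 : ∀ τ, 0 ≤ r τ ∧ r τ ≤ 1) (hH : 1 ≤ H) (hα : 0 < α) (hc : D.IsCore H U)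
    (hr : D.Regular H U α) (hU : ∀ o : O, ((some o, []) : Test O A) ∈ U H)
    (hW : WellSpecified F H D α) (hS : SizeBound U H α (D.psrRank H) S) (hK : 1 ≤ K)
    (hβ : 1 ≤ β) (hT : 0 < T) (hTβ : Real.log T ≤ β)
    (hεb : K * Fintype.card (EpisodeIdx U H) * εb ≤ 1) (hεb0 : 0 ≤ εb)
    {g₁ g₂ : Fin n → Policy O A → (Fin H → O × A) → ℝ}
    (hg : ∀ i π, ∑ τ, |g₁ i π τ - g₂ i π τ| ≤ εb)
    (hgF : ∀ f ∈ F, ∃ i, ∀ π τ, g₁ i π τ ≤ f.prob π τ ∧ f.prob π τ ≤ g₂ i π τ)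
    {ω : Fin K → RoundData U H} (hω : alg.runProb D ω ≠ 0)
    (htyp : ∀ f ∈ F, ∀ i, (∀ π τ, g₁ i π τ ≤ f.prob π τ ∧ f.prob π τ ≤ g₂ i π τ) →
      ∀ k < K, alg.Typical D T (g₂ i) ((List.ofFn ω).take k)) :
    D.optValue r H - alg.outputValue D r ω ≤ 1 / K * (H * (4 * S ^ 2 *
      (√(92 * S ^ 16 * (10 * β)) * √(K * (2 * (S * Real.log (S + K))))))) := by
  obtain ⟨⟨fs, hfs, hind⟩, hF⟩ := hW
  have hnn : ∀ f ∈ F, ∀ π (τ : Fin H → O × A), 0 ≤ f.prob π τ := by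
    intro f hf π τ
    obtain ⟨D', hD', _⟩ := hF f hf
    rw [hD']; exact D'.prob_nonneg _ _
  set L := List.ofFn ω with hL
  have hlen : ∀ k < K, (L.take k).length = k := fun k hk => by
    rw [List.length_take, hL, List.length_ofFn]; omega
  have hpos : ∀ k, 0 < alg.lik (fun π => D.prob π) (L.take k) := by
    intro k
    refine lt_of_le_of_ne (alg.lik_nonneg (fun π τ => D.prob_nonneg π τ) _) fun h0 => hω ?_
    rw [alg.runProb_eq_lik, ← hL, ← List.take_append_drop k L, Learner.lik, pathProd_append]
    change alg.lik (fun π => D.prob π) (L.take k) * _ = 0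
    rw [← h0, zero_mul]
  -- the true parameters are in all confidence sets
  have hmem : ∀ k < K, fs ∈ alg.confSet F β (L.take k) := by
    intro k hk
    refine alg.mem_confSet hfs hind hnn hT hTβ fun f hf => ?_
    obtain ⟨i, hi⟩ := hgF f hf
    exact (alg.lik_mono (hnn f hf) (fun π τ => (hi π τ).2) _).trans (htyp f hf i hi k hk).1
  have hchoice : ∀ k, ∃ D' : Dynamics O A, D'.IsCore H U ∧ D'.Regular H U α ∧
      (k < K → (alg (L.take k)).1.Induces H D') := by
    intro k
    by_cases hk : k < K
    · obtain ⟨D', h1, h2, h3⟩ := hF _ (halg (L.take k) (by rw [hlen k hk]; exact hk)).1.1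
      exact ⟨D', h2, h3, fun _ => h1⟩
    · exact ⟨D, hc, hr, fun h => absurd h hk⟩
  choose D' hc' hr' hind' using hchoice
  set π : ℕ → Policy O A := fun k => (alg (L.take k)).2 with hπ
  have hhell : ∀ k < K, ∑ j ∈ Finset.range k, exploreHell D (D' k) U H (π j) ≤ 10 * β := by
    intro k hk
    have hconf := (halg (L.take k) (by rw [hlen k hk]; exact hk)).1
    obtain ⟨i, hi⟩ := hgF _ hconf.1
    have h1 := alg.sum_exploreHell_le (D' := D' k) (f := fun π => (alg (L.take k)).1.prob π)
      (g := g₂ i) (εb := εb) hTβ (hind' k hk) (fun π τ => (hi π τ).2)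
      (fun π => (Finset.sum_le_sum fun τ _ => by
        refine le_trans ?_ (neg_le_abs (g₁ i π τ - g₂ i π τ))
        linarith [(hi π τ).1]).trans (hg i π))
      (htyp _ hconf.1 i hi k hk) (hpos k)
      (alg.lik_le_of_mem_confSet hfs hind hnn hconf (hpos k)) (by
        rw [hlen k hk]
        refine le_trans ?_ hεb
        have : (k : ℝ) ≤ K := by exact_mod_cast hk.le
        gcongr)
    rw [hlen k hk] at h1
    refine le_trans (le_of_eq (Finset.sum_congr rfl fun j hj => ?_)) (h1.trans (by linarith))
    rw [List.take_take, min_eq_left (Finset.mem_range.1 hj).le]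
  have hreg := sum_abs_prob_sub_le_sqrt hS hH hα hc hr hU D' hc' hr' π hK (β := 10 * β)
    (by linarith) hhell
  -- optimism: the chosen pair beats the true parameters with any policy
  have hopt : ∀ k < K, D.optValue r H ≤ value r ((D' k).prob (h := H) (π k)) := by
    intro k hk
    refine ciSup_le fun π' => ?_
    have h1 := (halg (L.take k) (by rw [hlen k hk]; exact hk)).2 fs (hmem k hk) π'
    have h2 : (fs.prob π' : (Fin H → O × A) → ℝ) = D.prob π' := funext (hind π')
    have h3 : ((alg (L.take k)).1.prob (π k) : (Fin H → O × A) → ℝ) = (D' k).prob (π k) :=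
      funext (hind' k hk (π k))
    rw [h2] at h1
    rw [← h3]
    exact h1
  have hKr : (0 : ℝ) < K := by exact_mod_cast hK
  rw [alg.outputValue_eq, ← hL]
  have h1 : ∑ k ∈ Finset.range K, (D.optValue r H - value r (D.prob (h := H) (π k))) ≤
      H * ∑ k ∈ Finset.range K, ∑ τ : Fin H → O × A, |(D' k).prob (π k) τ - D.prob (π k) τ| := by
    rw [Finset.mul_sum]
    refine Finset.sum_le_sum fun k hk => ?_
    exact (sub_le_sub_right (hopt k (Finset.mem_range.1 hk)) _).trans (value_sub_le hr01 _ _)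
  rw [Finset.sum_sub_distrib, Finset.sum_const, Finset.card_range, nsmul_eq_mul] at h1
  have h2 : D.optValue r H - 1 / (K : ℝ) * ∑ k ∈ Finset.range K,
      value r (D.prob (h := H) (alg (L.take k)).2) = 1 / K * (K * D.optValue r H -
        ∑ k ∈ Finset.range K, value r (D.prob (h := H) (π k))) := by
    rw [mul_sub, ← mul_assoc, one_div_mul_cancel hKr.ne', one_mul]
  rw [h2]
  refine mul_le_mul_of_nonneg_left (h1.trans ?_) (by positivity)
  exact mul_le_mul_of_nonneg_left hreg (by positivity)

open Classical in
/-- The data are typical for all upper brackets with probability at least `1 - δ`. -/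
theorem Learner.one_sub_le_sum_of_typical (alg : Learner U H) (hW : WellSpecified F H D α)
    {δ : ℝ} (hT : 0 < T) (hTδ : n * K * (4 / T) ≤ δ)
    (hεb : K * Fintype.card (EpisodeIdx U H) * εb ≤ 1) (hεb0 : 0 ≤ εb)
    {g₁ g₂ : Fin n → Policy O A → (Fin H → O × A) → ℝ}
    (hg : ∀ i π, ∑ τ, |g₁ i π τ - g₂ i π τ| ≤ εb) (G : Set (Fin K → RoundData U H))
    (hG : ∀ ω, alg.runProb D ω ≠ 0 →
      (∀ f ∈ F, ∀ i, (∀ π τ, g₁ i π τ ≤ f.prob π τ ∧ f.prob π τ ≤ g₂ i π τ) →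
        ∀ k < K, alg.Typical D T (g₂ i) ((List.ofFn ω).take k)) → ω ∈ G) :
    1 - δ ≤ ∑ ω, G.indicator (alg.runProb D) ω := by
  set p : Policy O A → (Fin H → O × A) → ℝ := fun π => D.prob π with hp
  have hrun0 : ∀ ω : Fin K → RoundData U H, 0 ≤ alg.runProb D ω := fun ω => by
    rw [alg.runProb_eq_lik]; exact alg.lik_nonneg (fun π τ => D.prob_nonneg π τ) _
  have hsum1 : ∑ ω : Fin K → RoundData U H, alg.runProb D ω = 1 := by
    simp only [alg.runProb_eq_lik]
    exact lsum_pathProd_eq_one (alg.sum_stepLik_eq_one D) K []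
  set I : Finset (Fin n) := Finset.univ.filter fun i =>
    ∃ f ∈ F, ∀ π τ, g₁ i π τ ≤ f.prob π τ ∧ f.prob π τ ≤ g₂ i π τ with hI
  set bad : Fin n → ℕ → (Fin K → RoundData U H) → ℝ := fun i k ω =>
    if ¬ alg.Typical D T (g₂ i) ((List.ofFn ω).take k) then alg.runProb D ω else 0 with hbad
  have hbad0 : ∀ i k ω, 0 ≤ bad i k ω := fun i k ω => by
    simp only [hbad]; split_ifs
    exacts [le_rfl, hrun0 ω]
  have hbad1 : ∀ i ∈ I, ∀ k ∈ Finset.range K, ∑ ω, bad i k ω ≤ 4 / T := by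
    intro i hi k hk
    obtain ⟨f, hf, hfi⟩ := (Finset.mem_filter.1 hi).2
    obtain ⟨D', hD', _⟩ := hW.2 f hf
    have hg0 : ∀ π τ, 0 ≤ g₂ i π τ := fun π τ => by
      refine le_trans ?_ (hfi π τ).2
      rw [hD']; exact D'.prob_nonneg _ _
    have hg1 : ∀ π, ∑ τ, g₂ i π τ ≤ 1 + εb := by
      intro π
      rw [← D'.sum_prob π H]
      refine le_trans ?_ (add_le_add_right (hg i π) _)
      rw [← Finset.sum_add_distrib]
      refine Finset.sum_le_sum fun τ _ => ?_
      rw [← hD' π τ]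
      linarith [(hfi π τ).1, neg_le_abs (g₁ i π τ - g₂ i π τ)]
    have h1 := alg.lsum_not_typical_le D hT hεb0 hg0 hg1 (Finset.mem_range.1 hk).le hεb
    refine le_trans (le_of_eq ?_) h1
    refine Finset.sum_congr rfl fun ω _ => ?_
    simp only [hbad, alg.runProb_eq_lik]
  -- a union bound over the brackets that contain a model, and over the iterations
  have hpt : ∀ ω, alg.runProb D ω - ∑ i ∈ I, ∑ k ∈ Finset.range K, bad i k ω ≤
      G.indicator (alg.runProb D) ω := by
    intro ω
    have hb : 0 ≤ ∑ i ∈ I, ∑ k ∈ Finset.range K, bad i k ω :=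
      Finset.sum_nonneg fun _ _ => Finset.sum_nonneg fun _ _ => hbad0 _ _ _
    by_cases hωG : ω ∈ G
    · rw [Set.indicator_of_mem hωG]; linarith
    · rw [Set.indicator_of_notMem hωG]
      by_cases h0 : alg.runProb D ω = 0
      · rw [h0]; linarith
      have h2 : ¬ _ := fun h => hωG (hG ω h0 h)
      push Not at h2
      obtain ⟨f, hf, i, hfi, k, hk, hnt⟩ := h2
      have h3 : bad i k ω = alg.runProb D ω := by simp only [hbad]; rw [if_pos hnt]
      have h4 : bad i k ω ≤ ∑ i ∈ I, ∑ k ∈ Finset.range K, bad i k ω :=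
        (Finset.single_le_sum (f := fun k => bad i k ω) (fun _ _ => hbad0 _ _ _)
          (Finset.mem_range.2 hk)).trans
        (Finset.single_le_sum (f := fun i => ∑ k ∈ Finset.range K, bad i k ω)
          (fun _ _ => Finset.sum_nonneg fun _ _ => hbad0 _ _ _)
          (Finset.mem_filter.2 ⟨Finset.mem_univ i, f, hf, hfi⟩))
      linarith
  have h5 : ∑ ω, ∑ i ∈ I, ∑ k ∈ Finset.range K, bad i k ω ≤ δ := by
    rw [Finset.sum_comm]
    calc ∑ i ∈ I, ∑ ω, ∑ k ∈ Finset.range K, bad i k ω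
        ≤ ∑ i ∈ I, ∑ k ∈ Finset.range K, 4 / T := by
          refine Finset.sum_le_sum fun i hi => ?_
          rw [Finset.sum_comm]
          exact Finset.sum_le_sum fun k hk => hbad1 i hi k hk
      _ = I.card * (K * (4 / T)) := by simp
      _ ≤ n * (K * (4 / T)) := by
          have : (I.card : ℝ) ≤ n := by
            exact_mod_cast (Finset.card_le_univ I).trans (by simp)
          gcongr
      _ = n * K * (4 / T) := by ring
      _ ≤ δ := hTδ
  calc 1 - δ ≤ ∑ ω, alg.runProb D ω - ∑ ω, ∑ i ∈ I, ∑ k ∈ Finset.range K, bad i k ω := by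
        rw [hsum1]; linarith
    _ = ∑ ω, (alg.runProb D ω - ∑ i ∈ I, ∑ k ∈ Finset.range K, bad i k ω) :=
        Finset.sum_sub_distrib _ _ |>.symm
    _ ≤ _ := Finset.sum_le_sum fun ω _ => hpt ω

end Value

/-! ### The number of iterations -/

/-- A bound `K ε² ≥ poly(Q, log(1 / ε))` absorbs the logarithms of `K`. -/
theorem mul_one_add_log_sq_le {K ε Q : ℝ} (hK : 0 < K) (hε : 0 < ε) (hQ : 1 ≤ Q)
    (h : (16 * Q * (2 + Real.log (1 / ε) ^ 2) ^ 2) ^ 2 ≤ K * ε ^ 2) (hlogK : 0 ≤ Real.log K) :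
    Q * (1 + Real.log K) ^ 2 ≤ K * ε ^ 2 := by
  set L := Real.log (1 / ε) with hL
  set y := K * ε ^ 2 with hy
  have hB : 1 ≤ 16 * Q * (2 + L ^ 2) ^ 2 := by
    have h1 : 1 ≤ (2 + L ^ 2) ^ 2 := one_le_pow₀ (by nlinarith [sq_nonneg L])
    nlinarith
  have hy1 : 1 ≤ y := (one_le_pow₀ hB).trans h
  set s := √(√y) with hs
  have hs2 : s ^ 2 = √y := Real.sq_sqrt (Real.sqrt_nonneg _)
  have hs4 : s ^ 4 = y := by
    rw [show s ^ 4 = (s ^ 2) ^ 2 by ring, hs2, Real.sq_sqrt (by linarith)]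
  have hspos : 0 < s := Real.sqrt_pos.2 (Real.sqrt_pos.2 (by linarith))
  have hBs : 16 * Q * (2 + L ^ 2) ^ 2 ≤ s ^ 2 := by
    rw [hs2]; exact Real.le_sqrt_of_sq_le h
  -- with `s = y^(1/4)`, the logarithm of `y` is at most `4 s`, which its square root absorbs
  have hlogy : Real.log y ≤ 4 * (s - 1) := by
    rw [← hs4, Real.log_pow]
    have := Real.log_le_sub_one_of_pos hspos
    push_cast; linarith
  have hlogy0 : 0 ≤ Real.log y := Real.log_nonneg hy1
  have hlogK' : Real.log K = Real.log y + 2 * L := by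
    rw [hy, Real.log_mul hK.ne' (by positivity), Real.log_pow, hL, one_div, Real.log_inv]
    push_cast; ring
  have h1 : 1 + Real.log K ≤ (2 + L ^ 2) * (4 * s) := by
    have h2 : 1 + Real.log K ≤ (2 + L ^ 2) * (1 + Real.log y) := by
      rw [hlogK']
      nlinarith [sq_nonneg (L - 1), mul_nonneg (sq_nonneg L) hlogy0]
    refine h2.trans (mul_le_mul_of_nonneg_left (by linarith) (by positivity))
  calc Q * (1 + Real.log K) ^ 2 ≤ Q * ((2 + L ^ 2) * (4 * s)) ^ 2 := by gcongr
    _ = 16 * Q * (2 + L ^ 2) ^ 2 * s ^ 2 := by ring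
    _ ≤ s ^ 2 * s ^ 2 := by gcongr
    _ = y := by rw [← hs4]; ring

theorem log_add_le {S K : ℝ} (hS : 1 ≤ S) (hK : 1 ≤ K) :
    Real.log (S + K) ≤ 2 * S * (1 + Real.log K) := by
  have hlK : 0 ≤ Real.log K := Real.log_nonneg hK
  have h1 : S + K ≤ 2 * S * K := by nlinarith
  have h2 : Real.log (S + K) ≤ Real.log (2 * S * K) := Real.log_le_log (by linarith) h1
  rw [Real.log_mul (by positivity) (by positivity)] at h2
  have h3 := Real.log_le_sub_one_of_pos (show 0 < 2 * S by linarith)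
  nlinarith

theorem two_mul_add_le {S ℓ x a b c : ℝ} (hS : 1 ≤ S) (hℓ : 0 ≤ ℓ) (hx : 0 ≤ x)
    (ha : a ≤ 48 * S ^ 7 * (1 + ℓ)) (hb : b ≤ S) (hc : c ≤ S) :
    2 * (a + ℓ + b + c + x) ≤ 102 * S ^ 7 * (1 + ℓ) * (1 + x) := by
  have hS7 : 1 ≤ S ^ 7 := one_le_pow₀ hS
  have hSS7 : S ≤ S ^ 7 := le_self_pow₀ hS (by norm_num)
  generalize S ^ 7 = p at *
  have h1 : ℓ ≤ p * ℓ := le_mul_of_one_le_left hℓ hS7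
  have h2 : x ≤ p * x := le_mul_of_one_le_left hx hS7
  have h3 : 0 ≤ p * ℓ := by positivity
  have h4 : 0 ≤ p * x := by positivity
  have h5 : 0 ≤ p * ℓ * x := by positivity
  have h6 : 102 * p * (1 + ℓ) * (1 + x) =
    102 * p + 102 * (p * ℓ) + 102 * (p * x) + 102 * (p * ℓ * x) := by ring
  have h7 : 48 * p * (1 + ℓ) = 48 * p + 48 * (p * ℓ) := by ring
  linarith

/-- The regret bound is at most `ε` once `K ε²` dominates the product of the factors under the
square roots. -/
theorem regret_bound_le {K S β H ε ℓ x : ℝ} (hK : 1 ≤ K) (hS : 1 ≤ S) (hε : 0 < ε)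
    (hH : H ≤ S) (hx : 0 ≤ x) (hℓ : 0 ≤ ℓ) (hβ0 : 0 ≤ β)
    (hβ : β ≤ 102 * S ^ 7 * (1 + ℓ) * (1 + x)) (hlog : Real.log (S + K) ≤ 2 * S * (1 + ℓ))
    (h : 6005760 * S ^ 31 * (1 + x) * (1 + ℓ) ^ 2 ≤ K * ε ^ 2) :
    1 / K * (H * (4 * S ^ 2 *
      (√(92 * S ^ 16 * (10 * β)) * √(K * (2 * (S * Real.log (S + K))))))) ≤ ε := by
  have hK0 : 0 < K := by linarith
  have hS0 : 0 < S := by linarith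
  have hl0 : 0 ≤ Real.log (S + K) := Real.log_nonneg (by linarith)
  have h1 : √(92 * S ^ 16 * (10 * β)) * √(K * (2 * (S * Real.log (S + K)))) ≤
      K * ε / (4 * S ^ 3) := by
    rw [← Real.sqrt_mul (by positivity)]
    refine Real.sqrt_le_iff.2 ⟨by positivity, ?_⟩
    rw [div_pow, le_div_iff₀ (by positivity)]
    calc 92 * S ^ 16 * (10 * β) * (K * (2 * (S * Real.log (S + K)))) * (4 * S ^ 3) ^ 2
        = 29440 * K * S ^ 23 * (β * Real.log (S + K)) := by ring
      _ ≤ 29440 * K * S ^ 23 * (102 * S ^ 7 * (1 + ℓ) * (1 + x) * (2 * S * (1 + ℓ))) := by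
          gcongr
      _ = K * (6005760 * S ^ 31 * (1 + x) * (1 + ℓ) ^ 2) := by ring
      _ ≤ K * (K * ε ^ 2) := by gcongr
      _ = (K * ε) ^ 2 := by ring
  calc 1 / K * (H * (4 * S ^ 2 *
      (√(92 * S ^ 16 * (10 * β)) * √(K * (2 * (S * Real.log (S + K)))))))
      ≤ 1 / K * (S * (4 * S ^ 2 * (K * ε / (4 * S ^ 3)))) := by gcongr
    _ = ε := by field_simp

section Final

variable {O A : Type*} [Fintype O] [Fintype A] [DecidableEq O] [DecidableEq A] [Nonempty A]
variable {U : ℕ → Finset (Test O A)} {H : ℕ}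

/-- At the bracket size used by CRANE, the rate depends on `K` only through a logarithm. -/
theorem tabularRate_le {α S : ℝ} {K : ℕ} (hα : 0 < α) (hK : 1 ≤ K) (hS : 1 ≤ S)
    (hO : (Fintype.card O : ℝ) ≤ S) (hA : (Fintype.card A : ℝ) ≤ S) (hH : (H : ℝ) ≤ S)
    (hU : (maxTests U H : ℝ) ≤ S) (hUA : (maxActionSeqs U H : ℝ) ≤ S) (hαS : 1 / α ≤ S) :
    tabularRate U H α (1 / (K * H * maxActionSeqs U H)) ≤ 8 * S ^ 7 * (1 + Real.log K) := by
  have hK' : (1 : ℝ) ≤ K := by exact_mod_cast hK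
  have hlK : 0 ≤ Real.log K := Real.log_nonneg hK'
  set X : ℝ := H * Fintype.card O * Fintype.card A * maxActionSeqs U H * maxTests U H /
    (α * (1 / (K * H * maxActionSeqs U H))) with hX
  have hXeq : X = H * Fintype.card O * Fintype.card A * maxActionSeqs U H * maxTests U H *
      ((1 / α) * (K * H * maxActionSeqs U H)) := by
    rw [hX, div_eq_mul_inv, mul_inv, one_div, one_div, inv_inv]
  have hX0 : 0 ≤ X := by rw [hXeq]; positivity
  have hXle : X ≤ S ^ 8 * K := by
    rw [hXeq]
    calc _ ≤ S * S * S * S * S * (S * (K * S * S)) := by gcongr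
      _ = S ^ 8 * K := by ring
  have hlog : Real.log X ≤ 8 * S * (1 + Real.log K) := by
    have h1 : Real.log X ≤ Real.log (S ^ 8 * K) := by
      rcases hX0.eq_or_lt with h0 | h0
      · rw [← h0, Real.log_zero]
        exact Real.log_nonneg (one_le_mul_of_one_le_of_one_le (one_le_pow₀ hS) hK')
      · exact Real.log_le_log h0 hXle
    rw [Real.log_mul (by positivity) (by positivity), Real.log_pow] at h1
    have h2 := Real.log_le_sub_one_of_pos (show 0 < S by linarith)
    push_cast at h1
    nlinarith
  have hR : tabularRate U H α (1 / (K * H * maxActionSeqs U H)) =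
      (maxTests U H : ℝ) ^ 2 * Fintype.card O * Fintype.card A * (H : ℝ) ^ 2 * Real.log X := rfl
  rw [hR]
  refine (mul_le_mul_of_nonneg_left hlog (by positivity)).trans ?_
  calc _ ≤ S ^ 2 * S * S * S ^ 2 * (8 * S * (1 + Real.log K)) := by gcongr
    _ = _ := by ring

/-- The sum of the size parameters, in the variables of the sample complexity polynomial. -/
noncomputable def sizePoly : MvPolynomial (Fin 9) ℝ :=
  1 + MvPolynomial.X 0 + MvPolynomial.X 1 + MvPolynomial.X 2 + MvPolynomial.X 3 +
    MvPolynomial.X 4 + MvPolynomial.X 5 + MvPolynomial.X 6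

/-- The sample complexity polynomial; the last two variables stand for `log (1 / δ)` and
`log (1 / ε)`. -/
noncomputable def samplePoly : MvPolynomial (Fin 9) ℝ :=
  (16 * (6005760 * sizePoly ^ 31 * (1 + MvPolynomial.X 7)) * (2 + MvPolynomial.X 8 ^ 2) ^ 2) ^ 2

theorem eval_samplePoly (a b c d e f g x y : ℝ) :
    MvPolynomial.eval ![a, b, c, d, e, f, g, x, y] samplePoly =
      (16 * (6005760 * (1 + a + b + c + d + e + f + g) ^ 31 * (1 + x)) * (2 + y ^ 2) ^ 2) ^ 2 := by
  simp only [samplePoly, sizePoly, map_mul, map_pow, map_add, map_one, MvPolynomial.eval_X,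
    map_ofNat]
  rfl

variable {D : Dynamics O A} {F : Set (Params U)} {α ε δ N : ℝ} {r : List (O × A) → ℝ} {K : ℕ}

/-- All values lie in `[0, H]`, so for `H ≤ ε` every output is `ε`-optimal. -/
theorem Learner.optValue_sub_le_of_horizon_le (alg : Learner U H)
    (hr : ∀ τ, 0 ≤ r τ ∧ r τ ≤ 1) (hε : (H : ℝ) ≤ ε) (ω : Fin K → RoundData U H) :
    D.optValue r H - ε ≤ alg.outputValue D r ω := by
  have h1 : D.optValue r H ≤ H := ciSup_le fun π => (value_prob_mem hr D π).2
  have h2 : 0 ≤ alg.outputValue D r ω := by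
    rw [alg.outputValue_eq]
    exact mul_nonneg (by positivity) (Finset.sum_nonneg fun _ _ => (value_prob_mem hr D _).1)
  linarith

/-- The output of CRANE is `ε`-optimal with probability at least `1 - δ`. -/
theorem Learner.IsCRANE.one_sub_le_sum {alg : Learner U H} (hH : 1 ≤ H)
    (hr01 : ∀ τ, 0 ≤ r τ ∧ r τ ≤ 1) (hα : 0 < α) (hc : D.IsCore H U) (hr : D.Regular H U α)
    (hU : ∀ o : O, ((some o, []) : Test O A) ∈ U H) (hW : WellSpecified F H D α)
    (hF : ∀ f ∈ F, f.Bounded H) (hδ : 0 < δ) (hδ1 : δ ≤ 1) (hε : 0 < ε) (hK : 1 ≤ K)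
    {S εb : ℝ}
    (hSdef : S = 1 + (D.psrRank H : ℝ) + maxActionSeqs U H + 1 / α + maxTests U H +
      Fintype.card O + Fintype.card A + H)
    (hKε : (16 * (6005760 * S ^ 31 * (1 + Real.log (1 / δ))) *
      (2 + Real.log (1 / ε) ^ 2) ^ 2) ^ 2 ≤ K * ε ^ 2)
    (hεb : εb = 1 / (K * H * maxActionSeqs U H))
    (hN : ((bracketNumber F H εb).toNat : ℝ) ≤ N)
    (hN' : Real.log N ≤ 6 * tabularRate U H α εb)
    (halg : alg.IsCRANE r F (2 * Real.log (N * K * H * maxActionSeqs U H / δ)) K) :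
    1 - δ ≤ ∑ ω : Fin K → RoundData U H,
      Set.indicator {ω | D.optValue r H - ε ≤ alg.outputValue D r ω} (alg.runProb D) ω := by
  obtain ⟨-, -, hUA1, -⟩ := size_facts hH hα hc hr
  have hαinv : 0 < 1 / α := by positivity
  have hd0 : (0 : ℝ) ≤ D.psrRank H := Nat.cast_nonneg _
  have hUA0 : (0 : ℝ) ≤ maxActionSeqs U H := Nat.cast_nonneg _
  have hU0 : (0 : ℝ) ≤ maxTests U H := Nat.cast_nonneg _
  have hO0 : (0 : ℝ) ≤ Fintype.card O := Nat.cast_nonneg _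
  have hA0 : (0 : ℝ) ≤ Fintype.card A := Nat.cast_nonneg _
  have hH0 : (0 : ℝ) ≤ H := Nat.cast_nonneg _
  have hS1 : 1 ≤ S := by linarith
  have hdS : (D.psrRank H : ℝ) ≤ S := by linarith
  have hUAS : (maxActionSeqs U H : ℝ) ≤ S := by linarith
  have hαS : 1 / α ≤ S := by linarith
  have hUS : (maxTests U H : ℝ) ≤ S := by linarith
  have hOS : (Fintype.card O : ℝ) ≤ S := by linarith
  have hAS : (Fintype.card A : ℝ) ≤ S := by linarith
  have hHS : (H : ℝ) ≤ S := by linarith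
  have hS : SizeBound U H α (D.psrRank H) S :=
    ⟨hOS, hAS, fun h h1 hh => le_trans (by exact_mod_cast card_le_maxTests h1 hh) hUS,
      fun h h1 hh => le_trans (by exact_mod_cast card_le_maxActionSeqs h1 hh) hUAS,
      hαS, hHS, hdS, hS1⟩
  have hUA1' : (1 : ℝ) ≤ maxActionSeqs U H := by exact_mod_cast hUA1
  have hH1 : (1 : ℝ) ≤ H := by exact_mod_cast hH
  have hK1 : (1 : ℝ) ≤ K := by exact_mod_cast hK
  set u : ℝ := (maxActionSeqs U H : ℝ) with hu
  have hprod : (1 : ℝ) ≤ K * H * u :=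
    one_le_mul_of_one_le_of_one_le (one_le_mul_of_one_le_of_one_le hK1 hH1) hUA1'
  have hεb0 : 0 < εb := by rw [hεb]; positivity
  have hεb1 : εb ≤ 1 := by
    rw [hεb, div_le_one (by linarith)]; exact hprod
  obtain ⟨n, hn, ⟨g₁, g₂, hg, hgF⟩, hn0, -⟩ := exists_bracketNumber_le hH hα hc hr hW hF hεb0 hεb1
  rw [hn, ENat.toNat_natCast] at hN
  have hn1 : (1 : ℝ) ≤ n := by exact_mod_cast hn0
  have hN1 : 1 ≤ N := hn1.trans hN
  have hx : 0 ≤ Real.log (1 / δ) := Real.log_nonneg (by rw [le_div_iff₀ hδ]; linarith)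
  have hlK : 0 ≤ Real.log K := Real.log_nonneg hK1
  have hcard : K * Fintype.card (EpisodeIdx U H) * εb ≤ 1 := by
    rw [hεb, mul_one_div, div_le_one (by linarith), mul_assoc]
    have h1 : ((Fintype.card (EpisodeIdx U H) : ℕ) : ℝ) ≤ H * u := by
      rw [hu]; exact_mod_cast card_episodeIdx_le (U := U) (H := H)
    gcongr
  -- the level `T = 4 n K / δ` makes the union bound over `n` brackets and `K` iterations equal to `δ`
  have hT : (0 : ℝ) < 4 * n * K / δ := by positivity
  have hTδ : n * K * (4 / (4 * n * K / δ)) ≤ δ := le_of_eq (by field_simp)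
  refine alg.one_sub_le_sum_of_typical hW hT hTδ hcard hεb0.le hg _ fun ω hω htyp => ?_
  rcases le_total (H : ℝ) ε with hHε | hHε
  · exact alg.optValue_sub_le_of_horizon_le hr01 hHε ω
  set x := Real.log (1 / δ) with hxdef
  set Q : ℝ := 6005760 * S ^ 31 * (1 + x) with hQ
  have hQS : S ≤ Q := by
    rw [hQ]
    have h1 : S ≤ S ^ 31 := le_self_pow₀ hS1 (by norm_num)
    have h2 : S ^ 31 ≤ S ^ 31 * (1 + x) := le_mul_of_one_le_right (by positivity) (by linarith)
    linarith
  have hmain := mul_one_add_log_sq_le (by linarith) hε (hS1.trans hQS) hKε hlK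
  -- since `ε ≤ H ≤ S`, the assumption on `K` also makes `K` larger than an absolute constant
  have hK4 : (4 : ℝ) ≤ K := by
    have h1 : (2 * S) ^ 2 ≤ (16 * Q * (2 + Real.log (1 / ε) ^ 2) ^ 2) ^ 2 := by
      have h2 : 1 ≤ (2 + Real.log (1 / ε) ^ 2) ^ 2 :=
        one_le_pow₀ (by linarith [sq_nonneg (Real.log (1 / ε))])
      have h3 : 16 * Q * 1 ≤ 16 * Q * (2 + Real.log (1 / ε) ^ 2) ^ 2 :=
        mul_le_mul_of_nonneg_left h2 (by linarith)
      exact pow_le_pow_left₀ (by linarith) (by linarith) 2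
    have h2 : K * ε ^ 2 ≤ K * S ^ 2 := by
      have := hHε.trans hHS
      gcongr
    have h3 : 4 * S ^ 2 ≤ K * S ^ 2 := by linarith [h1.trans (hKε.trans h2)]
    exact le_of_mul_le_mul_right h3 (by positivity)
  set W : ℝ := N * K * H * u / δ with hWdef
  have hWK : n * K / δ ≤ W := by
    rw [hWdef]
    refine div_le_div_of_nonneg_right ?_ hδ.le
    calc (n : ℝ) * K = n * K * 1 * 1 := by ring
      _ ≤ N * K * H * u := by gcongr
  have hKW : (K : ℝ) ≤ n * K / δ := by
    rw [le_div_iff₀ hδ]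
    calc (K : ℝ) * δ ≤ K * 1 := by gcongr
      _ ≤ K * n := by gcongr
      _ = n * K := mul_comm _ _
  have hW4 : 4 ≤ W := hK4.trans (hKW.trans hWK)
  have hTβ : Real.log (4 * n * K / δ) ≤ 2 * Real.log W := by
    have h1 : 4 * n * K / δ ≤ W ^ 2 := by
      calc 4 * n * K / δ = 4 * (n * K / δ) := by ring
        _ ≤ W * W := mul_le_mul hW4 hWK (by positivity) (by linarith)
        _ = W ^ 2 := (sq W).symm
    refine (Real.log_le_log hT h1).trans (le_of_eq ?_)
    rw [Real.log_pow]; norm_num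
  have hβ1 : 1 ≤ 2 * Real.log W := by
    have h1 : Real.log (2 ^ 2) ≤ Real.log W := Real.log_le_log (by norm_num) (by linarith)
    rw [Real.log_pow] at h1
    have := Real.log_two_gt_d9
    push_cast at h1
    linarith
  have hbound := halg.optValue_sub_le hr01 hH hα hc hr hU hW hS hK hβ1 hT hTβ hcard hεb0.le hg hgF
    hω htyp
  have hlogH : Real.log H ≤ S := (Real.log_le_sub_one_of_pos (by linarith)).trans (by linarith)
  have hlogu : Real.log u ≤ S := (Real.log_le_sub_one_of_pos (by linarith)).trans (by linarith)
  have hrate : Real.log N ≤ 48 * S ^ 7 * (1 + Real.log K) := by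
    have h2 : tabularRate U H α εb ≤ 8 * S ^ 7 * (1 + Real.log K) := by
      rw [hεb]; exact tabularRate_le hα hK hS1 hOS hAS hHS hUS hUAS hαS
    linarith
  have hlogW : Real.log W = Real.log N + Real.log K + Real.log H + Real.log u + x := by
    rw [hWdef, hxdef, Real.log_div (by positivity) hδ.ne', Real.log_mul (by positivity)
      (by positivity), Real.log_mul (by positivity) (by positivity),
      Real.log_mul (by positivity) (by positivity), one_div, Real.log_inv]
    ring
  have hβle : 2 * Real.log W ≤ 102 * S ^ 7 * (1 + Real.log K) * (1 + x) := by
    rw [hlogW]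
    exact two_mul_add_le hS1 hlK hx hrate hlogH hlogu
  have hfin := hbound.trans (regret_bound_le hK1 hS1 hε hHS hx hlK (by linarith) hβle
    (log_add_le hS1 hK1) hmain)
  change D.optValue r H - ε ≤ alg.outputValue D r ω
  linarith

end Final

end PSR

theorem corollary2 :
    ∃ (c C : ℝ) (P : MvPolynomial (Fin 9) ℝ), 0 < c ∧ 0 < C ∧
      ∀ (O A : Type*) [Fintype O] [DecidableEq O] [Fintype A] [DecidableEq A] [Nonempty A]
        (H : ℕ) (U : ℕ → Finset (PSR.Test O A)) (D : PSR.Dynamics O A)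
        (r : List (O × A) → ℝ) (F : Set (PSR.Params U)) (α : ℝ),
        1 ≤ H → (∀ τ, 0 ≤ r τ ∧ r τ ≤ 1) → 0 < α →
        D.IsCore H U → D.Regular H U α →
        (∀ o : O, ((some o, []) : PSR.Test O A) ∈ U H) →
        PSR.WellSpecified F H D α →
        (∀ f ∈ F, f.Bounded H) →
        (∀ e : ℝ, 0 < e → e ≤ 1 →
          ∃ n : ℕ, PSR.bracketNumber F H e = n ∧
            Real.log n ≤ C * PSR.tabularRate U H α e) ∧
        ∀ (δ ε : ℝ) (K : ℕ), 0 < δ → δ ≤ 1 → 0 < ε → 1 ≤ K →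
          (1 / ε ^ 2) * MvPolynomial.eval
            ![(D.psrRank H : ℝ), (PSR.maxActionSeqs U H : ℝ), 1 / α, (PSR.maxTests U H : ℝ),
              (Fintype.card O : ℝ), (Fintype.card A : ℝ), (H : ℝ),
              Real.log (1 / δ), Real.log (1 / ε)] P ≤ K →
          ∀ (εb N : ℝ), εb = 1 / (K * H * PSR.maxActionSeqs U H) →
            ((PSR.bracketNumber F H εb).toNat : ℝ) ≤ N →
            Real.log N ≤ C * PSR.tabularRate U H α εb →
            ∀ alg : PSR.Learner U H,
              alg.IsCRANE r F (c * Real.log (N * K * H * PSR.maxActionSeqs U H / δ)) K →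
              1 - δ ≤ ∑ ω : Fin K → PSR.RoundData U H,
                Set.indicator {ω | D.optValue r H - ε ≤ alg.outputValue D r ω}
                  (alg.runProb D) ω := by
  refine ⟨2, 6, PSR.samplePoly, by norm_num, by norm_num, ?_⟩
  intro O A _ _ _ _ _ H U D r F α hH hr01 hα hc hr hU hW hF
  refine ⟨fun e he he1 => ?_, ?_⟩
  · obtain ⟨n, hn, -, -, hlog⟩ := PSR.exists_bracketNumber_le hH hα hc hr hW hF he he1
    exact ⟨n, hn, hlog⟩
  · intro δ ε K hδ hδ1 hε hK hKP εb N hεb hN hN' alg halg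
    rw [PSR.eval_samplePoly, one_div_mul_eq_div, div_le_iff₀ (by positivity)] at hKP
    exact halg.one_sub_le_sum hH hr01 hα hc hr hU hW hF hδ hδ1 hε hK rfl hKP hεb hN hN'
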